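/- **Definitions.** Let $\Sigma$ be a finite alphabet. A *parameterized enumeration problem* is a triple $\Pi=(L,\mathrm{Sol},\kappa)$, where $L\subseteq\Sigma^*$ is decidable, $\mathrm{Sol}$ is a computable function that assigns to each $x\in\Sigma^*$ a finite set $\mathrm{Sol}(x)\subseteq\Sigma^*$ with $\mathrm{Sol}(x)\neq\emptyset\iff x\in L$, and $\kappa:\Sigma^*\to\mathbb N$ is a function (the parameter). Algorithms are multi-stack (equivalently, multi-tape Turing) machine programs with an output tape, and time is the number of steps, where outputting a word $w$ takes $|w|+1$ steps; numbers are given in unary. An algorithm *enumerates a set $S$ with delay $B$* if it halts, outputs each element of $S$ exactly once and nothing else, and the time before the first output, between any two consecutive outputs, and after the last output are each at most $B$. * An *FPT-delay algorithm* for $\Pi$ is an algorithm that, for every $x$, given $x$ and $\kappa(x)$, enumerates $\mathrm{Sol}(x)$ with delay $f(\kappa(x))\cdot(|x|+1)^{c}$, for some computable $f:\mathbb N\to\mathbb N$ and some constant $c$. If $f$ can be taken bounded, $\Pi$ is *solvable with polynomial delay*. * A *PD kernel of size $f$* for $\Pi$, with $f:\mathbb N\to\mathbb N$ computable, is a pair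 of algorithms $(\mathcal A_1,\mathcal A_2)$ such that for every instance $x$: (1) given $x$ and $\kappa(x)$, $\mathcal A_1$ outputs in time polynomial in $|x|+\kappa(x)$ an instance $y$ with $\kappa(y)\le f(\kappa(x))$, $|y|\le f(\kappa(x))$ and $\mathrm{Sol}(y)\ne\emptyset\iff\mathrm{Sol}(x)\neq\emptyset$; (2) given $x,y,\kappa(x),\kappa(y)$ and any $Y\in\mathrm{Sol}(y)$, $\mathcal A_2$ enumerates, with delay polynomial in $|x|+|y|+\kappa(x)+\kappa(y)+|Y|$, a (possibly empty) set $S_Y\subseteq\mathrm{Sol}(x)$, where the sets $S_Y$, $Y\in\mathrm{Sol}(y)$, are pairwise disjoint and have union $\mathrm{Sol}(x)$. The kernel has *constant size* if $f$ is bounded. **Theorem.** Let $\Pi=(L,\mathrm{Sol},\kappa)$ be a parameterized enumeration problem. 1. If $\Pi$ has an FPT-delay algorithm, then it has a PD kernel. Conversely, if $\Pi$ has a PD kernel and $\kappa$ is computable, then $\Pi$ has an FPT-delay algorithm. (So for computable $\kappa$ the two are equivalent.) 2. If $\Pi$ is solvable with polynomial delay, then it has a PD kernel of constant size. Conversely,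 if $\Pi$ has a PD kernel of constant size and $\kappa(x)$ is bounded by a polynomial in $|x|$, then $\Pi$ is solvable with polynomial delay. (So for polynomially bounded $\kappa$ the two are equivalent.) -/

import Mathlib

namespace PDKernel

/-! ### Machine model: multi-stack programs with a step count

A program works on registers `0, 1, 2, …`, each holding a stack of symbols (symbols are named by
natural numbers). A program is a finite text, hence it mentions only finitely many registers and
symbols: symbols enter the registers only from the input and through `push` with a constant, and
are read only by comparing the top of a stack with a constant. So this is a multi-tape
(multi-stack) Turing machine with structured control flow and a write-only output tape. -/

/-- Programs. -/
inductive Prog : Type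
  /-- do nothing -/
  | skip : Prog
  /-- push the symbol `a` on register `r` -/
  | push (r a : ℕ) : Prog
  /-- remove the top symbol of register `r` (no effect if it is empty) -/
  | pop (r : ℕ) : Prog
  /-- output the word that is in register `r` -/
  | emit (r : ℕ) : Prog
  /-- first `p`, then `q` -/
  | seq (p q : Prog) : Prog
  /-- do `p` if the top of register `r` is `o` (`none`: if the register is empty), else `q` -/
  | ifTop (r : ℕ) (o : Option ℕ) (p q : Prog) : Prog
  /-- repeat `p` as long as register `r` is nonempty -/
  | loop (r : ℕ) (p : Prog) : Prog

/-- The contents of the registers; the head of a list is the top of the stack. -/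
abbrev State : Type := ℕ → List ℕ

/-- What happens during a run, in order: `none` is an elementary step without output, `some w` is
a step in which the output of the word `w` is completed. -/
abbrev Trace : Type := List (Option (List ℕ))

/-- `Run p s τ s'`: started in state `s`, the program `p` halts in state `s'` and its run has the
trace `τ`. Each instruction and each test costs one step; the output of a word `w` costs
`|w| + 1` steps. -/
inductive Run : Prog → State → Trace → State → Prop
  | skip (s : State) : Run Prog.skip s [none] s
  | push (r a : ℕ) (s : State) :
      Run (Prog.push r a) s [none] (Function.update s r (a :: s r))
  | pop (r : ℕ) (s : State) :
      Run (Prog.pop r) s [none] (Function.update s r (s r).tail)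
  | emit (r : ℕ) (s : State) :
      Run (Prog.emit r) s (List.replicate (s r).length none ++ [some (s r)]) s
  | seq {p q : Prog} {s s₁ s₂ : State} {τ₁ τ₂ : Trace} :
      Run p s τ₁ s₁ → Run q s₁ τ₂ s₂ → Run (Prog.seq p q) s (τ₁ ++ τ₂) s₂
  | ifTop_true {r : ℕ} {o : Option ℕ} {p q : Prog} {s s' : State} {τ : Trace} :
      (s r).head? = o → Run p s τ s' → Run (Prog.ifTop r o p q) s (none :: τ) s'
  | ifTop_false {r : ℕ} {o : Option ℕ} {p q : Prog} {s s' : State} {τ : Trace} :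
      (s r).head? ≠ o → Run q s τ s' → Run (Prog.ifTop r o p q) s (none :: τ) s'
  | loop_done {r : ℕ} {p : Prog} {s : State} :
      s r = [] → Run (Prog.loop r p) s [none] s
  | loop_step {r : ℕ} {p : Prog} {s s₁ s₂ : State} {τ₁ τ₂ : Trace} :
      s r ≠ [] → Run p s τ₁ s₁ → Run (Prog.loop r p) s₁ τ₂ s₂ →
      Run (Prog.loop r p) s (none :: (τ₁ ++ τ₂)) s₂

/-- The initial state: the `i`-th input word is in register `i`, all other registers are empty. -/
def initState (inputs : List (List ℕ)) : State := fun r => inputs.getD r []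

/-- The words that are output during a run, in order. -/
def Trace.outputs (τ : Trace) : List (List ℕ) := τ.reduceOption

/-- At most `B` consecutive steps without a completed output: this bounds the precalculation time,
the time between any two consecutive outputs, and the postcalculation time. -/
def Trace.DelayLE (τ : Trace) (B : ℕ) : Prop :=
  ∀ n : ℕ, List.replicate n none <:+: τ → n ≤ B

/-- Words over the finite alphabet `{0, …, s - 1}`. -/
abbrev Word (s : ℕ) : Type := List (Fin s)

/-- A word as the content of a register. -/
def enc {s : ℕ} (w : Word s) : List ℕ := w.map Fin.val

/-- A number as the content of a register, in unary. -/
def unary (k : ℕ) : List ℕ := List.replicate k 0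

/-- On the given inputs, the program halts and outputs the elements of the finite set `S`,
each exactly once, with delay at most `B`. -/
def EnumeratesWithDelay {s : ℕ} (p : Prog) (inputs : List (List ℕ)) (S : Finset (Word s))
    (B : ℕ) : Prop :=
  ∃ (τ : Trace) (s' : State) (l : List (Word s)),
    Run p (initState inputs) τ s' ∧ τ.outputs = l.map enc ∧ l.Nodup ∧ l.toFinset = S ∧
      τ.DelayLE B

/-- On the given inputs, the program halts after at most `T` steps, and its output is `y`. -/
def ComputesInTime {s : ℕ} (p : Prog) (inputs : List (List ℕ)) (y : Word s) (T : ℕ) : Prop :=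
  ∃ (τ : Trace) (s' : State),
    Run p (initState inputs) τ s' ∧ τ.outputs = [enc y] ∧ τ.length ≤ T

/-! ### Parameterized enumeration problems -/

/-- A parameterized enumeration problem `(L, Sol, κ)` over the alphabet `{0, …, s - 1}`. -/
structure ParamEnumProblem (s : ℕ) where
  /-- the underlying language -/
  L : Set (Word s)
  decidable_L : ComputablePred fun x : Word s => x ∈ L
  /-- the finite set of solutions of an instance -/
  Sol : Word s → Finset (Word s)
  /-- `Sol` is computable: a list of the elements of `Sol x` can be computed from `x` -/
  computable_Sol : ∃ g : Word s → List (Word s), Computable g ∧ ∀ x, (g x).toFinset = Sol x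
  nonempty_Sol_iff : ∀ x, (Sol x).Nonempty ↔ x ∈ L
  /-- the parameterization -/
  κ : Word s → ℕ

namespace ParamEnumProblem

variable {s : ℕ}

/-- Given `x` and `κ(x)`, the program enumerates `Sol(x)` with delay `f(κ(x)) · |x|^{O(1)}`.
(`|x| + 1` instead of `|x|` because `x` may be empty.) -/
def EnumeratedWithFactor (P : ParamEnumProblem s) (p : Prog) (f : ℕ → ℕ) : Prop :=
  ∃ c : ℕ, ∀ x : Word s,
    EnumeratesWithDelay p [enc x, unary (P.κ x)] (P.Sol x) (f (P.κ x) * (x.length + 1) ^ c)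

/-- The problem has an FPT-delay algorithm. -/
def HasFPTDelayAlgorithm (P : ParamEnumProblem s) : Prop :=
  ∃ (p : Prog) (f : ℕ → ℕ), Computable f ∧ P.EnumeratedWithFactor p f

/-- The problem can be solved with polynomial delay: as above, with `f` bounded. -/
def HasPolyDelayAlgorithm (P : ParamEnumProblem s) : Prop :=
  ∃ (p : Prog) (f : ℕ → ℕ), Computable f ∧ (∃ C : ℕ, ∀ k, f k ≤ C) ∧ P.EnumeratedWithFactor p f

/-- `A₁` is a compression algorithm of size `f`, and it maps every instance `x` to `y x`. -/
def IsCompression (P : ParamEnumProblem s) (A₁ : Prog) (f : ℕ → ℕ) (y : Word s → Word s) : Prop :=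
  (∃ q : Polynomial ℕ, ∀ x : Word s,
    ComputesInTime A₁ [enc x, unary (P.κ x)] (y x) (q.eval (x.length + P.κ x))) ∧
  ∀ x : Word s, P.κ (y x) ≤ f (P.κ x) ∧ (y x).length ≤ f (P.κ x) ∧
    ((P.Sol (y x)).Nonempty ↔ (P.Sol x).Nonempty)

/-- `A₂` is a lifting algorithm for the compression `y`: for an instance `x` and `Y ∈ Sol(y x)` it
enumerates a set `S x Y ⊆ Sol(x)` with delay polynomial in the total input size; for every `x`,
the sets `S x Y` are pairwise disjoint (so distinct `Y` give distinct nonempty sets) and their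
union is `Sol(x)`. -/
def IsLifting (P : ParamEnumProblem s) (A₂ : Prog) (y : Word s → Word s) : Prop :=
  ∃ (g : Polynomial ℕ) (S : Word s → Word s → Finset (Word s)), ∀ x : Word s,
    (∀ Y ∈ P.Sol (y x),
      EnumeratesWithDelay A₂ [enc x, enc (y x), unary (P.κ x), unary (P.κ (y x)), enc Y] (S x Y)
        (g.eval (x.length + (y x).length + P.κ x + P.κ (y x) + Y.length))) ∧
    (P.Sol (y x) : Set (Word s)).PairwiseDisjoint (S x) ∧
    (P.Sol (y x)).biUnion (S x) = P.Sol x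

/-- `(A₁, A₂)` is a PD kernel of size `f`. -/
def IsPDKernel (P : ParamEnumProblem s) (A₁ A₂ : Prog) (f : ℕ → ℕ) : Prop :=
  ∃ y : Word s → Word s, P.IsCompression A₁ f y ∧ P.IsLifting A₂ y

/-- The problem has a PD kernel. -/
def HasPDKernel (P : ParamEnumProblem s) : Prop :=
  ∃ (A₁ A₂ : Prog) (f : ℕ → ℕ), Computable f ∧ P.IsPDKernel A₁ A₂ f

/-- The problem has a PD kernel of constant size. -/
def HasConstantSizePDKernel (P : ParamEnumProblem s) : Prop :=
  ∃ (A₁ A₂ : Prog) (f : ℕ → ℕ),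
    Computable f ∧ (∃ C : ℕ, ∀ k, f k ≤ C) ∧ P.IsPDKernel A₁ A₂ f

/-- The parameter is polynomially bounded in the length of the instance. -/
def PolyBoundedParameter (P : ParamEnumProblem s) : Prop :=
  ∃ q : Polynomial ℕ, ∀ x : Word s, P.κ x ≤ q.eval x.length

end ParamEnumProblem

end PDKernel

/-! From an algorithm to a kernel. Let `A` enumerate with delay f(κ(x))·(|x|+1)^c. Since f is
computable, some program `d` writes f(k) in unary; a step lengthens a register by at most one
symbol, so f(k) ≤ k + T(k), where T(k) is the running time of `d`. The compression runs `d` on κ(x)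
with |x| units of fuel. If |x| ≤ T(κ(x)), the fuel is used up and x is its own kernel. Otherwise
T(κ(x)) < |x|, so f(κ(x)) ≤ κ(x) + |x| and `A` has delay polynomial in |x| + κ(x) on this x. Running
`A` up to its first output then decides whether Sol(x) is empty, and the kernel is a fixed instance
y₁ with solutions or a fixed instance y₀ without. For lifting, if the kernel is y₁, one fixed
solution Y₁ yields all of Sol(x) by means of `A` and the others yield nothing; for any other kernel
each Y yields itself. The clock T takes the place of f, which need not be computable in polynomial
time. As T bounds the kernel size it has to be computable, which follows from an interpreter
(`exists_partrec_run`). For bounded f the trivial program serves as `d`. The common argument is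
`exists_kernel`.

From a kernel to an algorithm. Compute y, then κ(y) and a list of Sol(y), and lift the solutions one
after another (`exists_enumeration`). Disjointness of the sets S_Y excludes repetitions. Some S_Y
may be empty, so the delays are summed over all Y. Every quantity that depends on y alone is bounded
by a computable function of |y| ≤ f(κ(x)) (`exists_computable_bound`). For constant size, y ranges
over a finite set, so κ and Sol are read from a finite table and κ need not be computable; the
polynomial bound on κ(x) absorbs the remaining dependence on the parameter.

Two program transformations do the work on the machine. `Layout.watch` interrupts a program when its
fuel is used up or at its first output, which it captures in a register (`watch_run`). `Ground.lift`
runs a program on top of the leftovers of earlier runs (`lift_run`). Erasing the leftovers instead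
would spoil the delay, because their size is governed by the total running time, which the delay
does not bound. Computable functions become programs through `Turing.ToPartrec.Code` (`ofCode_run`).
-/

namespace PDKernel

/-! ### Traces -/

theorem Trace.outputs_append (τ₁ τ₂ : Trace) :
    Trace.outputs (τ₁ ++ τ₂) = Trace.outputs τ₁ ++ Trace.outputs τ₂ := by
  simp [Trace.outputs, List.reduceOption_append]

@[simp] theorem Trace.outputs_replicate (n : ℕ) :
    Trace.outputs (List.replicate n none) = [] := by
  induction n with
  | zero => rfl
  | succ n ih => simp [Trace.outputs, List.replicate_succ]

@[simp] theorem Trace.outputs_nil : Trace.outputs [] = [] := rfl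

@[simp] theorem Trace.outputs_cons_none (τ : Trace) :
    Trace.outputs (none :: τ) = Trace.outputs τ := by
  simp [Trace.outputs]

@[simp] theorem Trace.outputs_cons_some (w : List ℕ) (τ : Trace) :
    Trace.outputs (some w :: τ) = w :: Trace.outputs τ := by
  simp [Trace.outputs]

theorem Trace.eq_replicate_of_outputs {τ : Trace} (h : τ.outputs = []) :
    τ = List.replicate τ.length none := by
  induction τ with
  | nil => rfl
  | cons a τ ih =>
    cases a with
    | none =>
      rw [Trace.outputs_cons_none] at h
      conv_lhs => rw [ih h]
      rfl
    | some w => simp at h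

theorem Trace.DelayLE.mono {τ : Trace} {B B' : ℕ} (h : τ.DelayLE B) (hB : B ≤ B') :
    τ.DelayLE B' := fun n hn => (h n hn).trans hB

/-- A silent stretch across the seam is a suffix of the first trace followed by a prefix of the
second, hence the sum. All delay estimates below are obtained by adding the bounds of the parts of a
program. -/
theorem Trace.DelayLE.append {τ₁ τ₂ : Trace} {B₁ B₂ : ℕ} (h₁ : τ₁.DelayLE B₁)
    (h₂ : τ₂.DelayLE B₂) : Trace.DelayLE (τ₁ ++ τ₂) (B₁ + B₂) := by
  intro n hn
  rw [List.infix_append_iff] at hn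
  rcases hn with hn | hn | ⟨l₁, l₂, e, hs, hp⟩
  · exact (h₁ n hn).trans (by omega)
  · exact (h₂ n hn).trans (by omega)
  · rw [eq_comm, List.append_eq_replicate_iff] at e
    obtain ⟨e1, e2, e3⟩ := e
    have a1 := h₁ l₁.length (by rw [← e2]; exact hs.isInfix)
    have a2 := h₂ l₂.length (by rw [← e3]; exact hp.isInfix)
    omega

theorem Trace.delayLE_replicate (n : ℕ) : Trace.DelayLE (List.replicate n none) n := by
  intro m hm
  simpa using hm.length_le

theorem Trace.delayLE_length (τ : Trace) : τ.DelayLE τ.length := by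
  intro m hm
  simpa using hm.length_le

theorem Trace.delayLE_some (w : List ℕ) : Trace.DelayLE [some w] 0 := by
  intro m hm
  rcases m with _ | m
  · exact le_rfl
  · have := hm.subset (List.mem_replicate.2 ⟨Nat.succ_ne_zero m, rfl⟩)
    simp at this

/-- With m outputs a trace has m + 1 silent gaps, each of length at most B, and m output steps. -/
theorem Trace.length_le_of_delayLE {B : ℕ} {τ : Trace} (h : τ.DelayLE B) :
    τ.length ≤ (τ.outputs.length + 1) * B + τ.outputs.length := by
  -- The prefix of g silent steps is the part already read of the current gap; without it the
  -- induction would forget how long that gap is.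
  suffices H : ∀ (τ : Trace) (g : ℕ), Trace.DelayLE (List.replicate g none ++ τ) B →
      g + τ.length ≤ (τ.outputs.length + 1) * B + τ.outputs.length by
    simpa using H τ 0 (by simpa using h)
  intro τ
  induction τ with
  | nil =>
    intro g hg
    simpa using hg g (by simp)
  | cons a τ ih =>
    intro g hg
    cases a with
    | none =>
      have := ih (g + 1) (by
        rw [List.replicate_succ', List.append_assoc]; exact hg)
      simp only [List.length_cons, Trace.outputs_cons_none] at this ⊢
      omega
    | some w =>
      have h1 : g ≤ B := hg g (List.prefix_append _ _).isInfix
      have h2 := ih 0 (by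
        intro n hn
        refine hg n (hn.trans ?_)
        refine List.IsSuffix.isInfix ⟨List.replicate g none ++ [some w], ?_⟩
        simp)
      simp only [List.length_cons, Trace.outputs_cons_some] at h2 ⊢
      nlinarith

/-! ### Runs with given outputs and a bound on the delay -/

/-- Started in `s`, the program halts in `s'`, having output the words in `L` with delay at
most `B`. For `L = []` the number `B` bounds the number of steps. -/
def ERun (p : Prog) (s : State) (L : List (List ℕ)) (B : ℕ) (s' : State) : Prop :=
  ∃ τ : Trace, Run p s τ s' ∧ τ.outputs = L ∧ τ.DelayLE B

theorem ERun.mono {p : Prog} {s s' : State} {L : List (List ℕ)} {B B' : ℕ}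
    (h : ERun p s L B s') (hB : B ≤ B') : ERun p s L B' s' := by
  obtain ⟨τ, h1, h2, h3⟩ := h
  exact ⟨τ, h1, h2, h3.mono hB⟩

theorem ERun.of_run {p : Prog} {s s' : State} {n B : ℕ}
    (h : Run p s (List.replicate n none) s') (hB : n ≤ B) : ERun p s [] B s' :=
  ⟨_, h, by simp, (Trace.delayLE_replicate n).mono hB⟩

/-- A trace without outputs is a single gap, so its delay is its length. Hence delay bounds double
as time bounds for silent programs. -/
theorem ERun.silent {p : Prog} {s s' : State} {B : ℕ} (h : ERun p s [] B s') :
    ∃ n ≤ B, Run p s (List.replicate n none) s' := by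
  obtain ⟨τ, h1, h2, h3⟩ := h
  have e := Trace.eq_replicate_of_outputs h2
  refine ⟨τ.length, h3 _ (by rw [← e]), by rwa [← e]⟩

theorem ERun.cast {p : Prog} {s s₁ s₂ : State} {L : List (List ℕ)} {B : ℕ}
    (h : ERun p s L B s₁) (e : s₁ = s₂) : ERun p s L B s₂ := e ▸ h

theorem ERun.skip (s : State) : ERun .skip s [] 1 s :=
  .of_run (n := 1) (.skip s) le_rfl

theorem ERun.push (r a : ℕ) (s : State) :
    ERun (.push r a) s [] 1 (Function.update s r (a :: s r)) :=
  .of_run (n := 1) (.push r a s) le_rfl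

theorem ERun.pop (r : ℕ) (s : State) :
    ERun (.pop r) s [] 1 (Function.update s r (s r).tail) :=
  .of_run (n := 1) (.pop r s) le_rfl

theorem ERun.emit (r : ℕ) (s : State) : ERun (.emit r) s [s r] (s r).length s :=
  ⟨_, .emit r s, by simp [Trace.outputs_append],
    by simpa using (Trace.delayLE_replicate (s r).length).append (Trace.delayLE_some (s r))⟩

theorem ERun.seq {p q : Prog} {s s₁ s₂ : State} {L₁ L₂ : List (List ℕ)} {B₁ B₂ : ℕ}
    (h₁ : ERun p s L₁ B₁ s₁) (h₂ : ERun q s₁ L₂ B₂ s₂) :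
    ERun (.seq p q) s (L₁ ++ L₂) (B₁ + B₂) s₂ := by
  obtain ⟨τ, h1, h2, h3⟩ := h₁
  obtain ⟨σ, g1, g2, g3⟩ := h₂
  exact ⟨τ ++ σ, .seq h1 g1, by rw [Trace.outputs_append, h2, g2], h3.append g3⟩

theorem ERun.seq_silent {p q : Prog} {s s₁ s₂ : State} {L : List (List ℕ)} {B₁ B₂ : ℕ}
    (h₁ : ERun p s [] B₁ s₁) (h₂ : ERun q s₁ L B₂ s₂) :
    ERun (.seq p q) s L (B₁ + B₂) s₂ := h₁.seq h₂

theorem Trace.delayLE_cons_none {τ : Trace} {B : ℕ} (h : τ.DelayLE B) :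
    Trace.DelayLE (none :: τ) (B + 1) := by
  simpa [add_comm] using (Trace.delayLE_replicate 1).append h

theorem ERun.ifTop_true {r : ℕ} {o : Option ℕ} {p q : Prog} {s s' : State}
    {L : List (List ℕ)} {B : ℕ} (ho : (s r).head? = o) (h : ERun p s L B s') :
    ERun (.ifTop r o p q) s L (B + 1) s' := by
  obtain ⟨τ, h1, h2, h3⟩ := h
  exact ⟨none :: τ, .ifTop_true ho h1, by simpa using h2, Trace.delayLE_cons_none h3⟩

theorem ERun.ifTop_false {r : ℕ} {o : Option ℕ} {p q : Prog} {s s' : State}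
    {L : List (List ℕ)} {B : ℕ} (ho : (s r).head? ≠ o) (h : ERun q s L B s') :
    ERun (.ifTop r o p q) s L (B + 1) s' := by
  obtain ⟨τ, h1, h2, h3⟩ := h
  exact ⟨none :: τ, .ifTop_false ho h1, by simpa using h2, Trace.delayLE_cons_none h3⟩

theorem ERun.loop_done {r : ℕ} {p : Prog} {s : State} (hr : s r = []) :
    ERun (.loop r p) s [] 1 s :=
  .of_run (n := 1) (.loop_done hr) le_rfl

theorem ERun.loop_step {r : ℕ} {p : Prog} {s s₁ s₂ : State} {L₁ L₂ : List (List ℕ)}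
    {B₁ B₂ : ℕ} (hr : s r ≠ []) (h₁ : ERun p s L₁ B₁ s₁) (h₂ : ERun (.loop r p) s₁ L₂ B₂ s₂) :
    ERun (.loop r p) s (L₁ ++ L₂) (B₁ + B₂ + 1) s₂ := by
  obtain ⟨τ, h1, h2, h3⟩ := h₁
  obtain ⟨σ, g1, g2, g3⟩ := h₂
  exact ⟨none :: (τ ++ σ), .loop_step hr h1 g1,
    by rw [Trace.outputs_cons_none, Trace.outputs_append, h2, g2],
    Trace.delayLE_cons_none (h3.append g3)⟩

theorem ERun.loop_step_silent {r : ℕ} {p : Prog} {s s₁ s₂ : State}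
    {B₁ B₂ : ℕ} (hr : s r ≠ []) (h₁ : ERun p s [] B₁ s₁) (h₂ : ERun (.loop r p) s₁ [] B₂ s₂) :
    ERun (.loop r p) s [] (B₁ + B₂ + 1) s₂ := h₁.loop_step hr h₂

/-! ### Basic programs -/

/-- Move the top symbol of `a` to `b` if it is less than the bound, else remove it. -/
def mvTop (a b : ℕ) : ℕ → Prog
  | 0 => .pop a
  | n + 1 => .ifTop a (some n) (.seq (.pop a) (.push b n)) (mvTop a b n)

theorem mvTop_run {a b : ℕ} (hab : a ≠ b) {x : ℕ} {l : List ℕ} {s : State} (hs : s a = x :: l)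
    (n : ℕ) (hx : x < n) : ERun (mvTop a b n) s [] (n + 2)
      (Function.update (Function.update s a l) b (x :: s b)) := by
  induction n with
  | zero => omega
  | succ n ih =>
    by_cases h : x = n
    · subst h
      refine ((ERun.pop a s).seq_silent (.push b x _)).ifTop_true (by simp [hs]) |>.mono
        (by omega) |>.cast ?_
      simp [hs, hab.symm]
    · exact (ih (by omega)).ifTop_false (by simp [hs, h]) |>.mono (by omega)

/-- The version without a bound on the symbols: a symbol not below the bound is lost, but the source
register shrinks all the same. It is needed where an arbitrary program outputs a word over an
unknown alphabet. -/
theorem mvTop_run' {a b : ℕ} (hab : a ≠ b) (s : State) (n : ℕ) :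
    ∃ s', ERun (mvTop a b n) s [] (n + 2) s' ∧ s' a = (s a).tail ∧
      ∀ q, q ≠ a → q ≠ b → s' q = s q := by
  induction n with
  | zero =>
    exact ⟨_, (ERun.pop a s).mono (by omega), by simp, fun q h1 h2 => by simp [h1]⟩
  | succ n ih =>
    obtain ⟨s', h1, h2, h3⟩ := ih
    by_cases h : (s a).head? = some n
    · refine ⟨_, ((ERun.pop a s).seq_silent (.push b n _)).ifTop_true h |>.mono
        (by omega), ?_, ?_⟩
      · simp [hab]
      · intro q h1 h2
        simp [h1, h2]
    · exact ⟨s', h1.ifTop_false h |>.mono (by omega), h2, h3⟩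

/-- Move the content of `a` to `b`, reversing its order. -/
def mv (n a b : ℕ) : Prog := .loop a (mvTop a b n)

theorem mv_run {a b : ℕ} (hab : a ≠ b) (n : ℕ) (l : List ℕ) (s : State) (hs : s a = l)
    (hl : ∀ x ∈ l, x < n) : ERun (mv n a b) s [] ((n + 3) * l.length + 1)
      (Function.update (Function.update s a []) b (l.reverse ++ s b)) := by
  induction l generalizing s with
  | nil =>
    refine (ERun.loop_done hs).mono (by simp) |>.cast ?_
    funext q
    simp only [Function.update_apply]
    split_ifs <;> simp_all
  | cons x l ih =>
    have h1 := mvTop_run hab hs n (hl x (by simp))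
    refine ERun.loop_step_silent (by simp [hs]) h1 (ih _ (by simp [hab]) fun y hy =>
      hl y (by simp [hy])) |>.mono (by simp; ring_nf; omega) |>.cast ?_
    funext q
    simp only [Function.update_apply]
    split_ifs <;> simp_all

theorem mv_run' {a b : ℕ} (hab : a ≠ b) (n : ℕ) (l : List ℕ) (s : State) (hs : s a = l) :
    ∃ s', ERun (mv n a b) s [] ((n + 3) * l.length + 1) s' ∧ s' a = [] ∧
      ∀ q, q ≠ a → q ≠ b → s' q = s q := by
  induction l generalizing s with
  | nil => exact ⟨s, (ERun.loop_done hs).mono (by simp), hs, fun _ _ _ => rfl⟩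
  | cons x l ih =>
    obtain ⟨s1, h1, h2, h3⟩ := mvTop_run' hab s n
    obtain ⟨s2, g1, g2, g3⟩ := ih s1 (by simp [h2, hs])
    exact ⟨s2, ERun.loop_step_silent (by simp [hs]) h1 g1 |>.mono (by simp; ring_nf; omega), g2,
      fun q e1 e2 => by rw [g3 q e1 e2, h3 q e1 e2]⟩

/-- Empty a register. -/
def clear (a : ℕ) : Prog := .loop a (.pop a)

theorem clear_run {a : ℕ} (l : List ℕ) (s : State) (hs : s a = l) :
    ERun (clear a) s [] (2 * l.length + 1) (Function.update s a []) := by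
  induction l generalizing s with
  | nil => exact (ERun.loop_done hs).mono (by simp) |>.cast (by rw [← hs]; simp)
  | cons x l ih =>
    refine ERun.loop_step_silent (by simp [hs]) (.pop a s) (ih _ (by simp [hs])) |>.mono
      (by simp; omega) |>.cast (by simp)

/-- Move the top symbol of `t` to both `a` and `b`. -/
def dupTop (t a b : ℕ) : ℕ → Prog
  | 0 => .pop t
  | n + 1 => .ifTop t (some n) (.seq (.pop t) (.seq (.push a n) (.push b n))) (dupTop t a b n)

theorem dupTop_run {t a b : ℕ} (hta : t ≠ a) (htb : t ≠ b) (hab : a ≠ b) {x : ℕ} {l : List ℕ}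
    {s : State} (hs : s t = x :: l) (n : ℕ) (hx : x < n) :
    ERun (dupTop t a b n) s [] (n + 3)
      (Function.update (Function.update (Function.update s t l) a (x :: s a)) b (x :: s b)) := by
  induction n with
  | zero => omega
  | succ n ih =>
    by_cases h : x = n
    · subst h
      refine ((ERun.pop t s).seq_silent ((ERun.push a x _).seq_silent (.push b x _))).ifTop_true
        (by simp [hs]) |>.mono (by omega) |>.cast ?_
      simp [hs, hta.symm, htb.symm, hab.symm]
    · exact (ih (by omega)).ifTop_false (by simp [hs, h]) |>.mono (by omega)

/-- Move the content of `t` to both `a` and `b`, reversing its order. -/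
def dup (n t a b : ℕ) : Prog := .loop t (dupTop t a b n)

theorem dup_run {t a b : ℕ} (hta : t ≠ a) (htb : t ≠ b) (hab : a ≠ b) (n : ℕ) (l : List ℕ)
    (s : State) (hs : s t = l) (hl : ∀ x ∈ l, x < n) :
    ERun (dup n t a b) s [] ((n + 4) * l.length + 1)
      (Function.update (Function.update (Function.update s t []) a (l.reverse ++ s a)) b
        (l.reverse ++ s b)) := by
  induction l generalizing s with
  | nil =>
    refine (ERun.loop_done hs).mono (by simp) |>.cast ?_
    funext q
    simp only [Function.update_apply]
    split_ifs <;> simp_all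
  | cons x l ih =>
    have h1 := dupTop_run hta htb hab hs n (hl x (by simp))
    refine ERun.loop_step_silent (by simp [hs]) h1 (ih _ (by simp [hta, htb]) fun y hy =>
      hl y (by simp [hy])) |>.mono (by simp; ring_nf; omega) |>.cast ?_
    funext q
    simp only [Function.update_apply]
    split_ifs <;> simp_all

/-- Put a copy of the content of `a` on top of `b`, by means of the empty register `t`. -/
def cp (n a b t : ℕ) : Prog := .seq (mv n a t) (dup n t a b)

theorem cp_run {a b t : ℕ} (hta : t ≠ a) (htb : t ≠ b) (hab : a ≠ b) (n : ℕ) (s : State)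
    (ht : s t = []) (hl : ∀ x ∈ s a, x < n) :
    ERun (cp n a b t) s [] ((2 * n + 7) * (s a).length + 2)
      (Function.update s b (s a ++ s b)) := by
  refine ((mv_run hta.symm n _ s rfl hl).seq_silent (dup_run hta htb hab n (s a).reverse _
    (by simp [ht]) (by simpa using hl))).mono (by simp; ring_nf; omega) |>.cast ?_
  funext q
  by_cases h1 : q = b
  · subst h1; simp [htb.symm, hab.symm]
  · by_cases h2 : q = a
    · subst h2; simp [h1, hta.symm]
    · by_cases h3 : q = t
      · subst h3; simp [h1, h2, ht]
      · simp [h1, h2, h3]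

/-- Put the constant word `w` on top of `b`. -/
def put (b : ℕ) : List ℕ → Prog
  | [] => .skip
  | x :: w => .seq (put b w) (.push b x)

theorem put_run (b : ℕ) (w : List ℕ) (s : State) :
    ERun (put b w) s [] (w.length + 1) (Function.update s b (w ++ s b)) := by
  induction w with
  | nil => exact (ERun.skip s).cast (by simp)
  | cons x w ih => exact (ih.seq_silent (.push b x _)).mono (by simp) |>.cast (by simp)

/-- Do `p` if `a` contains the constant word `w`, else `q`; the register `a` is used up. -/
def ifEq (a : ℕ) : List ℕ → Prog → Prog → Prog
  | [], p, q => .ifTop a none p q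
  | x :: w, p, q => .ifTop a (some x) (.seq (.pop a) (ifEq a w p q)) q

theorem ifEq_run_eq {a : ℕ} (w : List ℕ) {p q : Prog} {s s' : State} {L : List (List ℕ)} {B : ℕ}
    (hs : s a = w) (h : ERun p (Function.update s a []) L B s') :
    ERun (ifEq a w p q) s L (B + 2 * w.length + 1) s' := by
  induction w generalizing s with
  | nil =>
    rw [← hs, Function.update_eq_self] at h
    exact h.ifTop_true (by simp [hs])
  | cons x w ih =>
    refine ((ERun.pop a s).seq_silent (ih (s := Function.update s a (s a).tail)
      (by simp [hs]) (by simpa using h))).ifTop_true (by simp [hs]) |>.mono (by simp; omega)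

/-- The comparison stops at the first mismatch, so an unknown rest l stays in the register.
Therefore the alternative has to work for every l, with one bound B. -/
theorem ifEq_run_ne {a : ℕ} (w : List ℕ) {p q : Prog} {s : State} {s' : List ℕ → State}
    {L : List (List ℕ)} {B : ℕ}
    (hs : s a ≠ w) (h : ∀ l, ERun q (Function.update s a l) L B (s' l)) :
    ∃ l, ERun (ifEq a w p q) s L (B + 2 * w.length + 1) (s' l) := by
  induction w generalizing s with
  | nil =>
    have := h (s a)
    rw [Function.update_eq_self] at this
    exact ⟨_, this.ifTop_false (by simpa using hs)⟩
  | cons x w ih =>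
    by_cases hx : (s a).head? = some x
    · obtain ⟨l, hl⟩ := ih (s := Function.update s a (s a).tail) (by
        intro e
        apply hs
        cases hsa : s a with
        | nil => simp [hsa] at hx
        | cons y m => simp_all) (by simpa using h)
      exact ⟨l, ((ERun.pop a s).seq_silent hl).ifTop_true hx |>.mono (by simp; omega)⟩
    · have := h (s a)
      rw [Function.update_eq_self] at this
      exact ⟨_, this.ifTop_false hx |>.mono (by simp)⟩

/-! ### Renaming registers -/

/-- Rename the registers of a program. -/
def Prog.rename (σ : ℕ → ℕ) : Prog → Prog
  | .skip => .skip
  | .push r a => .push (σ r) a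
  | .pop r => .pop (σ r)
  | .emit r => .emit (σ r)
  | .seq p q => .seq (p.rename σ) (q.rename σ)
  | .ifTop r o p q => .ifTop (σ r) o (p.rename σ) (q.rename σ)
  | .loop r p => .loop (σ r) (p.rename σ)

/-- Programs moved to disjoint sets of registers do not interfere. The start state t is prescribed
only on the image of σ, and outside of it nothing changes. -/
theorem Run.rename {σ : ℕ → ℕ} (hσ : Function.Injective σ) {p : Prog} {s s' : State} {τ : Trace}
    (h : Run p s τ s') : ∀ t : State, (∀ r, t (σ r) = s r) →
      ∃ t', Run (p.rename σ) t τ t' ∧ (∀ r, t' (σ r) = s' r) ∧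
        ∀ q, (∀ r, q ≠ σ r) → t' q = t q := by
  induction h with
  | skip s => exact fun t ht => ⟨t, .skip t, ht, fun _ _ => rfl⟩
  | push r a s =>
    refine fun t ht => ⟨_, .push _ a t, fun q => ?_, fun q hq => by simp [hq r]⟩
    simp [Function.update_apply, hσ.eq_iff, ht]
  | pop r s =>
    refine fun t ht => ⟨_, .pop _ t, fun q => ?_, fun q hq => by simp [hq r]⟩
    simp [Function.update_apply, hσ.eq_iff, ht]
  | emit r s =>
    refine fun t ht => ⟨t, ?_, ht, fun _ _ => rfl⟩
    rw [← ht r]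
    exact .emit _ t
  | seq _ _ ih₁ ih₂ =>
    intro t ht
    obtain ⟨t₁, h1, h2, h3⟩ := ih₁ t ht
    obtain ⟨t₂, g1, g2, g3⟩ := ih₂ t₁ h2
    exact ⟨t₂, .seq h1 g1, g2, fun q hq => by rw [g3 q hq, h3 q hq]⟩
  | ifTop_true ho _ ih =>
    intro t ht
    obtain ⟨t₁, h1, h2, h3⟩ := ih t ht
    exact ⟨t₁, .ifTop_true (by rw [ht, ho]) h1, h2, h3⟩
  | ifTop_false ho _ ih =>
    intro t ht
    obtain ⟨t₁, h1, h2, h3⟩ := ih t ht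
    exact ⟨t₁, .ifTop_false (by rwa [ht]) h1, h2, h3⟩
  | loop_done hr => exact fun t ht => ⟨t, .loop_done (by rw [ht, hr]), ht, fun _ _ => rfl⟩
  | loop_step hr _ _ ih₁ ih₂ =>
    intro t ht
    obtain ⟨t₁, h1, h2, h3⟩ := ih₁ t ht
    obtain ⟨t₂, g1, g2, g3⟩ := ih₂ t₁ h2
    exact ⟨t₂, .loop_step (by rwa [ht]) h1 g1, g2, fun q hq => by rw [g3 q hq, h3 q hq]⟩

theorem ERun.rename {σ : ℕ → ℕ} (hσ : Function.Injective σ) {p : Prog} {s s' : State}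
    {L : List (List ℕ)} {B : ℕ} (h : ERun p s L B s') (t : State) (ht : ∀ r, t (σ r) = s r) :
    ∃ t', ERun (p.rename σ) t L B t' ∧ (∀ r, t' (σ r) = s' r) ∧
      ∀ q, (∀ r, q ≠ σ r) → t' q = t q := by
  obtain ⟨τ, h1, h2, h3⟩ := h
  obtain ⟨t', g1, g2, g3⟩ := h1.rename hσ t ht
  exact ⟨t', ⟨τ, g1, h2, h3⟩, g2, g3⟩

/-! ### States given by lists -/

theorem update_initState (L : List (List ℕ)) (i : ℕ) (x : List ℕ) (hi : i < L.length) :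
    Function.update (initState L) i x = initState (L.set i x) := by
  funext q
  by_cases h : q = i
  · subst h; simp [initState, hi]
  · simp [initState, h, List.getD, List.getElem?_set_ne (Ne.symm h)]

/-- An in-place program expects all registers but its first to be empty. Shifted by d it can thus be
run above saved data in the registers below d, provided that everything above d is empty. -/
theorem ERun.shift {p : Prog} {l l' : List ℕ} {B : ℕ}
    (h : ERun p (initState [l]) [] B (initState [l'])) (d : ℕ) (s : State) (h0 : s d = l)
    (h1 : ∀ r, d < r → s r = []) :
    ERun (p.rename (· + d)) s [] B (Function.update s d l') := by
  obtain ⟨t', g1, g2, g3⟩ := h.rename (add_left_injective d) s (fun r => by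
    rcases r with _ | r
    · simpa [initState] using h0
    · simpa [initState] using h1 _ (by omega))
  refine g1.cast (funext fun q => ?_)
  by_cases hq : q < d
  · rw [g3 q (fun r => by simp only [ne_eq]; omega)]
    simp [hq.ne]
  · obtain ⟨r, rfl⟩ : ∃ r, q = r + d := ⟨q - d, by omega⟩
    have := g2 r
    rw [this]
    rcases r with _ | r
    · simp [initState]
    · simp [initState, h1]

/-! ### Compiling computable functions -/

/-- A list of numbers as the content of a register. -/
def encNats (v : List ℕ) : List ℕ := v.flatMap fun n => List.replicate n 0 ++ [1]

@[simp] theorem encNats_nil : encNats [] = [] := rfl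

@[simp] theorem encNats_cons (n : ℕ) (v : List ℕ) :
    encNats (n :: v) = List.replicate n 0 ++ 1 :: encNats v := by
  simp [encNats]

theorem lt_two_of_mem_encNats {v : List ℕ} {x : ℕ} (hx : x ∈ encNats v) : x < 2 := by
  simp only [encNats, List.mem_flatMap, List.mem_append, List.mem_replicate,
    List.mem_singleton] at hx
  omega

/-- Remove the first number from the list in register `r`, and add it to register `t`. -/
def moveBlock (r t f : ℕ) : Prog :=
  .seq (.push f 0) (.loop f (.seq (.pop f) (.ifTop r (some 0)
    (.seq (.pop r) (.seq (.push t 0) (.push f 0))) (.pop r))))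

/-- A loop can only test for emptiness, so register f is a flag that is renewed after each symbol
`0` and not after the separator. The empty list behaves like a list with first entry 0, in
accordance with `headI` and `tail`. -/
theorem moveBlock_run {r t f : ℕ} (hrt : r ≠ t) (hrf : r ≠ f) (htf : t ≠ f) (v : List ℕ)
    (s : State) (hr : s r = encNats v) (hf : s f = []) :
    ∃ B, ERun (moveBlock r t f) s [] B (Function.update (Function.update s r (encNats v.tail)) t
      (List.replicate v.headI 0 ++ s t)) := by
  suffices H : ∀ (n : ℕ) (l : List ℕ) (s : State),
      (s r = List.replicate n 0 ++ 1 :: l ∨ n = 0 ∧ l = [] ∧ s r = []) →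
      s f = [0] → ∃ B, ERun (.loop f (.seq (.pop f) (.ifTop r (some 0)
        (.seq (.pop r) (.seq (.push t 0) (.push f 0))) (.pop r)))) s [] B
        (Function.update (Function.update (Function.update s r l) t
          (List.replicate n 0 ++ s t)) f []) by
    obtain ⟨B, hB⟩ := H v.headI (encNats v.tail) (Function.update s f [0]) (by
      cases v with
      | nil => right; simp [hrf, hr]
      | cons n v => left; simp [hrf, hr]) (by simp)
    refine ⟨_, ((ERun.push f 0 s).cast (by rw [hf])).seq_silent hB |>.cast ?_⟩
    funext q
    simp only [Function.update_apply]
    split_ifs <;> simp_all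
  intro n
  induction n with
  | zero =>
    intro l s h1 h2
    refine ⟨_, ERun.loop_step_silent (by simp [h2]) ((ERun.pop f s).seq_silent
      ((ERun.pop r _).ifTop_false ?_)) (ERun.loop_done ?_) |>.cast ?_⟩
    · rcases h1 with h1 | ⟨-, -, h1⟩ <;> simp [h1, hrf]
    · simp [hrf.symm, h2]
    · funext q
      simp only [Function.update_apply]
      split_ifs <;> simp_all
      rcases h1 with h1 | ⟨h1, h3⟩ <;> simp [*]
  | succ n ih =>
    intro l s h1 h2
    have h1 : s r = 0 :: (List.replicate n 0 ++ 1 :: l) := by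
      simpa [List.replicate_succ] using h1
    obtain ⟨B, hB⟩ := ih l (Function.update (Function.update s r
      (List.replicate n 0 ++ 1 :: l)) t (0 :: s t)) (by simp [hrt])
        (by simp [*, htf.symm, hrf.symm])
    refine ⟨_, ERun.loop_step_silent (by simp [h2]) (((ERun.pop f s).seq_silent
      (((ERun.pop r _).seq_silent ((ERun.push t 0 _).seq_silent (ERun.push f 0 _))).ifTop_true
        (by simp [hrf, h1]))).cast ?_) hB |>.cast ?_⟩
    · funext q
      simp only [Function.update_apply]
      split_ifs <;> simp_all
    · funext q
      simp only [Function.update_apply, List.replicate_succ']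
      split_ifs <;> simp_all

/-- The program of a code for a partial recursive function on lists of numbers. It works in place
on register `0`. -/
def ofCode : Turing.ToPartrec.Code → Prog
  | .zero' => .push 0 1
  | .succ => .seq (moveBlock 0 1 2) (.seq (clear 0) (.seq (.push 0 1) (.seq (mv 2 1 0)
      (.push 0 0))))
  | .tail => .seq (moveBlock 0 1 2) (clear 1)
  | .cons f g => .seq (cp 2 0 1 2) (.seq ((ofCode f).rename (· + 1)) (.seq (moveBlock 1 2 3)
      (.seq (clear 1) (.seq (mv 2 2 1) (.seq (cp 2 0 2 3) (.seq (clear 0)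
      (.seq ((ofCode g).rename (· + 2)) (.seq (cp 2 2 0 3) (.seq (clear 2) (.seq (.push 0 1)
      (mv 2 1 0)))))))))))
  | .comp f g => .seq (ofCode g) (ofCode f)
  | .case f g => .ifTop 0 (some 0) (.seq (.pop 0) (ofCode g)) (.seq (.pop 0) (ofCode f))
  | .fix f => .seq (cp 2 0 1 2) (.seq (clear 0) (.seq (.push 0 0) (.seq
      (.loop 0 (.seq (.pop 0) (.seq ((ofCode f).rename (· + 1))
        (.seq (.ifTop 1 (some 0) (.push 0 0) .skip) (.seq (moveBlock 1 2 3) (clear 2))))))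
      (.seq (cp 2 1 0 2) (clear 1)))))

theorem initState_apply (L : List (List ℕ)) (r : ℕ) : initState L r = L.getD r [] := rfl

theorem initState_append_replicate (L : List (List ℕ)) (n : ℕ) :
    initState (L ++ List.replicate n []) = initState L := by
  funext q
  simp only [initState, List.getD_eq_getElem?_getD, List.getElem?_append, List.getElem?_replicate]
  split_ifs with h1 h2
  · rfl
  · simp [List.getElem?_eq_none (not_lt.1 h1)]
  · simp [List.getElem?_eq_none (not_lt.1 h1)]

theorem initState_pad (l : List ℕ) : initState [l] = initState [l, [], [], []] :=
  (initState_append_replicate [l] 3).symm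

/-- Induction on the code. No time bound is recorded: it suffices that the program halts, as its
running time is shown to be computable afterwards. -/
theorem ofCode_run (c : Turing.ToPartrec.Code) : ∀ v w : List ℕ, w ∈ c.eval v →
    ∃ B, ERun (ofCode c) (initState [encNats v]) [] B (initState [encNats w]) := by
  induction c with
  | zero' =>
    intro v w h
    simp only [Turing.ToPartrec.Code.zero'_eval, Part.pure_eq_some, Part.mem_some_iff] at h
    subst h
    exact ⟨_, (ERun.push 0 1 _).cast (by simp [update_initState, initState_apply])⟩
  | succ =>
    intro v w h
    simp only [Turing.ToPartrec.Code.succ_eval, Part.pure_eq_some, Part.mem_some_iff] at h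
    subst h
    rw [initState_pad, initState_pad]
    obtain ⟨B, hB⟩ := moveBlock_run (r := 0) (t := 1) (f := 2) (by simp) (by simp) (by simp) v
      (initState [encNats v, [], [], []]) rfl rfl
    refine ⟨_, hB.seq_silent ((clear_run _ _ rfl).seq_silent ((ERun.push 0 1 _).seq_silent
      ((mv_run (by simp) 2 _ _ rfl ?_).seq_silent (ERun.push 0 0 _)))) |>.cast ?_⟩
    · simp [update_initState, initState_apply]
    · simp [update_initState, initState_apply, List.replicate_succ]
  | tail =>
    intro v w h
    simp only [Turing.ToPartrec.Code.tail_eval, Part.pure_eq_some, Part.mem_some_iff] at h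
    subst h
    rw [initState_pad, initState_pad]
    obtain ⟨B, hB⟩ := moveBlock_run (r := 0) (t := 1) (f := 2) (by simp) (by simp) (by simp) v
      (initState [encNats v, [], [], []]) rfl rfl
    refine ⟨_, hB.seq_silent (clear_run _ _ rfl) |>.cast ?_⟩
    simp [update_initState, initState_apply]
  | comp f g ihf ihg =>
    intro v w h
    simp only [Turing.ToPartrec.Code.comp_eval] at h
    obtain ⟨u, hu, hw⟩ := Part.mem_bind_iff.1 h
    obtain ⟨B₁, h1⟩ := ihg v u hu
    obtain ⟨B₂, h2⟩ := ihf u w hw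
    exact ⟨_, h1.seq_silent h2⟩
  | case f g ihf ihg =>
    intro v w h
    simp only [Turing.ToPartrec.Code.case_eval] at h
    rcases v with _ | ⟨_ | n, v⟩
    · obtain ⟨B, hB⟩ := ihf [] w h
      exact ⟨_, ((ERun.pop 0 _).seq_silent (hB.mono le_rfl |> fun h =>
        (by simpa [update_initState, initState_apply] using h))).ifTop_false (by
          simp [initState_apply])⟩
    · obtain ⟨B, hB⟩ := ihf v w h
      refine ⟨_, ((ERun.pop 0 _).seq_silent (by
        simpa [update_initState, initState_apply] using hB)).ifTop_false (by
          simp [initState_apply])⟩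
    · obtain ⟨B, hB⟩ := ihg (n :: v) w h
      refine ⟨_, ((ERun.pop 0 _).seq_silent (by
        simpa [update_initState, initState_apply, List.replicate_succ] using hB)).ifTop_true (by
          simp [initState_apply, List.replicate_succ])⟩
  | cons f g ihf ihg =>
    intro v w h
    simp only [Turing.ToPartrec.Code.cons_eval, Part.bind_eq_bind, Part.pure_eq_some,
      Part.mem_bind_iff, Part.mem_some_iff] at h
    obtain ⟨a, ha, b, hb, rfl⟩ := h
    obtain ⟨B₁, h1⟩ := ihf v a ha
    obtain ⟨B₂, h2⟩ := ihg v b hb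
    rw [initState_pad, initState_pad]
    have e0 := cp_run (a := 0) (b := 1) (t := 2) (by simp) (by simp) (by simp) 2
      (initState [encNats v, [], [], []]) rfl (fun x hx => lt_two_of_mem_encNats hx)
    rw [update_initState _ _ _ (by simp)] at e0
    have e1 := h1.shift 1 (initState [encNats v, encNats v, [], []]) rfl (by
      rintro (_ | _ | _ | _ | r) hr <;> first | omega | rfl)
    rw [update_initState _ _ _ (by simp)] at e1
    obtain ⟨B₃, e2⟩ := moveBlock_run (r := 1) (t := 2) (f := 3) (by simp) (by simp) (by simp) a
      (initState [encNats v, encNats a, [], []]) rfl rfl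
    rw [update_initState _ _ _ (by simp), update_initState _ _ _ (by simp)] at e2
    have e3 := clear_run (a := 1) _ (initState [encNats v, encNats a.tail,
      List.replicate a.headI 0, []]) rfl
    rw [update_initState _ _ _ (by simp)] at e3
    have e4 := mv_run (a := 2) (b := 1) (by simp) 2 _ (initState [encNats v, [],
      List.replicate a.headI 0, []]) rfl (by simp [initState_apply])
    rw [update_initState _ _ _ (by simp), update_initState _ _ _ (by simp)] at e4
    have e5 := cp_run (a := 0) (b := 2) (t := 3) (by simp) (by simp) (by simp) 2
      (initState [encNats v, List.replicate a.headI 0, [], []]) rfl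
      (fun x hx => lt_two_of_mem_encNats hx)
    rw [update_initState _ _ _ (by simp)] at e5
    have e6 := clear_run (a := 0) _ (initState [encNats v, List.replicate a.headI 0,
      encNats v, []]) rfl
    rw [update_initState _ _ _ (by simp)] at e6
    -- The head of the result of f is kept in register 1, so g has to run in register 2 with nothing
    -- above it; this is why its input was moved there.
    have e7 := h2.shift 2 (initState [[], List.replicate a.headI 0, encNats v, []]) rfl (by
      rintro (_ | _ | _ | _ | r) hr <;> first | omega | rfl)
    rw [update_initState _ _ _ (by simp)] at e7
    have e8 := cp_run (a := 2) (b := 0) (t := 3) (by simp) (by simp) (by simp) 2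
      (initState [[], List.replicate a.headI 0, encNats b, []]) rfl
      (fun x hx => lt_two_of_mem_encNats hx)
    rw [update_initState _ _ _ (by simp)] at e8
    have e9 := clear_run (a := 2) _ (initState [encNats b, List.replicate a.headI 0,
      encNats b, []]) rfl
    rw [update_initState _ _ _ (by simp)] at e9
    have e10 := ERun.push 0 1 (initState [encNats b, List.replicate a.headI 0, [], []])
    rw [update_initState _ _ _ (by simp)] at e10
    have e11 := mv_run (a := 1) (b := 0) (by simp) 2 _ (initState [1 :: encNats b,
      List.replicate a.headI 0, [], []]) rfl (by simp [initState_apply])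
    rw [update_initState _ _ _ (by simp), update_initState _ _ _ (by simp)] at e11
    simp only [initState_apply, List.getD_cons_zero, List.getD_cons_succ, List.append_nil,
      List.set_cons_zero, List.set_cons_succ, List.reverse_replicate, encNats_cons] at *
    exact ⟨_, e0.seq_silent <| e1.seq_silent <| e2.seq_silent <| e3.seq_silent <|
      e4.seq_silent <| e5.seq_silent <| e6.seq_silent <| e7.seq_silent <| e8.seq_silent <|
      e9.seq_silent <| e10.seq_silent e11⟩
  | fix f ih =>
    intro v w h
    simp only [Turing.ToPartrec.Code.fix_eval] at h
    have key : ∃ B, ERun (.loop 0 (.seq (.pop 0) (.seq ((ofCode f).rename (· + 1))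
        (.seq (.ifTop 1 (some 0) (.push 0 0) .skip) (.seq (moveBlock 1 2 3) (clear 2))))))
        (initState [[0], encNats v, [], []]) [] B (initState [[], encNats w, [], []]) := by
      -- Register 0 is the loop flag: it is raised again exactly if the head of the result of f is
      -- nonzero, which is the condition under which `fix` goes on.
      refine PFun.fixInduction (C := fun v => ∃ B, ERun _ (initState [[0], encNats v, [], []]) [] B
        (initState [[], encNats w, [], []])) h fun a ha hind => ?_
      obtain ⟨u, hu, hw⟩ : ∃ u, u ∈ f.eval a ∧ ((u.headI = 0 ∧ u.tail = w) ∨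
          (u.headI ≠ 0 ∧ Sum.inr u.tail ∈ Part.map (fun v : List ℕ =>
            if v.headI = 0 then (Sum.inl v.tail : List ℕ ⊕ List ℕ) else Sum.inr v.tail)
            (f.eval a))) := by
        rcases PFun.mem_fix_iff.1 ha with e | ⟨a', e, h'⟩
        · obtain ⟨u, hu, e⟩ := (Part.mem_map_iff _).1 e
          split_ifs at e with h0
          exact ⟨u, hu, .inl ⟨h0, by simpa using e⟩⟩
        · obtain ⟨u, hu, e⟩ := (Part.mem_map_iff _).1 e
          split_ifs at e with h0
          exact ⟨u, hu, .inr ⟨h0, (Part.mem_map_iff _).2 ⟨u, hu, by simp [h0]⟩⟩⟩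
      obtain ⟨B₁, h1⟩ := ih a u hu
      have e0 := ERun.pop 0 (initState [[0], encNats a, [], []])
      rw [update_initState _ _ _ (by simp)] at e0
      have e1 := h1.shift 1 (initState [[], encNats a, [], []]) rfl (by
        rintro (_ | _ | _ | _ | r) hr <;> first | omega | rfl)
      rw [update_initState _ _ _ (by simp)] at e1
      have e3 (l : List ℕ) := moveBlock_run (r := 1) (t := 2) (f := 3) (by simp) (by simp)
        (by simp) u (initState [l, encNats u, [], []]) rfl rfl
      simp only [update_initState _ _ _ (show 1 < List.length [_, _, _, _] by simp),
        List.set_cons_zero, List.set_cons_succ] at e3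
      simp only [update_initState _ _ _ (show 2 < List.length [_, _, _, _] by simp),
        List.set_cons_zero, List.set_cons_succ] at e3
      have e4 (l : List ℕ) := clear_run (a := 2) _ (initState [l, encNats u.tail,
        List.replicate u.headI 0, []]) rfl
      simp only [update_initState _ _ _ (show 2 < List.length [_, _, _, _] by simp),
        List.set_cons_zero, List.set_cons_succ] at e4
      simp only [initState_apply, List.getD_cons_zero, List.getD_cons_succ, List.append_nil,
        List.set_cons_zero, List.set_cons_succ, List.tail_cons] at e0 e1 e3 e4
      rcases hw with ⟨h0, rfl⟩ | ⟨h0, h'⟩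
      · have e2 := (ERun.skip (initState [[], encNats u, [], []])).ifTop_false (r := 1)
          (o := some 0) (p := .push 0 0) (by rcases u with _ | ⟨_ | n, u⟩ <;>
            simp_all [initState_apply])
        obtain ⟨B₃, e3⟩ := e3 []
        exact ⟨_, ERun.loop_step_silent (by simp [initState_apply]) (e0.seq_silent <|
          e1.seq_silent <| e2.seq_silent <| e3.seq_silent <| e4 []) (ERun.loop_done rfl)⟩
      · have e2 := (ERun.push 0 0 (initState [[], encNats u, [], []])).ifTop_true (r := 1)
          (o := some 0) (q := .skip) (by rcases u with _ | ⟨_ | n, u⟩ <;>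
            simp_all [initState_apply, List.replicate_succ])
        rw [update_initState _ _ _ (by simp)] at e2
        obtain ⟨B₃, e3⟩ := e3 [0]
        obtain ⟨B, hB⟩ := hind _ h'
        exact ⟨_, ERun.loop_step_silent (by simp [initState_apply]) (e0.seq_silent <|
          e1.seq_silent <| e2.seq_silent <| e3.seq_silent <| e4 [0]) hB⟩
    obtain ⟨B, key⟩ := key
    rw [initState_pad, initState_pad]
    have e0 := cp_run (a := 0) (b := 1) (t := 2) (by simp) (by simp) (by simp) 2
      (initState [encNats v, [], [], []]) rfl (fun x hx => lt_two_of_mem_encNats hx)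
    rw [update_initState _ _ _ (by simp)] at e0
    have e1 := clear_run (a := 0) _ (initState [encNats v, encNats v, [], []]) rfl
    rw [update_initState _ _ _ (by simp)] at e1
    have e2 := ERun.push 0 0 (initState [[], encNats v, [], []])
    rw [update_initState _ _ _ (by simp)] at e2
    have e3 := cp_run (a := 1) (b := 0) (t := 2) (by simp) (by simp) (by simp) 2
      (initState [[], encNats w, [], []]) rfl (fun x hx => lt_two_of_mem_encNats hx)
    rw [update_initState _ _ _ (by simp)] at e3
    have e4 := clear_run (a := 1) _ (initState [encNats w, encNats w, [], []]) rfl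
    rw [update_initState _ _ _ (by simp)] at e4
    simp only [initState_apply, List.getD_cons_zero, List.getD_cons_succ, List.append_nil,
      List.set_cons_zero, List.set_cons_succ] at *
    exact ⟨_, e0.seq_silent <| e1.seq_silent <| e2.seq_silent <| key.seq_silent <|
      e3.seq_silent e4⟩

/-- Every computable function on numbers is computed, in unary and in place, by a program. -/
theorem exists_prog_of_computable {h : ℕ → ℕ} (hh : Computable h) :
    ∃ p : Prog, ∀ n, ∃ B, ERun p (initState [unary n]) [] B (initState [unary (h n)]) := by
  have h1 : Nat.Partrec' fun v : List.Vector ℕ 1 => (h v.head : Part ℕ) :=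
    Nat.Partrec'.part_iff₁.2 hh.partrec
  obtain ⟨c, hc⟩ := Turing.ToPartrec.Code.exists_code h1
  -- The one-entry list of n is 0ⁿ with the separator at the bottom of the stack, so the number is
  -- set aside while the separator is pushed. After the computation the first entry is extracted
  -- again.
  refine ⟨.seq (mv 2 0 1) (.seq (.push 0 1) (.seq (mv 2 1 0) (.seq (ofCode c) (.seq
    (moveBlock 0 1 2) (mv 2 1 0))))), fun n => ?_⟩
  have h2 : [h n] ∈ c.eval [n] := by
    have := hc ⟨[n], rfl⟩
    simp only [List.Vector.head] at this
    rw [this]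
    simp
  obtain ⟨B, hB⟩ := ofCode_run c _ _ h2
  rw [initState_pad, initState_pad] at hB ⊢
  have e0 := mv_run (a := 0) (b := 1) (by simp) 2 _ (initState [unary n, [], [], []]) rfl
    (by simp [initState_apply, unary])
  rw [update_initState _ _ _ (by simp), update_initState _ _ _ (by simp)] at e0
  have e1 := ERun.push 0 1 (initState [[], unary n, [], []])
  rw [update_initState _ _ _ (by simp)] at e1
  have e2 := mv_run (a := 1) (b := 0) (by simp) 2 _ (initState [[1], unary n, [], []]) rfl
    (by simp [initState_apply, unary])
  rw [update_initState _ _ _ (by simp), update_initState _ _ _ (by simp)] at e2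
  obtain ⟨B₃, e3⟩ := moveBlock_run (r := 0) (t := 1) (f := 2) (by simp) (by simp) (by simp) [h n]
    (initState [encNats [h n], [], [], []]) rfl rfl
  rw [update_initState _ _ _ (by simp), update_initState _ _ _ (by simp)] at e3
  have e4 := mv_run (a := 1) (b := 0) (by simp) 2 _ (initState [[], unary (h n), [], []]) rfl
    (by simp [initState_apply, unary])
  rw [update_initState _ _ _ (by simp), update_initState _ _ _ (by simp)] at e4
  simp only [initState_apply, List.getD_cons_zero, List.getD_cons_succ, List.append_nil,
    List.set_cons_zero, List.set_cons_succ, unary, List.reverse_replicate, encNats_cons,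
    encNats_nil, List.tail_cons, List.headI_cons] at *
  exact ⟨_, e0.seq_silent <| e1.seq_silent <| e2.seq_silent <| hB.seq_silent <|
    e3.seq_silent e4⟩

/-! ### The running time of a program is computable -/

/-- All registers that occur in the program are less than `N`. -/
def Prog.RegsLT (N : ℕ) : Prog → Prop
  | .skip => True
  | .push r _ => r < N
  | .pop r => r < N
  | .emit r => r < N
  | .seq p q => p.RegsLT N ∧ q.RegsLT N
  | .ifTop r _ p q => r < N ∧ p.RegsLT N ∧ q.RegsLT N
  | .loop r p => r < N ∧ p.RegsLT N

theorem Prog.RegsLT.mono {N N' : ℕ} (hN : N ≤ N') : ∀ {p : Prog}, p.RegsLT N → p.RegsLT N'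
  | .skip, _ => trivial
  | .push _ _, h => lt_of_lt_of_le (b := N) h hN
  | .pop _, h => lt_of_lt_of_le (b := N) h hN
  | .emit _, h => lt_of_lt_of_le (b := N) h hN
  | .seq _ _, h => ⟨h.1.mono hN, h.2.mono hN⟩
  | .ifTop _ _ _ _, h => ⟨h.1.trans_le hN, h.2.1.mono hN, h.2.2.mono hN⟩
  | .loop _ _, h => ⟨h.1.trans_le hN, h.2.mono hN⟩

theorem Prog.exists_regsLT : ∀ p : Prog, ∃ N, p.RegsLT N
  | .skip => ⟨0, trivial⟩
  | .push r _ => ⟨r + 1, Nat.lt_succ_self r⟩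
  | .pop r => ⟨r + 1, Nat.lt_succ_self r⟩
  | .emit r => ⟨r + 1, Nat.lt_succ_self r⟩
  | .seq p q => by
    obtain ⟨a, ha⟩ := p.exists_regsLT
    obtain ⟨b, hb⟩ := q.exists_regsLT
    exact ⟨max a b, ha.mono (by omega), hb.mono (by omega)⟩
  | .ifTop r _ p q => by
    obtain ⟨a, ha⟩ := p.exists_regsLT
    obtain ⟨b, hb⟩ := q.exists_regsLT
    exact ⟨max (max a b) (r + 1), by omega, ha.mono (by omega), hb.mono (by omega)⟩
  | .loop r p => by
    obtain ⟨a, ha⟩ := p.exists_regsLT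
    exact ⟨max a (r + 1), by omega, ha.mono (by omega)⟩

/-- The contents of the first `N` registers. -/
def State.take (N : ℕ) (s : State) : Fin N → List ℕ := fun i => s i

theorem State.take_update {N r : ℕ} (hr : r < N) (s : State) (l : List ℕ) :
    State.take N (Function.update s r l) = Function.update (State.take N s) ⟨r, hr⟩ l := by
  funext i
  simp [State.take, Function.update_apply, Fin.ext_iff]

theorem primrec_update {N : ℕ} (i : Fin N) {f : (Fin N → List ℕ) → List ℕ} (hf : Primrec f) :
    Primrec fun v : Fin N → List ℕ => Function.update v i (f v) := by
  refine Primrec.fin_curry.2 ?_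
  have : Primrec₂ fun (v : Fin N → List ℕ) (j : Fin N) => if j = i then f v else v j :=
    Primrec.ite (Primrec.eq.comp Primrec.snd (Primrec.const i)) (hf.comp Primrec.fst)
      (Primrec.fin_app.comp Primrec.fst Primrec.snd)
  exact this.of_eq fun v j => by simp [Function.update_apply]

/-- An interpreter, by recursion on the program. Only finitely many registers occur, so the state is
a vector in a `Primcodable` type. The second component counts the steps. Only one direction is
needed: `R` returns the result of every halting run. -/
theorem exists_partrec_run (N : ℕ) (p : Prog) (hp : p.RegsLT N) :
    ∃ R : (Fin N → List ℕ) →. (Fin N → List ℕ) × ℕ, Partrec R ∧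
      ∀ s τ s', Run p s τ s' → (State.take N s', τ.length) ∈ R (State.take N s) := by
  induction p with
  | skip =>
    refine ⟨fun v => Part.some (v, 1), (Computable.pair .id (.const 1)).partrec, ?_⟩
    intro s τ s' h
    cases h
    simp
  | push r a =>
    refine ⟨fun v => Part.some (Function.update v ⟨r, hp⟩ (a :: v ⟨r, hp⟩), 1),
      (Computable.pair (primrec_update _ (Primrec.list_cons.comp (.const a)
        (Primrec.fin_app.comp .id (.const _)))).to_comp (.const 1)).partrec, ?_⟩
    intro s τ s' h
    cases h
    simp [State.take_update hp]
    rfl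
  | pop r =>
    refine ⟨fun v => Part.some (Function.update v ⟨r, hp⟩ (v ⟨r, hp⟩).tail, 1),
      (Computable.pair (primrec_update _ (Primrec.list_tail.comp
        (Primrec.fin_app.comp .id (.const _)))).to_comp (.const 1)).partrec, ?_⟩
    intro s τ s' h
    cases h
    simp [State.take_update hp]
    rfl
  | emit r =>
    refine ⟨fun v => Part.some (v, (v ⟨r, hp⟩).length + 1), (Computable.pair .id
      (Primrec.succ.comp (Primrec.list_length.comp
        (Primrec.fin_app.comp .id (.const _)))).to_comp).partrec, ?_⟩
    intro s τ s' h
    cases h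
    simp [State.take]
  | seq p q ihp ihq =>
    obtain ⟨R₁, h1, g1⟩ := ihp hp.1
    obtain ⟨R₂, h2, g2⟩ := ihq hp.2
    refine ⟨fun v => (R₁ v).bind fun a => (R₂ a.1).map fun b => (b.1, a.2 + b.2),
      h1.bind (Partrec.map (h2.comp (Computable.fst.comp .snd))
        (Computable.pair (Computable.fst.comp .snd)
          (Primrec.nat_add.comp (Primrec.snd.comp (Primrec.snd.comp .fst))
            (Primrec.snd.comp .snd)).to_comp).to₂), ?_⟩
    intro s τ s' h
    cases h with
    | seq r1 r2 =>
      refine Part.mem_bind_iff.2 ⟨_, g1 _ _ _ r1, (Part.mem_map_iff _).2 ⟨_, g2 _ _ _ r2, ?_⟩⟩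
      simp
  | ifTop r o p q ihp ihq =>
    obtain ⟨R₁, h1, g1⟩ := ihp hp.2.1
    obtain ⟨R₂, h2, g2⟩ := ihq hp.2.2
    refine ⟨fun v => (bif (decide ((v ⟨r, hp.1⟩).head? = o)) then R₁ v else R₂ v).map
        fun b => (b.1, b.2 + 1), Partrec.map (Partrec.cond ?_ h1 h2)
        (Computable.pair (Computable.fst.comp .snd)
          (Primrec.succ.comp (Primrec.snd.comp .snd)).to_comp).to₂, ?_⟩
    · exact (Primrec.eq.comp (Primrec.list_head?.comp (Primrec.fin_app.comp .id (.const _)))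
        (.const o)).decide.to_comp
    · intro s τ s' h
      cases h with
      | ifTop_true ho r1 =>
        refine (Part.mem_map_iff _).2 ⟨(State.take N s', _), ?_, rfl⟩
        rw [decide_eq_true (by exact ho)]
        exact g1 _ _ _ r1
      | ifTop_false ho r1 =>
        refine (Part.mem_map_iff _).2 ⟨(State.take N s', _), ?_, rfl⟩
        rw [decide_eq_false (by exact ho)]
        exact g2 _ _ _ r1
  | loop r p ih =>
    obtain ⟨R, h1, g1⟩ := ih hp.2
    let body : ((Fin N → List ℕ) × ℕ) →. ((Fin N → List ℕ) × ℕ) ⊕ ((Fin N → List ℕ) × ℕ) :=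
      fun v => bif decide (v.1 ⟨r, hp.1⟩ = []) then Part.some (Sum.inl (v.1, v.2 + 1))
        else (R v.1).map fun b => Sum.inr (b.1, v.2 + 1 + b.2)
    have hbody : Partrec body := by
      refine Partrec.cond ?_ ?_ ?_
      · exact (Primrec.eq.comp (Primrec.fin_app.comp .fst (.const _)) (.const [])).decide.to_comp
      · exact (Primrec.sumInl.comp (Primrec.pair .fst (Primrec.succ.comp .snd))).to_comp.partrec
      · exact Partrec.map (h1.comp .fst) (Primrec.sumInr.comp (Primrec.pair
          (Primrec.fst.comp .snd) (Primrec.nat_add.comp (Primrec.succ.comp (Primrec.snd.comp .fst))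
            (Primrec.snd.comp .snd)))).to_comp.to₂
    -- The program is a variable p' so that induction on the run applies; t is the number of steps
    -- made before.
    have key : ∀ p' s τ s', Run p' s τ s' → p' = .loop r p → ∀ t,
        (State.take N s', t + τ.length) ∈ PFun.fix body (State.take N s, t) := by
      intro p' s τ s' h
      induction h with
      | loop_done hr =>
        rintro e t
        cases e
        refine PFun.mem_fix_iff.2 (.inl ?_)
        simp only [body]
        rw [decide_eq_true (by exact hr)]
        simp
      | @loop_step _ _ _ s₁ _ τ₁ _ hr h2 _ _ ih2 =>
        rintro e t
        cases e
        have h3 := ih2 rfl (t + 1 + List.length τ₁)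
        refine PFun.mem_fix_iff.2 (.inr ⟨(State.take N s₁, t + 1 + τ₁.length), ?_, ?_⟩)
        rotate_left
        · convert h3 using 2
          simp
          omega
        · simp only [body]
          rw [decide_eq_false (by exact hr)]
          exact (Part.mem_map_iff _).2 ⟨_, g1 _ _ _ h2, rfl⟩
      | _ => rintro ⟨⟩
    refine ⟨fun v => PFun.fix body (v, 0), (Partrec.fix hbody).comp
      (Computable.pair .id (.const 0)), fun s τ s' h => ?_⟩
    simpa using key _ s τ s' h rfl 0

/-- The running time of a program that halts on all inputs of a computable family is
computable. -/
theorem exists_computable_time {α : Type*} [Primcodable α] (p : Prog) (f : α → State)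
    (hf : ∀ N, Computable fun a => State.take N (f a)) (s' : α → State)
    (h : ∀ a, ∃ B, ERun p (f a) [] B (s' a)) :
    ∃ T : α → ℕ, Computable T ∧ ∀ a, Run p (f a) (List.replicate (T a) none) (s' a) := by
  choose B hB using h
  choose T hT hT' using fun a => (hB a).silent
  obtain ⟨N, hN⟩ := p.exists_regsLT
  obtain ⟨R, h1, g1⟩ := exists_partrec_run N p hN
  refine ⟨T, ?_, hT'⟩
  have : Partrec fun a => (R (State.take N (f a))).map Prod.snd :=
    Partrec.map (h1.comp (hf N)) (Computable.snd.comp .snd).to₂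
  -- `T` was merely chosen, but it is the total function computed by the interpreter, so it is
  -- computable.
  refine this.of_eq_tot fun a => (Part.mem_map_iff _).2 ⟨_, g1 _ _ _ (hT' a), by simp⟩

/-- Used to cut a run of a sequence at its middle and to glue the pieces differently, when a loop is
unrolled. -/
theorem ERun.seq_inv {p q : Prog} {s s' : State} {B : ℕ} (h : ERun (.seq p q) s [] B s') :
    ∃ s₁ B₁ B₂, ERun p s [] B₁ s₁ ∧ ERun q s₁ [] B₂ s' ∧ B₁ + B₂ ≤ B := by
  obtain ⟨n, hn, h⟩ := h.silent
  generalize hτ : List.replicate n none = τ at h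
  cases h with
  | @seq _ _ _ s₁ _ τ₁ τ₂ h1 h2 =>
    obtain ⟨e1, e2, e3⟩ := List.append_eq_replicate_iff.1 hτ.symm
    exact ⟨s₁, τ₁.length, τ₂.length, .of_run (e2 ▸ h1) le_rfl, .of_run (e3 ▸ h2) le_rfl, by omega⟩

/-! ### Running a program until its fuel is used up or it produces its first output -/

/-- Registers for the watched version of a program: `ρ r` plays the role of register `r`; the
fuel is in `c`, the first output goes to `o`, and `f` tells whether there was one; `φ` is the flag
that controls the loops. Symbols that are output have to be less than `n`. -/
structure Layout where
  /-- registers of the program -/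
  ρ : ℕ → ℕ
  /-- fuel -/
  c : ℕ
  /-- output -/
  o : ℕ
  /-- whether there was an output -/
  f : ℕ
  /-- loop flag -/
  φ : ℕ
  /-- bound on the symbols -/
  n : ℕ
  inj : Function.Injective ρ
  ρc : ∀ r, ρ r ≠ c
  ρo : ∀ r, ρ r ≠ o
  ρf : ∀ r, ρ r ≠ f
  ρφ : ∀ r, ρ r ≠ φ
  co : c ≠ o
  cf : c ≠ f
  cφ : c ≠ φ
  fo : f ≠ o
  oφ : o ≠ φ
  fφ : f ≠ φ

namespace Layout

variable (ℓ : Layout)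

/-- Use up one unit of fuel; the symbol `1` stands for unlimited fuel. -/
def tick : Prog := .ifTop ℓ.c (some 1) .skip (.pop ℓ.c)

/-- Raise the flag if there is fuel and register `r` is nonempty. -/
def setFlag (r : ℕ) : Prog :=
  .ifTop ℓ.c none .skip (.ifTop (ℓ.ρ r) none .skip (.push ℓ.φ 0))

/-- The version of a program that stops when the fuel is used up or when it produces its
first output. -/
def watch : Prog → Prog
  | .skip => ℓ.tick
  | .push r a => .seq ℓ.tick (.push (ℓ.ρ r) a)
  | .pop r => .seq ℓ.tick (.pop (ℓ.ρ r))
  | .emit r => .ifTop ℓ.c none .skip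
      (.seq (.pop ℓ.c) (.seq (.push ℓ.f 0) (mv ℓ.n (ℓ.ρ r) ℓ.o)))
  | .seq p q => .seq (watch p) (watch q)
  | .ifTop r a p q => .seq ℓ.tick (.ifTop (ℓ.ρ r) a (watch p) (watch q))
  | .loop r p => .seq ℓ.tick (.seq (ℓ.setFlag r)
      (.loop ℓ.φ (.seq (.pop ℓ.φ) (.seq (watch p) (.seq ℓ.tick (ℓ.setFlag r))))))

/-- A bound on the number of steps that `watch p` still makes when there is no fuel. -/
def rest : Prog → ℕ
  | .skip => 10
  | .push _ _ => 10
  | .pop _ => 10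
  | .emit _ => 10
  | .seq p q => rest p + rest q
  | .ifTop _ _ p q => rest p + rest q + 10
  | .loop _ p => rest p + 20

/-- The fuel is unlimited or a number in unary. -/
def Fuel (l : List ℕ) : Prop := l = [1] ∨ ∃ t, l = List.replicate t 0

/-- The fuel that remains after `g` steps. -/
def burn (l : List ℕ) (g : ℕ) : List ℕ := if l = [1] then [1] else l.drop g

/-- The two states agree outside of the registers of the layout. -/
def Frame (t t' : State) : Prop :=
  ∀ q, (∀ r, q ≠ ℓ.ρ r) → q ≠ ℓ.c → q ≠ ℓ.o → q ≠ ℓ.f → q ≠ ℓ.φ → t' q = t q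

/-- What happens without fuel. -/
def Idle (t t' : State) : Prop :=
  t' ℓ.c = [] ∧ t' ℓ.φ = [] ∧ t' ℓ.o = t ℓ.o ∧ t' ℓ.f = t ℓ.f ∧ ℓ.Frame t t'

/-- The outcome of a run that is not stopped. -/
def Alive (τ : Trace) (s' : State) (t t' : State) (B : ℕ) : Prop :=
  τ.outputs = [] ∧ B ≤ (ℓ.n + 10) * τ.length ∧ t' ℓ.c = burn (t ℓ.c) τ.length ∧ t' ℓ.c ≠ [] ∧
    (∀ r, t' (ℓ.ρ r) = s' r) ∧ t' ℓ.φ = [] ∧ t' ℓ.o = t ℓ.o ∧ t' ℓ.f = t ℓ.f ∧ ℓ.Frame t t'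

/-- The outcome of a run that is stopped. -/
def Dead (τ : Trace) (t t' : State) (B D : ℕ) : Prop :=
  t' ℓ.c = [] ∧ t' ℓ.φ = [] ∧ ℓ.Frame t t' ∧ ∃ g τ', τ = List.replicate g none ++ τ' ∧
    B ≤ (ℓ.n + 10) * g + D ∧
    ((t ℓ.c = List.replicate g 0 ∧ t' ℓ.o = t ℓ.o ∧ t' ℓ.f = t ℓ.f) ∨
      (t ℓ.c = [1] ∧ ∃ w τ'', τ' = some w :: τ'' ∧ t' ℓ.f = 0 :: t ℓ.f ∧
        ((∀ a ∈ w, a < ℓ.n) → t' ℓ.o = w.reverse ++ t ℓ.o)))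

variable {ℓ}

theorem burn_replicate (t g : ℕ) : burn (List.replicate t 0) g = List.replicate (t - g) 0 := by
  rw [burn, if_neg, List.drop_replicate]
  intro h
  have : 1 ∈ List.replicate t 0 := by rw [h]; simp
  simp at this

theorem Fuel.burn {l : List ℕ} (h : Fuel l) (g : ℕ) : Fuel (burn l g) := by
  rcases h with rfl | ⟨t, rfl⟩
  · exact .inl rfl
  · exact .inr ⟨_, burn_replicate t g⟩

theorem Fuel.burn_burn {l : List ℕ} (h : Fuel l) (g g' : ℕ) :
    Layout.burn (Layout.burn l g) g' = Layout.burn l (g + g') := by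
  rcases h with rfl | ⟨t, rfl⟩
  · rfl
  · simp [burn_replicate, Nat.sub_sub]

theorem Frame.trans {t t₁ t₂ : State} (h : ℓ.Frame t t₁) (h' : ℓ.Frame t₁ t₂) : ℓ.Frame t t₂ :=
  fun q h1 h2 h3 h4 h5 => (h' q h1 h2 h3 h4 h5).trans (h q h1 h2 h3 h4 h5)

theorem Idle.trans {t t₁ t₂ : State} (h : ℓ.Idle t t₁) (h' : ℓ.Idle t₁ t₂) : ℓ.Idle t t₂ := by
  obtain ⟨a1, a2, a3, a4, a5⟩ := h
  obtain ⟨b1, b2, b3, b4, b5⟩ := h'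
  exact ⟨b1, b2, b3.trans a3, b4.trans a4, a5.trans b5⟩

theorem Idle.refl {t : State} (hc : t ℓ.c = []) (hφ : t ℓ.φ = []) : ℓ.Idle t t :=
  ⟨hc, hφ, rfl, rfl, fun _ _ _ _ _ _ => rfl⟩

theorem Alive.trans {τ₁ τ₂ : Trace} {s₁ s₂ t t₁ t₂ : State} {B₁ B₂ : ℕ} (hf : Fuel (t ℓ.c))
    (h : ℓ.Alive τ₁ s₁ t t₁ B₁) (h' : ℓ.Alive τ₂ s₂ t₁ t₂ B₂) :
    ℓ.Alive (τ₁ ++ τ₂) s₂ t t₂ (B₁ + B₂) := by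
  obtain ⟨a1, a2, a3, a4, a5, a6, a7, a8, a9⟩ := h
  obtain ⟨b1, b2, b3, b4, b5, b6, b7, b8, b9⟩ := h'
  refine ⟨by simp [Trace.outputs_append, *], by simp only [List.length_append, mul_add]; omega,
    ?_, b4, b5, b6, b7.trans a7, b8.trans a8, a9.trans b9⟩
  rw [b3, a3, hf.burn_burn, List.length_append]

/-- The silent steps of the first part count towards the g steps before the stop. Since fuel was
left after the first part, truncated subtraction does no harm when the fuel used is added up. -/
theorem Alive.trans_dead {τ₁ τ₂ : Trace} {s₁ t t₁ t₂ : State} {B₁ B₂ D : ℕ} (hf : Fuel (t ℓ.c))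
    (h : ℓ.Alive τ₁ s₁ t t₁ B₁) (h' : ℓ.Dead τ₂ t₁ t₂ B₂ D) :
    ℓ.Dead (τ₁ ++ τ₂) t t₂ (B₁ + B₂) D := by
  obtain ⟨a1, a2, a3, a4, a5, a6, a7, a8, a9⟩ := h
  obtain ⟨b1, b2, b3, g, τ', rfl, b4, b5⟩ := h'
  refine ⟨b1, b2, a9.trans b3, τ₁.length + g, τ', ?_, by rw [mul_add]; omega, ?_⟩
  · rw [← List.replicate_append_replicate, ← Trace.eq_replicate_of_outputs a1, List.append_assoc]
  · rcases b5 with ⟨c1, c2, c3⟩ | ⟨c1, w, τ'', c2, c3, c4⟩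
    · refine .inl ⟨?_, c2.trans a7, c3.trans a8⟩
      rcases hf with hf | ⟨u, hf⟩
      · rw [a3, hf] at c1
        have : 1 ∈ List.replicate g 0 := by rw [← c1]; simp [burn]
        simp at this
      · rw [a3, hf, burn_replicate] at c1
        rw [a3, hf, burn_replicate] at a4
        have h1 := congrArg List.length c1
        simp only [List.length_replicate] at h1
        have h2 : u - τ₁.length ≠ 0 := by
          intro h; simp [h] at a4
        rw [hf]
        congr 1
        omega
    · refine .inr ⟨?_, w, τ'', c2, by rw [c3, a8], fun hw => by rw [c4 hw, a7]⟩
      rcases hf with hf | ⟨u, hf⟩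
      · exact hf
      · rw [a3, hf, burn_replicate] at c1
        have : 1 ∈ List.replicate (u - τ₁.length) 0 := by rw [c1]; simp
        simp at this

theorem Dead.trans {τ₁ : Trace} (τ₂ : Trace) {t t₁ t₂ : State} {B₁ B₂ D₁ : ℕ}
    (h : ℓ.Dead τ₁ t t₁ B₁ D₁) (h' : ℓ.Idle t₁ t₂) :
    ℓ.Dead (τ₁ ++ τ₂) t t₂ (B₁ + B₂) (D₁ + B₂) := by
  obtain ⟨b1, b2, b3, g, τ', rfl, b4, b5⟩ := h
  obtain ⟨a1, a2, a3, a4, a5⟩ := h'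
  refine ⟨a1, a2, b3.trans a5, g, τ' ++ τ₂, by simp, by omega, ?_⟩
  rcases b5 with ⟨c1, c2, c3⟩ | ⟨c1, w, τ'', c2, c3, c4⟩
  · exact .inl ⟨c1, a3.trans c2, a4.trans c3⟩
  · exact .inr ⟨c1, w, τ'' ++ τ₂, by simp [c2], by rw [a4, c3], fun hw => by rw [a3, c4 hw]⟩

theorem Dead.mono {τ : Trace} {t t' : State} {B B' D D' : ℕ} (h : ℓ.Dead τ t t' B D)
    (hB : B' + D ≤ B + D') : ℓ.Dead τ t t' B' D' := by
  obtain ⟨b1, b2, b3, g, τ', h1, b4, b5⟩ := h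
  exact ⟨b1, b2, b3, g, τ', h1, by omega, b5⟩

theorem Alive.mono {τ : Trace} {s' t t' : State} {B B' : ℕ} (h : ℓ.Alive τ s' t t' B)
    (hB : B' ≤ B) : ℓ.Alive τ s' t t' B' :=
  ⟨h.1, hB.trans h.2.1, h.2.2⟩

theorem tick_run {t : State} (hf : Fuel (t ℓ.c)) :
    ERun ℓ.tick t [] 2 (Function.update t ℓ.c (burn (t ℓ.c) 1)) := by
  rcases hf with hf | ⟨u, hf⟩
  · refine (ERun.skip t).ifTop_true (by simp [hf]) |>.cast ?_
    rw [hf, burn, if_pos rfl, ← hf, Function.update_eq_self]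
  · refine (ERun.pop ℓ.c t).ifTop_false ?_ |>.cast ?_
    · rw [hf]
      cases u <;> simp [List.replicate_succ]
    · rw [hf, burn_replicate, List.tail_replicate]

theorem tick_idle {t : State} (hc : t ℓ.c = []) : ERun ℓ.tick t [] 2 t :=
  (tick_run (.inr ⟨0, hc⟩)).cast (by
    conv_rhs => rw [← Function.update_eq_self ℓ.c t, hc]
    rw [hc]
    rfl)

theorem tick_outcome {s t : State} (hs : ∀ r, t (ℓ.ρ r) = s r) (hf : Fuel (t ℓ.c))
    (hc : t ℓ.c ≠ []) (hφ : t ℓ.φ = []) :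
    ∃ t₁, ERun ℓ.tick t [] 2 t₁ ∧ (∀ r, t₁ (ℓ.ρ r) = s r) ∧ Fuel (t₁ ℓ.c) ∧ t₁ ℓ.φ = [] ∧
      ((ℓ.Alive [none] s t t₁ (ℓ.n + 10)) ∨ ℓ.Dead [none] t t₁ (ℓ.n + 10) 0) := by
  refine ⟨_, tick_run hf, fun r => by simp [ℓ.ρc, hs], by simpa using hf.burn 1,
    by simp [ℓ.cφ.symm, hφ], ?_⟩
  by_cases h : burn (t ℓ.c) 1 = []
  · right
    refine ⟨by simp [h], by simp [ℓ.cφ.symm, hφ], fun q _ h2 _ _ _ => by simp [h2], 1, [], rfl,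
      by simp, .inl ⟨?_, by simp [ℓ.co.symm], by simp [ℓ.cf.symm]⟩⟩
    rcases hf with hf | ⟨u, hf⟩
    · simp [hf, burn] at h
    · rw [hf, burn_replicate] at h
      have h1 := congrArg List.length h
      simp only [List.length_replicate, List.length_nil] at h1
      have h2 : u ≠ 0 := by rintro rfl; simp [hf] at hc
      rw [hf]
      congr 1
      omega
  · left
    exact ⟨by simp, by simp, by simp, by simpa using h, fun r => by simp [ℓ.ρc, hs],
      by simp [ℓ.cφ.symm, hφ], by simp [ℓ.co.symm], by simp [ℓ.cf.symm],
      fun q _ h2 _ _ _ => by simp [h2]⟩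

/-- There is no instruction that aborts a program, so a stopped simulation has to fall through the
remaining text. Without fuel no loop flag is raised, hence no loop body is entered and the cost
depends on the text only. The simulated registers may still change, which is harmless. -/
theorem watch_idle (p : Prog) : ∀ t : State, t ℓ.c = [] → t ℓ.φ = [] →
    ∃ t', ERun (ℓ.watch p) t [] (rest p) t' ∧ ℓ.Idle t t' := by
  induction p with
  | skip =>
    intro t hc hφ
    exact ⟨t, (tick_idle hc).mono (by simp [rest]), .refl hc hφ⟩
  | push r a =>
    intro t hc hφ
    refine ⟨_, (tick_idle hc).seq_silent (.push _ a t) |>.mono (by simp [rest]),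
      by simp [(ℓ.ρc r).symm, hc], by simp [(ℓ.ρφ r).symm, hφ], by simp [(ℓ.ρo r).symm],
      by simp [(ℓ.ρf r).symm], fun q h _ _ _ _ => by simp [h r]⟩
  | pop r =>
    intro t hc hφ
    refine ⟨_, (tick_idle hc).seq_silent (.pop _ t) |>.mono (by simp [rest]),
      by simp [(ℓ.ρc r).symm, hc], by simp [(ℓ.ρφ r).symm, hφ], by simp [(ℓ.ρo r).symm],
      by simp [(ℓ.ρf r).symm], fun q h _ _ _ _ => by simp [h r]⟩
  | emit r =>
    intro t hc hφ
    exact ⟨t, (ERun.skip t).ifTop_true (by simp [hc]) |>.mono (by simp [rest]), .refl hc hφ⟩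
  | seq p q ihp ihq =>
    intro t hc hφ
    obtain ⟨t₁, h1, g1⟩ := ihp t hc hφ
    obtain ⟨t₂, h2, g2⟩ := ihq t₁ g1.1 g1.2.1
    exact ⟨t₂, h1.seq_silent h2, g1.trans g2⟩
  | ifTop r o p q ihp ihq =>
    intro t hc hφ
    by_cases ho : (t (ℓ.ρ r)).head? = o
    · obtain ⟨t₁, h1, g1⟩ := ihp t hc hφ
      exact ⟨t₁, (tick_idle hc).seq_silent (h1.ifTop_true ho) |>.mono
        (by simp [rest]; omega), g1⟩
    · obtain ⟨t₁, h1, g1⟩ := ihq t hc hφ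
      exact ⟨t₁, (tick_idle hc).seq_silent (h1.ifTop_false ho) |>.mono
        (by simp [rest]; omega), g1⟩
  | loop r p ih =>
    intro t hc hφ
    exact ⟨t, (tick_idle hc).seq_silent (((ERun.skip t).ifTop_true (by simp [hc])).seq_silent
      (.loop_done hφ)) |>.mono (by simp [rest]), .refl hc hφ⟩

theorem setFlag_idle {t : State} (r : ℕ) (hc : t ℓ.c = []) : ERun (ℓ.setFlag r) t [] 2 t :=
  (ERun.skip t).ifTop_true (by simp [hc])

/-- If `p` makes a run with trace `τ`, then `watch p` either simulates the whole run, or it stops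
because `τ` starts with as many silent steps as there is fuel, or because it finds the first
output. The number of steps is linear in the number of simulated steps. -/
theorem watch_run {p : Prog} {s s' : State} {τ : Trace} (h : Run p s τ s') : ∀ t : State,
    (∀ r, t (ℓ.ρ r) = s r) → Fuel (t ℓ.c) → t ℓ.c ≠ [] → t ℓ.φ = [] →
    (t ℓ.c = [1] ∨ τ.outputs = []) →
    ∃ t' B, ERun (ℓ.watch p) t [] B t' ∧ (ℓ.Alive τ s' t t' B ∨ ℓ.Dead τ t t' B (rest p)) := by
  induction h with
  | skip s =>
    intro t hs hf hc hφ _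
    obtain ⟨t₁, h1, h2, h3, h4, h5⟩ := tick_outcome hs hf hc hφ
    exact ⟨t₁, _, h1.mono (B' := ℓ.n + 10) (by omega),
      h5.imp id fun h => h.mono (by omega)⟩
  | push r a s =>
    intro t hs hf hc hφ _
    obtain ⟨t₁, h1, h2, h3, h4, h5⟩ := tick_outcome hs hf hc hφ
    refine ⟨_, _, (h1.seq_silent (.push (ℓ.ρ r) a t₁)).mono (B' := ℓ.n + 10) (by omega),
      h5.imp (fun h => ?_) fun h => ?_⟩
    · obtain ⟨a1, a2, a3, a4, a5, a6, a7, a8, a9⟩ := h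
      refine ⟨a1, a2, by simp [(ℓ.ρc r).symm, a3], by simpa [(ℓ.ρc r).symm] using a4, fun q => ?_,
        by simp [(ℓ.ρφ r).symm, a6], by simp [(ℓ.ρo r).symm, a7], by simp [(ℓ.ρf r).symm, a8],
        a9.trans fun q h _ _ _ _ => by simp [h r]⟩
      simp [Function.update_apply, ℓ.inj.eq_iff, a5]
    · have e := h.trans (t₂ := Function.update t₁ (ℓ.ρ r) (a :: t₁ (ℓ.ρ r))) (B₂ := 10) []
        ⟨by simp [(ℓ.ρc r).symm, h.1], by simp [(ℓ.ρφ r).symm, h4], by simp [(ℓ.ρo r).symm],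
        by simp [(ℓ.ρf r).symm], fun q h _ _ _ _ => by simp [h r]⟩
      exact e.mono (by simp [rest])
  | pop r s =>
    intro t hs hf hc hφ _
    obtain ⟨t₁, h1, h2, h3, h4, h5⟩ := tick_outcome hs hf hc hφ
    refine ⟨_, _, (h1.seq_silent (.pop (ℓ.ρ r) t₁)).mono (B' := ℓ.n + 10) (by omega),
      h5.imp (fun h => ?_) fun h => ?_⟩
    · obtain ⟨a1, a2, a3, a4, a5, a6, a7, a8, a9⟩ := h
      refine ⟨a1, a2, by simp [(ℓ.ρc r).symm, a3], by simpa [(ℓ.ρc r).symm] using a4, fun q => ?_,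
        by simp [(ℓ.ρφ r).symm, a6], by simp [(ℓ.ρo r).symm, a7], by simp [(ℓ.ρf r).symm, a8],
        a9.trans fun q h _ _ _ _ => by simp [h r]⟩
      simp [Function.update_apply, ℓ.inj.eq_iff, a5]
    · have e := h.trans (t₂ := Function.update t₁ (ℓ.ρ r) (t₁ (ℓ.ρ r)).tail) (B₂ := 10) []
        ⟨by simp [(ℓ.ρc r).symm, h.1], by simp [(ℓ.ρφ r).symm, h4], by simp [(ℓ.ρo r).symm],
        by simp [(ℓ.ρf r).symm], fun q h _ _ _ _ => by simp [h r]⟩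
      exact e.mono (by simp [rest])
  | emit r s =>
    intro t hs hf hc hφ h1
    -- The trace contains an output, so the fuel must be unlimited here; limited fuel is only
    -- considered for silent runs.
    replace h1 : t ℓ.c = [1] := h1.resolve_right (by simp [Trace.outputs_append])
    let t₁ := Function.update (Function.update t ℓ.c []) ℓ.f (0 :: t ℓ.f)
    have e1 : ERun (.seq (.pop ℓ.c) (.push ℓ.f 0)) t [] 2 t₁ :=
      ((ERun.pop ℓ.c t).seq_silent (.push ℓ.f 0 _)).cast (by simp [t₁, h1, ℓ.cf.symm])
    obtain ⟨a, B₁, B₂, e2, e3, e4⟩ := e1.seq_inv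
    have ht₁ : t₁ (ℓ.ρ r) = s r := by simp [t₁, ℓ.ρc, ℓ.ρf, hs]
    -- Copying w costs a multiple of its length, which is paid for by the |w| silent steps that
    -- precede the output. If a symbol is too large, the output register holds no meaningful word,
    -- and `Dead` claims nothing about it.
    have D : ∀ t', (t' ℓ.o = (s r).reverse ++ t₁ ℓ.o ∨ ¬ ∀ a ∈ s r, a < ℓ.n) →
        (∀ q, q ≠ ℓ.ρ r → q ≠ ℓ.o → t' q = t₁ q) →
        ℓ.Dead (List.replicate (s r).length none ++ [some (s r)]) t t'
          ((ℓ.n + 3) * (s r).length + 5) 10 := by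
      intro t' h1' h2'
      refine ⟨?_, ?_, ?_, (s r).length, [some (s r)], rfl, by ring_nf; omega,
        .inr ⟨h1, s r, [], rfl,
        ?_, fun hw => ?_⟩⟩
      · rw [h2' _ (ℓ.ρc r).symm ℓ.co]; simp [t₁, ℓ.cf]
      · rw [h2' _ (ℓ.ρφ r).symm ℓ.oφ.symm]; simp [t₁, ℓ.fφ.symm, ℓ.cφ.symm, hφ]
      · intro q g1 g2 g3 g4 g5
        rw [h2' _ (g1 r) g3]; simp [t₁, g2, g4]
      · rw [h2' _ (ℓ.ρf r).symm ℓ.fo]; simp [t₁]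
      · rw [h1'.resolve_right (by simpa using hw)]
        simp [t₁, ℓ.fo.symm, ℓ.co.symm]
    by_cases hw : ∀ a ∈ s r, a < ℓ.n
    · have e5 := mv_run (ℓ.ρo r) ℓ.n (s r) t₁ ht₁ hw
      refine ⟨_, _, ((e2.seq_silent (e3.seq_silent e5)).ifTop_false (by simp [h1])).mono
        (B' := (ℓ.n + 3) * (s r).length + 5) (by omega), .inr (D _ ?_ ?_)⟩
      · left; simp
      · intro q g1 g2; simp [g1, g2]
    · obtain ⟨t', e5, e6, e7⟩ := mv_run' (ℓ.ρo r) ℓ.n (s r) t₁ ht₁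
      refine ⟨_, _, ((e2.seq_silent (e3.seq_silent e5)).ifTop_false (by simp [h1])).mono
        (B' := (ℓ.n + 3) * (s r).length + 5) (by omega), .inr (D _ (.inr hw) e7)⟩
  | @seq p q s s₁ s₂ τ₁ τ₂ _ _ ih₁ ih₂ =>
    intro t hs hf hc hφ ho
    rw [Trace.outputs_append, List.append_eq_nil_iff] at ho
    obtain ⟨t₁, B₁, e1, h1⟩ := ih₁ t hs hf hc hφ (ho.imp id And.left)
    rcases h1 with h1 | h1
    · have hfb := h1.2.2.1
      obtain ⟨t₂, B₂, e2, h2⟩ := ih₂ t₁ h1.2.2.2.2.1 (hfb ▸ hf.burn _) h1.2.2.2.1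
        h1.2.2.2.2.2.1 (ho.imp (fun h => by rw [hfb, h]; rfl) And.right)
      exact ⟨t₂, _, e1.seq_silent e2, h2.imp (fun h => h1.trans hf h) fun h =>
        (h1.trans_dead hf h).mono (by simp only [rest]; omega)⟩
    · obtain ⟨t₂, e2, h2⟩ := watch_idle (ℓ := ℓ) q t₁ h1.1 h1.2.1
      exact ⟨t₂, _, e1.seq_silent e2, .inr ((h1.trans (B₂ := rest q) τ₂ h2).mono (by
        simp only [rest]; omega))⟩
  | @ifTop_true r o p q s s' τ ho _ ih =>
    intro t hs hf hc hφ hout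
    rw [Trace.outputs_cons_none] at hout
    obtain ⟨t₁, h1, h2, h3, h4, h5⟩ := tick_outcome hs hf hc hφ
    rcases h5 with h5 | h5
    · obtain ⟨t₂, B₂, e2, h6⟩ := ih t₁ h2 h3 h5.2.2.2.1 h4
        (hout.imp (fun h => by rw [h5.2.2.1, h]; rfl) id)
      exact ⟨t₂, _, (h1.seq_silent (e2.ifTop_true (by rw [h2, ho]))).mono
        (B' := ℓ.n + 10 + B₂) (by omega), h6.imp (fun h => h5.trans hf h) fun h =>
        (h5.trans_dead hf h).mono (by simp only [rest]; omega)⟩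
    · obtain ⟨t₂, e2, h6⟩ := watch_idle (ℓ := ℓ) p t₁ h5.1 h5.2.1
      exact ⟨t₂, _, (h1.seq_silent (e2.ifTop_true (by rw [h2, ho]))).mono
        (B' := ℓ.n + 10 + rest p) (by omega), .inr ((h5.trans (B₂ := rest p) τ h6).mono (by
        simp only [rest]; omega))⟩
  | @ifTop_false r o p q s s' τ ho _ ih =>
    intro t hs hf hc hφ hout
    rw [Trace.outputs_cons_none] at hout
    obtain ⟨t₁, h1, h2, h3, h4, h5⟩ := tick_outcome hs hf hc hφ
    rcases h5 with h5 | h5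
    · obtain ⟨t₂, B₂, e2, h6⟩ := ih t₁ h2 h3 h5.2.2.2.1 h4
        (hout.imp (fun h => by rw [h5.2.2.1, h]; rfl) id)
      exact ⟨t₂, _, (h1.seq_silent (e2.ifTop_false (by rwa [h2]))).mono
        (B' := ℓ.n + 10 + B₂) (by omega), h6.imp (fun h => h5.trans hf h) fun h =>
        (h5.trans_dead hf h).mono (by simp only [rest]; omega)⟩
    · obtain ⟨t₂, e2, h6⟩ := watch_idle (ℓ := ℓ) q t₁ h5.1 h5.2.1
      exact ⟨t₂, _, (h1.seq_silent (e2.ifTop_false (by rwa [h2]))).mono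
        (B' := ℓ.n + 10 + rest q) (by omega), .inr ((h5.trans (B₂ := rest q) τ h6).mono (by
        simp only [rest]; omega))⟩
  | @loop_done r p s hr =>
    intro t hs hf hc hφ _
    obtain ⟨t₁, h1, h2, h3, h4, h5⟩ := tick_outcome hs hf hc hφ
    have e : ERun (ℓ.setFlag r) t₁ [] 3 t₁ := by
      by_cases h : t₁ ℓ.c = []
      · exact (setFlag_idle r h).mono (by omega)
      · exact ((ERun.skip t₁).ifTop_true (by simp [h2, hr])).ifTop_false (by simpa using h)
    exact ⟨t₁, _, (h1.seq_silent (e.seq_silent (.loop_done h4))).mono (B' := ℓ.n + 10) (by omega),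
      h5.imp id fun h => h.mono (by omega)⟩
  | @loop_step r p s s₁ s₂ τ₁ τ₂ hr _ _ ih₁ ih₂ =>
    intro t hs hf hc hφ hout
    rw [Trace.outputs_cons_none, Trace.outputs_append, List.append_eq_nil_iff] at hout
    obtain ⟨t₁, h1, h2, h3, h4, h5⟩ := tick_outcome hs hf hc hφ
    rcases h5 with h5 | h5
    · have e1 : ERun (ℓ.setFlag r) t₁ [] 3 (Function.update t₁ ℓ.φ [0]) :=
        ((ERun.push ℓ.φ 0 t₁).ifTop_false (by simpa [h2] using hr)).ifTop_false
          (by simpa using h5.2.2.2.1) |>.cast (by rw [h4])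
      have e2 : ERun (.pop ℓ.φ) (Function.update t₁ ℓ.φ [0]) [] 1 t₁ :=
        (ERun.pop ℓ.φ _).cast (by simp [← h4])
      obtain ⟨t₂, B₂, e3, h6⟩ := ih₁ t₁ h2 h3 h5.2.2.2.1 h4
        (hout.imp (fun h => by rw [h5.2.2.1, h]; rfl) And.left)
      rcases h6 with h6 | h6
      · have hfb := h6.2.2.1
        obtain ⟨t₃, B₃, e4, h7⟩ := ih₂ t₂ h6.2.2.2.2.1 (hfb ▸ h3.burn _) h6.2.2.2.1
          h6.2.2.2.2.2.1 (hout.imp (fun h => by rw [hfb, h5.2.2.1, h]; rfl) And.right)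
        -- The simulation of the remaining iterations starts with the same tick and flag test that
        -- end the loop body. It is cut after them, so that they become the end of the present pass.
        obtain ⟨u₁, b₁, b₁', f1, f1', hb1⟩ := e4.seq_inv
        obtain ⟨u₂, b₂, b₃, f2, f3, hb2⟩ := f1'.seq_inv
        refine ⟨t₃, _, (h1.seq_silent (e1.seq_silent (ERun.loop_step_silent (by simp)
          (e2.seq_silent (e3.seq_silent (f1.seq_silent f2))) f3))).mono
          (B' := ℓ.n + 10 + (B₂ + B₃)) (by omega), h7.imp (fun h => ?_) fun h => ?_⟩
        · exact h5.trans hf (h6.trans h3 h)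
        · exact h5.trans_dead hf (h6.trans_dead h3 h)
      · refine ⟨t₂, _, (h1.seq_silent (e1.seq_silent (ERun.loop_step_silent (by simp)
          (e2.seq_silent (e3.seq_silent ((tick_idle h6.1).seq_silent (setFlag_idle r h6.1))))
          (.loop_done h6.2.1)))).mono (B' := ℓ.n + 10 + (B₂ + 20)) (by omega), .inr ?_⟩
        exact (h5.trans_dead hf (h6.trans (B₂ := 20) τ₂ (.refl h6.1 h6.2.1))).mono (by
          simp only [rest]; omega)
    · refine ⟨t₁, _, (h1.seq_silent ((setFlag_idle r h5.1).seq_silent (.loop_done h4))).mono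
        (B' := ℓ.n + 10) (by omega), .inr ?_⟩
      exact (h5.trans (B₂ := 0) (τ₁ ++ τ₂) (.refl h5.1 h5.2.1)).mono (by omega)

/-- Finding the first output. -/
theorem watch_first {p : Prog} {s s' : State} {L : List (List ℕ)} {B : ℕ} (h : ERun p s L B s')
    (t : State) (hs : ∀ r, t (ℓ.ρ r) = s r) (hc : t ℓ.c = [1]) (hφ : t ℓ.φ = []) :
    ∃ t', ERun (ℓ.watch p) t [] ((ℓ.n + 10) * B + rest p) t' ∧ ℓ.Frame t t' ∧ t' ℓ.φ = [] ∧
      (L = [] → t' ℓ.f = t ℓ.f) ∧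
      ∀ w L', L = w :: L' → t' ℓ.f = 0 :: t ℓ.f ∧
        ((∀ a ∈ w, a < ℓ.n) → t' ℓ.o = w.reverse ++ t ℓ.o) := by
  obtain ⟨τ, h1, rfl, h3⟩ := h
  obtain ⟨t', B', e, h⟩ := watch_run (ℓ := ℓ) h1 t hs (.inl hc) (by simp [hc]) hφ (.inl hc)
  refine ⟨t', e.mono ?_, ?_⟩
  · rcases h with ⟨a1, a2, -⟩ | ⟨-, -, -, g, τ', rfl, b2, -⟩
    · have := h3 τ.length (by rw [← Trace.eq_replicate_of_outputs a1])
      nlinarith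
    · have := h3 g (List.prefix_append _ _).isInfix
      nlinarith
  · rcases h with ⟨a1, a2, a3, a4, a5, a6, a7, a8, a9⟩ | ⟨a1, a2, a3, g, τ', rfl, -, h⟩
    · exact ⟨a9, a6, fun _ => a8, fun w L' h => by simp [a1] at h⟩
    · refine ⟨a3, a2, ?_⟩
      rcases h with ⟨c1, -⟩ | ⟨-, w, τ'', rfl, c2, c3⟩
      · rw [hc] at c1
        have : 1 ∈ List.replicate g 0 := by rw [← c1]; simp
        simp at this
      · rw [Trace.outputs_append, Trace.outputs_replicate]
        refine ⟨by simp, fun v L' h => ?_⟩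
        simp only [List.nil_append, Trace.outputs_cons_some, List.cons.injEq] at h
        rw [← h.1]
        exact ⟨c2, c3⟩

/-- Running a program without output with limited fuel. -/
theorem watch_fuel {p : Prog} {s s' : State} {T m : ℕ} (h : Run p s (List.replicate T none) s')
    (t : State) (hs : ∀ r, t (ℓ.ρ r) = s r) (hc : t ℓ.c = List.replicate m 0) (hφ : t ℓ.φ = []) :
    ∃ t', ERun (ℓ.watch p) t [] ((ℓ.n + 10) * m + rest p) t' ∧ ℓ.Frame t t' ∧ t' ℓ.φ = [] ∧
      (t' ℓ.c = [] ↔ m ≤ T) := by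
  rcases Nat.eq_zero_or_pos m with rfl | hm
  · obtain ⟨t', e, h⟩ := watch_idle (ℓ := ℓ) p t hc hφ
    exact ⟨t', e.mono (by simp), h.2.2.2.2, h.2.1, by simp [h.1]⟩
  obtain ⟨t', B', e, h⟩ := watch_run (ℓ := ℓ) h t hs (.inr ⟨m, hc⟩)
    (by rw [hc]; simpa using hm.ne') hφ (.inr (by simp))
  refine ⟨t', ?_⟩
  rcases h with ⟨a1, a2, a3, a4, a5, a6, a7, a8, a9⟩ | ⟨a1, a2, a3, g, τ', e', b2, h⟩
  · rw [hc, burn_replicate] at a3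
    simp only [List.length_replicate] at a2 a3
    have h1 : m - T ≠ 0 := by intro h; simp [a3, h] at a4
    refine ⟨e.mono ?_, a9, a6, by simp only [a4, false_iff]; omega⟩
    have : T ≤ m := by omega
    nlinarith
  · rcases h with ⟨c1, -⟩ | ⟨c1, -⟩
    · rw [hc] at c1
      have h1 := congrArg List.length c1
      have h2 := congrArg List.length e'
      simp only [List.length_replicate, List.length_append] at h1 h2
      exact ⟨e.mono (by rw [h1]; exact b2), a3, a2, by simp only [a1, true_iff]; omega⟩
    · rw [hc] at c1
      have : 1 ∈ List.replicate m 0 := by rw [c1]; simp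
      simp at this

end Layout

/-! ### Dilated traces -/

/-- The second trace arises from the first one by slowing it down by a factor `K`. -/
inductive Dil (K : ℕ) : Trace → Trace → Prop
  | nil : Dil K [] []
  | silent {τ τ' : Trace} {j : ℕ} : j ≤ K → Dil K τ τ' →
      Dil K (none :: τ) (List.replicate j none ++ τ')
  | output {τ τ' : Trace} {i j : ℕ} {w : List ℕ} : i ≤ K * (w.length + 1) →
      j ≤ K * (w.length + 1) → Dil K τ τ' →
      Dil K (some w :: τ)
        (List.replicate i none ++ some w :: (List.replicate j none ++ τ'))

theorem Dil.append {K : ℕ} {τ₁ τ₁' τ₂ τ₂' : Trace} (h₁ : Dil K τ₁ τ₁') (h₂ : Dil K τ₂ τ₂') :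
    Dil K (τ₁ ++ τ₂) (τ₁' ++ τ₂') := by
  induction h₁ with
  | nil => exact h₂
  | silent hj _ ih => rw [List.cons_append, List.append_assoc]; exact ih.silent hj
  | output hi hj _ ih =>
    rw [List.cons_append, List.append_assoc, List.cons_append, List.append_assoc]
    exact ih.output hi hj

theorem Dil.one {K j : ℕ} (hj : j ≤ K) : Dil K [none] (List.replicate j none) := by
  simpa using Dil.nil.silent hj

theorem Dil.cons {K j : ℕ} {τ τ' : Trace} (hj : j ≤ K) (h : Dil K τ τ') :
    Dil K (none :: τ) (List.replicate j none ++ τ') := h.silent hj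

theorem Dil.outputs {K : ℕ} {τ τ' : Trace} (h : Dil K τ τ') : τ'.outputs = τ.outputs := by
  induction h with
  | nil => rfl
  | silent _ _ ih => simp [Trace.outputs_append, ih]
  | output _ _ _ ih => simp [Trace.outputs_append, ih]

theorem Trace.delayLE_replicate_some {g B : ℕ} {w : List ℕ} {τ : Trace} (hg : g ≤ B)
    (h : τ.DelayLE B) : Trace.DelayLE (List.replicate g none ++ some w :: τ) B := by
  intro n hn
  have key : ∀ m, List.replicate m none <+: some w :: τ → m = 0 := by
    intro m hm
    rcases m with _ | m
    · rfl
    · simp [List.replicate_succ] at hm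
  rw [List.infix_append_iff] at hn
  rcases hn with hn | hn | ⟨l₁, l₂, e, hs, hp⟩
  · exact (Trace.delayLE_replicate g n hn).trans hg
  · rcases List.infix_cons_iff.1 hn with hn | hn
    · simp [key n hn]
    · exact h n hn
  · rw [eq_comm, List.append_eq_replicate_iff] at e
    obtain ⟨e1, e2, e3⟩ := e
    rw [e3] at hp
    have a1 := hs.length_le
    have a2 := key _ hp
    simp only [List.length_replicate] at a1
    omega

theorem Trace.delayLE_of_cons {x : Option (List ℕ)} {g B : ℕ} {τ : Trace}
    (h : Trace.DelayLE (List.replicate g none ++ x :: τ) B) : τ.DelayLE B := fun n hn =>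
  h n (hn.trans (List.IsSuffix.isInfix ⟨List.replicate g none ++ [x], by simp⟩))

theorem Dil.delayLE {K B : ℕ} {τ τ' : Trace} (h : Dil K τ τ') (hτ : τ.DelayLE B)
    (hw : ∀ w ∈ τ.outputs, w.length ≤ B) : τ'.DelayLE (K * (3 * B + 2)) := by
  -- Here g and g' are the lengths of the current gap in the two traces, and K(B+1) accounts for the
  -- delay caused by the preceding output. A gap of at most B steps becomes at most K(B+1) + KB +
  -- K(B+1) = K(3B+2): after one output, in between, and before the next output.
  suffices H : ∀ g g', Trace.DelayLE (List.replicate g none ++ τ) B → g' ≤ K * g + K * (B + 1) →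
      Trace.DelayLE (List.replicate g' none ++ τ') (K * (3 * B + 2)) from
    H 0 0 (by simpa using hτ) (by simp)
  clear hτ
  induction h with
  | nil =>
    intro g g' h1 h2
    have : g ≤ B := h1 g (List.prefix_append _ _).isInfix
    rw [List.append_nil]
    refine (Trace.delayLE_replicate g').mono ?_
    nlinarith
  | silent hj _ ih =>
    intro g g' h1 h2
    rw [← List.append_assoc, List.replicate_append_replicate]
    refine ih (by simpa using hw) (g + 1) _ ?_ (by rw [mul_add]; omega)
    rw [List.replicate_succ', List.append_assoc]
    exact h1
  | @output τ τ' i j w hi hj _ ih =>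
    intro g g' h1 h2
    have : g ≤ B := h1 g (List.prefix_append _ _).isInfix
    have hB : w.length ≤ B := hw w (by simp)
    have hK : K * (w.length + 1) ≤ K * (B + 1) := Nat.mul_le_mul_left K (by omega)
    rw [← List.append_assoc, List.replicate_append_replicate]
    refine Trace.delayLE_replicate_some ?_ ?_
    · nlinarith
    · exact ih (fun v hv => hw v (by simp [hv])) 0 j (by
        simpa using Trace.delayLE_of_cons h1) (by omega)

/-- Writing w takes |w| silent steps, so words that are output are no longer than the delay. Hence a
slowdown linear in the length of an output is affordable. -/
theorem Run.replicate_infix {p : Prog} {s s' : State} {τ : Trace} (h : Run p s τ s') :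
    ∀ w ∈ τ.outputs, List.replicate w.length none <:+: τ := by
  induction h with
  | emit r s =>
    intro w hw
    simp only [Trace.outputs_append, Trace.outputs_replicate, Trace.outputs_cons_some,
      Trace.outputs_nil, List.nil_append, List.mem_singleton] at hw
    subst hw
    exact (List.prefix_append _ _).isInfix
  | seq _ _ ih₁ ih₂ =>
    intro w hw
    rw [Trace.outputs_append, List.mem_append] at hw
    rcases hw with hw | hw
    · exact (ih₁ w hw).trans (List.prefix_append _ _).isInfix
    · exact (ih₂ w hw).trans (List.suffix_append _ _).isInfix
  | ifTop_true _ _ ih =>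
    intro w hw
    exact (ih w (by simpa using hw)).trans (List.suffix_cons _ _).isInfix
  | ifTop_false _ _ ih =>
    intro w hw
    exact (ih w (by simpa using hw)).trans (List.suffix_cons _ _).isInfix
  | loop_step _ _ _ ih₁ ih₂ =>
    intro w hw
    rw [Trace.outputs_cons_none, Trace.outputs_append, List.mem_append] at hw
    refine List.IsInfix.trans ?_ (List.suffix_cons _ _).isInfix
    rcases hw with hw | hw
    · exact (ih₁ w hw).trans (List.prefix_append _ _).isInfix
    · exact (ih₂ w hw).trans (List.suffix_append _ _).isInfix
  | _ => intro w hw; simp at hw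

/-! ### Running a program on top of garbage -/

/-- All symbols that occur in the program are less than `M`. -/
def Prog.SymLT (M : ℕ) : Prog → Prop
  | .push _ a => a < M
  | .seq p q => p.SymLT M ∧ q.SymLT M
  | .ifTop _ o p q => (∀ a, o = some a → a < M) ∧ p.SymLT M ∧ q.SymLT M
  | .loop _ p => p.SymLT M
  | _ => True

theorem Prog.SymLT.mono {N N' : ℕ} (hN : N ≤ N') : ∀ {p : Prog}, p.SymLT N → p.SymLT N'
  | .skip, _ => trivial
  | .push _ _, h => lt_of_lt_of_le (b := N) h hN
  | .pop _, _ => trivial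
  | .emit _, _ => trivial
  | .seq _ _, h => ⟨h.1.mono hN, h.2.mono hN⟩
  | .ifTop _ _ _ _, h => ⟨fun a ha => (h.1 a ha).trans_le hN, h.2.1.mono hN, h.2.2.mono hN⟩
  | .loop _ p, h => Prog.SymLT.mono (p := p) hN h

theorem Prog.exists_symLT : ∀ p : Prog, ∃ N, p.SymLT N
  | .skip => ⟨0, trivial⟩
  | .push _ a => ⟨a + 1, Nat.lt_succ_self a⟩
  | .pop _ => ⟨0, trivial⟩
  | .emit _ => ⟨0, trivial⟩
  | .seq p q => by
    obtain ⟨a, ha⟩ := p.exists_symLT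
    obtain ⟨b, hb⟩ := q.exists_symLT
    exact ⟨max a b, ha.mono (by omega), hb.mono (by omega)⟩
  | .ifTop r o p q => by
    obtain ⟨a, ha⟩ := p.exists_symLT
    obtain ⟨b, hb⟩ := q.exists_symLT
    refine ⟨max (max a b) (o.getD 0 + 1), fun x hx => ?_, ha.mono (by omega), hb.mono (by omega)⟩
    rw [hx, Option.getD_some]
    omega
  | .loop _ p => p.exists_symLT

/-- Registers for the version of a program that works on top of garbage: `ρ r` plays the role of
register `r`; the bottom of its content is marked by the symbol `M`. The registers `u` and `e` are
used for the output, and `φ` is the flag that controls the loops. -/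
structure Ground where
  /-- registers of the program -/
  ρ : ℕ → ℕ
  /-- auxiliary register -/
  u : ℕ
  /-- output register -/
  e : ℕ
  /-- loop flag -/
  φ : ℕ
  /-- marker -/
  M : ℕ
  inj : Function.Injective ρ
  ρu : ∀ r, ρ r ≠ u
  ρe : ∀ r, ρ r ≠ e
  ρφ : ∀ r, ρ r ≠ φ
  ue : u ≠ e
  uφ : u ≠ φ
  eφ : e ≠ φ

namespace Ground

variable (ℓ : Ground)

/-- Raise the flag if register `r` is nonempty. -/
def setFlag (r : ℕ) : Prog := .ifTop (ℓ.ρ r) (some ℓ.M) .skip (.push ℓ.φ 0)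

/-- Repeat `p` as long as register `r` is nonempty. -/
def iter (r : ℕ) (p : Prog) : Prog :=
  .seq (ℓ.setFlag r) (.loop ℓ.φ (.seq (.pop ℓ.φ) (.seq p (ℓ.setFlag r))))

/-- The version of a program that works on top of garbage. -/
def lift : Prog → Prog
  | .skip => .skip
  | .push r a => .push (ℓ.ρ r) a
  | .pop r => .ifTop (ℓ.ρ r) (some ℓ.M) .skip (.pop (ℓ.ρ r))
  | .emit r => .seq (ℓ.iter r (mvTop (ℓ.ρ r) ℓ.u ℓ.M)) (.seq (dup ℓ.M ℓ.u (ℓ.ρ r) ℓ.e)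
      (.seq (.emit ℓ.e) (clear ℓ.e)))
  | .seq p q => .seq (lift p) (lift q)
  | .ifTop r o p q => .ifTop (ℓ.ρ r) (some (o.getD ℓ.M)) (lift p) (lift q)
  | .loop r p => ℓ.iter r (lift p)

/-- The slowdown. -/
def slow : ℕ := 2 * ℓ.M + 20

/-- The state `t` represents the state `s` on top of the garbage `G`, for registers less than
`N`. -/
structure Rep (N : ℕ) (G : ℕ → List ℕ) (s t : State) : Prop where
  eq : ∀ r < N, t (ℓ.ρ r) = s r ++ ℓ.M :: G r
  lt : ∀ r, ∀ a ∈ s r, a < ℓ.M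
  u : t ℓ.u = []
  e : t ℓ.e = []
  φ : t ℓ.φ = []

/-- The two states agree outside of the registers in use. -/
def Frame (t t' : State) : Prop :=
  ∀ q, (∀ r, q ≠ ℓ.ρ r) → q ≠ ℓ.u → q ≠ ℓ.e → q ≠ ℓ.φ → t' q = t q

variable {ℓ}

theorem Frame.trans {t t₁ t₂ : State} (h : ℓ.Frame t t₁) (h' : ℓ.Frame t₁ t₂) : ℓ.Frame t t₂ :=
  fun q h1 h2 h3 h4 => (h' q h1 h2 h3 h4).trans (h q h1 h2 h3 h4)

theorem Rep.head {N : ℕ} {G : ℕ → List ℕ} {s t : State} (h : ℓ.Rep N G s t) {r : ℕ} (hr : r < N)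
    (o : Option ℕ) (ho : ∀ a, o = some a → a ≠ ℓ.M) :
    (t (ℓ.ρ r)).head? = some (o.getD ℓ.M) ↔ (s r).head? = o := by
  rw [h.eq r hr]
  cases hs : s r with
  | nil =>
    cases o with
    | none => simp
    | some a => simp [(ho a rfl).symm]
  | cons x l =>
    have hx := h.lt r x (by simp [hs])
    cases o with
    | none => simp [hx.ne]
    | some a => simp

theorem Rep.head_marker {N : ℕ} {G : ℕ → List ℕ} {s t : State} (h : ℓ.Rep N G s t) {r : ℕ}
    (hr : r < N) : (t (ℓ.ρ r)).head? = some ℓ.M ↔ s r = [] := by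
  have := h.head hr none (by simp)
  simpa using this

theorem Rep.update {N : ℕ} {G : ℕ → List ℕ} {s t : State} (h : ℓ.Rep N G s t) (r : ℕ)
    (l : List ℕ) (hl : ∀ a ∈ l, a < ℓ.M) : ℓ.Rep N G (Function.update s r l)
      (Function.update t (ℓ.ρ r) (l ++ ℓ.M :: G r)) where
  eq q hq := by
    by_cases e : q = r
    · subst e; simp
    · simp [e, ℓ.inj.eq_iff, h.eq q hq]
  lt q a ha := by
    by_cases e : q = r
    · subst e; exact hl a (by simpa using ha)
    · exact h.lt q a (by simpa [e] using ha)
  u := by simp [(ℓ.ρu r).symm, h.u]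
  e := by simp [(ℓ.ρe r).symm, h.e]
  φ := by simp [(ℓ.ρφ r).symm, h.φ]

theorem frame_update (t : State) (r : ℕ) (l : List ℕ) :
    ℓ.Frame t (Function.update t (ℓ.ρ r) l) := fun q h _ _ _ => by simp [h r]

theorem iter_done {N : ℕ} {G : ℕ → List ℕ} {s t : State} (h : ℓ.Rep N G s t) {r : ℕ}
    (hr : r < N) (hs : s r = []) (p : Prog) :
    Run (ℓ.iter r p) t (List.replicate 3 none) t :=
  .seq (.ifTop_true ((h.head_marker hr).2 hs) (.skip t)) (.loop_done h.φ)

/-- The flag test that opens the remaining iteration closes the present pass, so the given run is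
split after it. The four extra steps are the flag test (two), the loop test and the removal of the
flag. -/
theorem iter_step {N : ℕ} {G : ℕ → List ℕ} {s t t₁ t₂ : State} (h : ℓ.Rep N G s t) {r : ℕ}
    (hr : r < N) (hs : s r ≠ []) {p : Prog} {τ₁ τ₂ : Trace} (h₁ : Run p t τ₁ t₁)
    (h₂ : Run (ℓ.iter r p) t₁ τ₂ t₂) :
    Run (ℓ.iter r p) t (List.replicate 4 none ++ (τ₁ ++ τ₂)) t₂ := by
  rw [Ground.iter] at h₂
  cases h₂ with
  | @seq _ _ _ a _ σ₁ σ₂ g1 g2 =>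
    have e1 : Run (ℓ.setFlag r) t [none, none] (Function.update t ℓ.φ [0]) := by
      have := Run.push ℓ.φ 0 t
      rw [h.φ] at this
      exact .ifTop_false (mt (h.head_marker hr).1 hs) this
    have e2 : Run (.pop ℓ.φ) (Function.update t ℓ.φ [0]) [none] t := by
      have := Run.pop ℓ.φ (Function.update t ℓ.φ [0])
      have e : Function.update t ℓ.φ [] = t := by rw [← h.φ, Function.update_eq_self]
      simpa [e] using this
    have := Run.seq e1 (.loop_step (by simp) (.seq e2 (.seq h₁ g1)) g2)
    simpa [Ground.iter, List.replicate_succ] using this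

theorem emit_run {N : ℕ} {G : ℕ → List ℕ} {s t : State} (h : ℓ.Rep N G s t) {r : ℕ}
    (hr : r < N) : ∃ i j, i ≤ ℓ.slow * ((s r).length + 1) ∧ j ≤ ℓ.slow * ((s r).length + 1) ∧
      Run (ℓ.lift (.emit r)) t
        (List.replicate i none ++ some (s r) :: (List.replicate j none ++ [])) t := by
  -- `Rep` requires u to be empty, which fails while the word is being moved; so the invariant is
  -- spelled out without this condition.
  have key : ∀ (l : List ℕ) (s t : State), s r = l → (∀ r < N, t (ℓ.ρ r) = s r ++ ℓ.M :: G r) →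
      (∀ r, ∀ a ∈ s r, a < ℓ.M) → t ℓ.φ = [] → t ℓ.e = [] →
      ERun (ℓ.iter r (mvTop (ℓ.ρ r) ℓ.u ℓ.M)) t [] ((ℓ.M + 6) * l.length + 3)
        (Function.update (Function.update t (ℓ.ρ r) (ℓ.M :: G r)) ℓ.u (l.reverse ++ t ℓ.u)) := by
    intro l
    induction l with
    | nil =>
      intro s t hs h1 h2 h3 h4
      have e : t (ℓ.ρ r) = ℓ.M :: G r := by simp [h1 r hr, hs]
      have e1 : ERun (ℓ.setFlag r) t [] 2 t := (ERun.skip t).ifTop_true (by simp [e])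
      refine (e1.seq_silent (.loop_done h3)).mono (by simp) |>.cast ?_
      rw [← e, Function.update_eq_self]
      simp
    | cons x l ih =>
      intro s t hs h1 h2 h3 h4
      have hx : x < ℓ.M := h2 r x (by simp [hs])
      have e : t (ℓ.ρ r) = x :: (l ++ ℓ.M :: G r) := by simp [h1 r hr, hs]
      have e1 : ERun (ℓ.setFlag r) t [] 2 (Function.update t ℓ.φ [0]) :=
        (ERun.push ℓ.φ 0 t).ifTop_false (by simp [e, hx.ne]) |>.cast (by rw [h3])
      have e2 : ERun (.pop ℓ.φ) (Function.update t ℓ.φ [0]) [] 1 t :=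
        (ERun.pop ℓ.φ _).cast (by simp [← h3])
      have e3 := mvTop_run (ℓ.ρu r) e ℓ.M hx
      have e4 := ih (Function.update s r l) (Function.update (Function.update t (ℓ.ρ r)
        (l ++ ℓ.M :: G r)) ℓ.u (x :: t ℓ.u)) (by simp) (fun q hq => by
          by_cases e : q = r
          · subst e; simp [ℓ.ρu]
          · simp [e, ℓ.ρu, ℓ.inj.eq_iff, h1 q hq]) (fun q a ha => by
          by_cases e : q = r
          · subst e; exact h2 q a (by rw [hs]; simp_all)
          · exact h2 q a (by simpa [e] using ha)) (by simp [ℓ.uφ.symm, (ℓ.ρφ r).symm, h3])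
          (by simp [ℓ.ue.symm, (ℓ.ρe r).symm, h4])
      obtain ⟨a, b₁, b₂, f1, f2, hb⟩ := e4.seq_inv
      refine (e1.seq_silent (ERun.loop_step_silent (by simp)
        (e2.seq_silent (e3.seq_silent f1)) f2)).mono ?_ |>.cast ?_
      · simp only [List.length_cons]
        rw [mul_add]
        omega
      · funext q
        simp only [Function.update_apply]
        split_ifs <;> simp_all
  have e1 := key (s r) s t rfl h.eq h.lt h.φ h.e
  have e2 := dup_run (t := ℓ.u) (a := ℓ.ρ r) (b := ℓ.e) (ℓ.ρu r).symm ℓ.ue (ℓ.ρe r) ℓ.M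
    (s r).reverse (Function.update (Function.update t (ℓ.ρ r) (ℓ.M :: G r)) ℓ.u
      ((s r).reverse ++ t ℓ.u)) (by simp [h.u]) (by simpa using h.lt r)
  have e12 : Function.update (Function.update (Function.update
      (Function.update (Function.update t (ℓ.ρ r) (ℓ.M :: G r)) ℓ.u ((s r).reverse ++ t ℓ.u))
      ℓ.u []) (ℓ.ρ r) ((s r).reverse.reverse ++ (Function.update (Function.update t (ℓ.ρ r)
      (ℓ.M :: G r)) ℓ.u ((s r).reverse ++ t ℓ.u)) (ℓ.ρ r))) ℓ.e
      ((s r).reverse.reverse ++ (Function.update (Function.update t (ℓ.ρ r)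
      (ℓ.M :: G r)) ℓ.u ((s r).reverse ++ t ℓ.u)) ℓ.e) = Function.update t ℓ.e (s r) := by
    have h1 := h.eq r hr
    have h2 := h.u
    have h3 := h.e
    funext q
    simp only [Function.update_apply, ℓ.ρu r, ℓ.ue.symm, (ℓ.ρe r).symm, if_true, if_false,
      List.reverse_reverse]
    split_ifs <;> simp_all
  rw [e12] at e2
  have e3 := Run.emit ℓ.e (Function.update t ℓ.e (s r))
  rw [Function.update_self] at e3
  have e4 := (clear_run (a := ℓ.e) (s r) (Function.update t ℓ.e (s r)) (by simp)).cast
    (s₂ := t) (by simp [← h.e])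
  obtain ⟨i₁, hi₁, f1⟩ := e1.silent
  obtain ⟨i₂, hi₂, f2⟩ := e2.silent
  obtain ⟨j, hj, f4⟩ := e4.silent
  refine ⟨i₁ + i₂ + (s r).length, j, ?_, ?_, ?_⟩
  · rw [List.length_reverse] at hi₂
    have : i₁ + i₂ + (s r).length ≤ (ℓ.M + 6) * (s r).length + 3 +
      ((ℓ.M + 4) * (s r).length + 1) + (s r).length := by omega
    refine this.trans ?_
    rw [slow]
    ring_nf
    omega
  · refine hj.trans ?_
    rw [slow]
    ring_nf
    omega
  · have := Run.seq f1 (.seq f2 (.seq e3 f4))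
    simpa [lift, ← List.replicate_append_replicate] using this

/-- Induction on the run. The marker on top plays the role of emptiness, and it cannot be confused
with a symbol of the program. Every instruction is slowed down by a constant factor except `emit`,
whose linear cost `Dil` charges to the output itself. -/
theorem lift_trace {p : Prog} {s s' : State} {τ : Trace} (h : Run p s τ s') {N : ℕ}
    {G : ℕ → List ℕ} : p.RegsLT N → p.SymLT ℓ.M → ∀ t, ℓ.Rep N G s t →
    ∃ τ' t', Run (ℓ.lift p) t τ' t' ∧ ℓ.Rep N G s' t' ∧ ℓ.Frame t t' ∧ Dil ℓ.slow τ τ' := by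
  have hK : 20 ≤ ℓ.slow := by rw [slow]; omega
  induction h with
  | skip s =>
    intro _ _ t ht
    exact ⟨_, t, .skip t, ht, fun _ _ _ _ _ => rfl, .one (j := 1) (by omega)⟩
  | push r a s =>
    intro hr ha t ht
    refine ⟨_, _, .push _ a t, ?_, frame_update _ _ _, .one (j := 1) (by omega)⟩
    rw [ht.eq r hr]
    refine ht.update r (a :: s r) fun b hb => ?_
    rcases List.mem_cons.1 hb with rfl | hb
    · exact ha
    · exact ht.lt r b hb
  | pop r s =>
    intro hr _ t ht
    by_cases hs : s r = []
    · refine ⟨_, t, .ifTop_true ((ht.head_marker hr).2 hs) (.skip t), ?_, fun _ _ _ _ _ => rfl,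
        .one (j := 2) (by omega)⟩
      have : Function.update s r (s r).tail = s := by simp [hs]
      rwa [this]
    · refine ⟨_, _, .ifTop_false (mt (ht.head_marker hr).1 hs) (.pop _ t), ?_,
        frame_update _ _ _, .one (j := 2) (by omega)⟩
      rw [ht.eq r hr, List.tail_append_of_ne_nil hs]
      exact ht.update r (s r).tail fun b hb => ht.lt r b (List.mem_of_mem_tail hb)
  | emit r s =>
    intro hr _ t ht
    obtain ⟨i, j, hi, hj, h⟩ := emit_run ht hr
    refine ⟨_, t, h, ht, fun _ _ _ _ _ => rfl, ?_⟩
    -- The silent steps of the original output are matched with nothing, and the whole simulation is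
    -- attributed to the output step.
    have e : Dil ℓ.slow (List.replicate (s r).length none) [] := by
      generalize (s r).length = n
      induction n with
      | zero => exact .nil
      | succ n ih => exact ih.silent (j := 0) (by omega)
    exact e.append (Dil.nil.output hi hj)
  | seq _ _ ih₁ ih₂ =>
    intro hp hq t ht
    obtain ⟨σ₁, t₁, f1, f2, f3, f4⟩ := ih₁ hp.1 hq.1 t ht
    obtain ⟨σ₂, t₂, g1, g2, g3, g4⟩ := ih₂ hp.2 hq.2 t₁ f2
    exact ⟨_, t₂, .seq f1 g1, g2, f3.trans g3, f4.append g4⟩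
  | @ifTop_true r o p q s s' τ ho _ ih =>
    intro hp hq t ht
    obtain ⟨σ₁, t₁, f1, f2, f3, f4⟩ := ih hp.2.1 hq.2.1 t ht
    exact ⟨_, t₁, .ifTop_true ((ht.head hp.1 o fun a ha => (hq.1 a ha).ne).2 ho) f1, f2, f3,
      f4.cons (j := 1) (by omega)⟩
  | @ifTop_false r o p q s s' τ ho _ ih =>
    intro hp hq t ht
    obtain ⟨σ₁, t₁, f1, f2, f3, f4⟩ := ih hp.2.2 hq.2.2 t ht
    exact ⟨_, t₁, .ifTop_false (mt (ht.head hp.1 o fun a ha => (hq.1 a ha).ne).1 ho) f1,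
      f2, f3, f4.cons (j := 1) (by omega)⟩
  | @loop_done r p s hr =>
    intro hp _ t ht
    exact ⟨_, t, iter_done ht hp.1 hr _, ht, fun _ _ _ _ _ => rfl, .one (by omega)⟩
  | @loop_step r p s s₁ s₂ τ₁ τ₂ hr _ _ ih₁ ih₂ =>
    intro hp hq t ht
    obtain ⟨σ₁, t₁, f1, f2, f3, f4⟩ := ih₁ hp.2 hq t ht
    obtain ⟨σ₂, t₂, g1, g2, g3, g4⟩ := ih₂ hp hq t₁ f2
    exact ⟨_, t₂, iter_step ht hp.1 hr f1 g1, g2, f3.trans g3,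
      (f4.append g4).cons (by omega)⟩

/-- The version of a program on top of garbage has the same outputs and a slightly larger
delay. -/
theorem lift_run {p : Prog} {s s' : State} {L : List (List ℕ)} {B : ℕ} (h : ERun p s L B s')
    {N : ℕ} {G : ℕ → List ℕ} (hN : p.RegsLT N) (hM : p.SymLT ℓ.M) (t : State)
    (ht : ℓ.Rep N G s t) : ∃ t', ERun (ℓ.lift p) t L (ℓ.slow * (3 * B + 2)) t' ∧ t' ℓ.u = [] ∧
      t' ℓ.e = [] ∧ t' ℓ.φ = [] ∧ ℓ.Frame t t' := by
  obtain ⟨τ, h1, rfl, h3⟩ := h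
  obtain ⟨τ', t', g1, g2, g3, g4⟩ := lift_trace h1 hN hM t ht
  exact ⟨t', ⟨τ', g1, g4.outputs, g4.delayLE h3 fun w hw => h3 _ (h1.replicate_infix w hw)⟩,
    g2.u, g2.e, g2.φ, g3⟩

end Ground

/-! ### Auxiliary facts -/

theorem polynomial_eval_mono (q : Polynomial ℕ) {a b : ℕ} (h : a ≤ b) : q.eval a ≤ q.eval b := by
  simp only [Polynomial.eval_eq_sum_range]
  gcongr

theorem exists_polynomial_bound (q : Polynomial ℕ) : ∃ K e : ℕ,
    ∀ n, q.eval n ≤ K * (n + 1) ^ e := by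
  refine ⟨∑ i ∈ Finset.range (q.natDegree + 1), q.coeff i, q.natDegree, fun n => ?_⟩
  rw [Polynomial.eval_eq_sum_range, Finset.sum_mul]
  refine Finset.sum_le_sum fun i hi => Nat.mul_le_mul_left _ ?_
  calc n ^ i ≤ (n + 1) ^ i := Nat.pow_le_pow_left (by omega) i
    _ ≤ (n + 1) ^ q.natDegree :=
      Nat.pow_le_pow_right (by omega) (by have := Finset.mem_range.1 hi; omega)

theorem initState_of_length_le {L : List (List ℕ)} {q : ℕ} (h : L.length ≤ q) :
    initState L q = [] := by
  simp [initState, List.getElem?_eq_none h]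

theorem enc_injective {s : ℕ} : Function.Injective (enc (s := s)) :=
  List.map_injective_iff.2 Fin.val_injective

theorem lt_of_mem_enc {s : ℕ} {w : Word s} {a : ℕ} (ha : a ∈ enc w) : a < s := by
  obtain ⟨b, -, rfl⟩ := List.mem_map.1 ha
  exact b.2

@[simp] theorem length_enc {s : ℕ} (w : Word s) : (enc w).length = w.length := List.length_map _

@[simp] theorem length_unary (k : ℕ) : (unary k).length = k := List.length_replicate

theorem eq_zero_of_mem_unary {k a : ℕ} (ha : a ∈ unary k) : a < 1 := by
  rw [(List.mem_replicate.1 ha).2]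
  exact Nat.one_pos

theorem Run.length_le {p : Prog} {s s' : State} {τ : Trace} (h : Run p s τ s') (r : ℕ) :
    (s' r).length ≤ (s r).length + τ.length := by
  induction h with
  | push q a s => by_cases h : r = q <;> simp [h]
  | pop q s => by_cases h : r = q <;> simp [h]; omega
  | seq _ _ ih₁ ih₂ => simp only [List.length_append]; omega
  | ifTop_true _ _ ih => simp only [List.length_cons]; omega
  | ifTop_false _ _ ih => simp only [List.length_cons]; omega
  | loop_step _ _ _ ih₁ ih₂ => simp only [List.length_cons, List.length_append]; omega
  | _ => omega

/-- A single output separates two gaps of length at most B, and the output step adds one. -/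
theorem ERun.computesInTime {s : ℕ} {p : Prog} {inputs : List (List ℕ)} {y : Word s} {B T : ℕ}
    {s' : State} (h : ERun p (initState inputs) [enc y] B s') (hT : 2 * B + 1 ≤ T) :
    ComputesInTime p inputs y T := by
  obtain ⟨τ, h1, h2, h3⟩ := h
  refine ⟨τ, s', h1, h2, (Trace.length_le_of_delayLE h3).trans ?_⟩
  simpa [h2] using hT

/-- Empty `a` and put its length in unary on top of `b`. -/
def toUnary (a b : ℕ) : Prog := .loop a (.seq (.pop a) (.push b 0))

theorem toUnary_run {a b : ℕ} (hab : a ≠ b) (l : List ℕ) (s : State) (hs : s a = l) :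
    ERun (toUnary a b) s [] (3 * l.length + 1)
      (Function.update (Function.update s a []) b (unary l.length ++ s b)) := by
  induction l generalizing s with
  | nil =>
    refine (ERun.loop_done hs).mono (by simp) |>.cast ?_
    funext q
    simp only [Function.update_apply]
    split_ifs <;> simp_all [unary]
  | cons x l ih =>
    refine ERun.loop_step_silent (by simp [hs]) ((ERun.pop a s).seq_silent (.push b 0 _))
      (ih _ (by simp [hab, hs])) |>.mono (by simp; omega) |>.cast ?_
    funext q
    simp only [Function.update_apply]
    split_ifs <;> simp_all [unary, List.replicate_succ']

/-- Layouts on disjoint sets of registers. -/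
def stdLayout (n j k : ℕ) (hj : j < 7) : Layout where
  ρ r := 8 * r + j
  c := 32 * k + 7
  o := 32 * k + 15
  f := 32 * k + 23
  φ := 32 * k + 31
  n := n
  inj a b h := by simp only at h; omega
  ρc r := by omega
  ρo r := by omega
  ρf r := by omega
  ρφ r := by omega
  co := by omega
  cf := by omega
  cφ := by omega
  fo := by omega
  oφ := by omega
  fφ := by omega

/-! ### From enumeration algorithms to kernels -/

/-- Run `A` on the inputs in the registers `0` and `1` until the first output; then output `w₁`
or, if there is no output, `w₀`. -/
def probe (s : ℕ) (A : Prog) (w₀ w₁ : List ℕ) : Prog :=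
  .seq (cp s 0 3 4) (.seq (cp 1 1 11 4) (.seq (.push 39 1)
    (.seq ((stdLayout s 3 1 (by omega)).watch A) (.ifTop 55 none
      (.seq (put 5 w₀) (.emit 5)) (.seq (put 5 w₁) (.emit 5))))))

/-- The first output costs one delay of `A`, not its total time. The simulation has its own control
registers 39, 47, 55, 63, since a previous simulation may have left something in 7, 15, 23, 31; so
`h7` starts at r = 4. Register 55 tells whether there was an output. -/
theorem probe_run {s k : ℕ} {x : Word s} {A : Prog} {L : List (List ℕ)} {B : ℕ} {s' : State}
    (hA : ERun A (initState [enc x, unary k]) L B s') (w₀ w₁ : List ℕ) (t : State)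
    (h0 : t 0 = enc x) (h1 : t 1 = unary k) (h4 : t 4 = []) (h5 : t 5 = [])
    (h3 : ∀ r, t (8 * r + 3) = []) (h7 : ∀ r, 4 ≤ r → t (8 * r + 7) = []) :
    ∃ t', ERun (probe s A w₀ w₁) t [if L = [] then w₀ else w₁]
      ((2 * s + 7) * x.length + 9 * k + (s + 10) * B + Layout.rest A + 2 * w₀.length +
        2 * w₁.length + 10) t' := by
  have e1 := cp_run (a := 0) (b := 3) (t := 4) (by omega) (by omega) (by omega) s t h4
    (fun a ha => lt_of_mem_enc (h0 ▸ ha))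
  rw [h0, length_enc, show t 3 = [] from h3 0, List.append_nil] at e1
  have e2 := cp_run (a := 1) (b := 11) (t := 4) (by omega) (by omega) (by omega) 1
    (Function.update t 3 (enc x)) (by simp [h4]) (fun a ha =>
      eq_zero_of_mem_unary (k := k) (by simpa [h1] using ha))
  have e11 : t 11 = [] := h3 1
  simp only [ne_eq, OfNat.one_ne_ofNat, not_false_eq_true, Function.update_of_ne, h1, e11,
    length_unary, Nat.reduceEqDiff, List.append_nil] at e2
  have e3 := ERun.push 39 1 (Function.update (Function.update t 3 (enc x)) 11 (unary k))
  have e39 : t 39 = [] := h7 4 (by omega)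
  simp only [ne_eq, Nat.reduceEqDiff, not_false_eq_true, Function.update_of_ne, e39] at e3
  set t₃ := Function.update (Function.update (Function.update t 3 (enc x)) 11 (unary k)) 39 [1]
    with ht₃
  obtain ⟨t₄, e4, f1, f2, f3, f4⟩ := Layout.watch_first (ℓ := stdLayout s 3 1 (by omega)) hA t₃
    (fun r => by
      show t₃ (8 * r + 3) = _
      rcases r with _ | _ | r
      · simp [ht₃, initState]
      · simp [ht₃, initState]
      · rw [initState_of_length_le (by simp), ht₃]
        simp only [Function.update_apply]
        rw [if_neg (by omega), if_neg (by omega), if_neg (by omega), h3])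
    (by show t₃ 39 = _; simp [ht₃])
    (by
      show t₃ 63 = _
      have := h7 7 (by omega)
      simp [ht₃, this])
  have f55 : t₃ 55 = [] := by
    have := h7 6 (by omega)
    simp [ht₃, this]
  have f5 : t₄ 5 = [] := by
    rw [f1 5 (fun r => by simp [stdLayout]; omega) (by simp [stdLayout]) (by simp [stdLayout])
      (by simp [stdLayout]) (by simp [stdLayout])]
    simp [ht₃, h5]
  have em (w : List ℕ) : ERun (.seq (put 5 w) (.emit 5)) t₄ [w] (2 * w.length + 1)
      (Function.update t₄ 5 w) := by
    have a1 := put_run 5 w t₄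
    rw [f5, List.append_nil] at a1
    have a2 := ERun.emit 5 (Function.update t₄ 5 w)
    rw [Function.update_self] at a2
    exact (a1.seq_silent a2).mono (by omega)
  have hfin : ∃ t', ERun (.ifTop 55 none (.seq (put 5 w₀) (.emit 5)) (.seq (put 5 w₁) (.emit 5)))
      t₄ [if L = [] then w₀ else w₁] (2 * w₀.length + 2 * w₁.length + 2) t' := by
    rcases L with _ | ⟨w, L⟩
    · rw [if_pos rfl]
      have : t₄ 55 = [] := (f3 rfl).trans f55
      exact ⟨_, ((em w₀).ifTop_true (by simp [this])).mono (by omega)⟩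
    · rw [if_neg (by simp)]
      have : t₄ 55 = 0 :: t₃ 55 := (f4 w L rfl).1
      exact ⟨_, ((em w₁).ifTop_false (by simp [this])).mono (by omega)⟩
  obtain ⟨t', e5⟩ := hfin
  refine ⟨t', (e1.seq_silent (e2.seq_silent (e3.seq_silent (e4.seq_silent e5)))).mono ?_⟩
  simp only [stdLayout]
  omega

/-- Run `d` on the number in register `1`, with the length of the word in register `0` as fuel.
If the fuel does not suffice, output the word, else `probe`. -/
def compress (s : ℕ) (d A : Prog) (w₀ w₁ : List ℕ) : Prog :=
  .seq (cp s 0 6 4) (.seq (toUnary 6 7) (.seq (cp 1 1 2 4)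
    (.seq ((stdLayout s 2 0 (by omega)).watch d) (.ifTop 7 none (.emit 0) (probe s A w₀ w₁)))))

/-- The delay B of `A` enters only if |x| > T, as otherwise `A` is not started. This matters because
B is under control only in that case. -/
theorem compress_run {s k T : ℕ} {x : Word s} {d A : Prog} {L : List (List ℕ)} {B : ℕ}
    {s' s'' : State} (hd : Run d (initState [unary k]) (List.replicate T none) s'')
    (hA : ERun A (initState [enc x, unary k]) L B s') (w₀ w₁ : List ℕ) :
    ∃ t', ERun (compress s d A w₀ w₁) (initState [enc x, unary k])
      [if x.length ≤ T then enc x else if L = [] then w₀ else w₁]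
      ((5 * s + 30) * x.length + 18 * k + (if x.length ≤ T then 0 else (s + 10) * B) +
        Layout.rest d + Layout.rest A + 2 * w₀.length + 2 * w₁.length + 20) t' := by
  set t := initState [enc x, unary k] with ht
  have hq : ∀ q, 2 ≤ q → t q = [] := fun q hq => initState_of_length_le (by simpa using hq)
  have h0 : t 0 = enc x := rfl
  have h1 : t 1 = unary k := rfl
  have e1 := cp_run (a := 0) (b := 6) (t := 4) (by omega) (by omega) (by omega) s t
    (hq 4 (by omega)) (fun a ha => lt_of_mem_enc (h0 ▸ ha))
  rw [h0, length_enc, hq 6 (by omega), List.append_nil] at e1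
  have e2 := toUnary_run (a := 6) (b := 7) (by omega) (enc x) (Function.update t 6 (enc x))
    (by simp)
  have e3 := cp_run (a := 1) (b := 2) (t := 4) (by omega) (by omega) (by omega) 1
    (Function.update t 7 (unary x.length)) (by simp [hq]) (fun a ha =>
      eq_zero_of_mem_unary (k := k) (by simpa [h1] using ha))
  have e2' : Function.update (Function.update (Function.update t 6 (enc x)) 6 []) 7
      (unary (enc x).length ++ Function.update t 6 (enc x) 7) =
      Function.update t 7 (unary x.length) := by
    funext q
    simp only [Function.update_apply]
    split_ifs <;> simp_all
  rw [e2', length_enc] at e2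
  simp only [ne_eq, OfNat.one_ne_ofNat, not_false_eq_true, Function.update_of_ne, h1,
    length_unary, Nat.reduceEqDiff, hq 2 le_rfl, List.append_nil] at e3
  set t₃ := Function.update (Function.update t 7 (unary x.length)) 2 (unary k) with ht₃
  obtain ⟨t₄, e4, f1, f2, f3⟩ := Layout.watch_fuel (ℓ := stdLayout s 2 0 (by omega))
    (m := x.length) hd t₃
    (fun r => by
      show t₃ (8 * r + 2) = _
      rcases r with _ | r
      · simp [ht₃, initState]
      · rw [initState_of_length_le (by simp), ht₃]
        simp only [Function.update_apply]
        rw [if_neg (by omega), if_neg (by omega), hq _ (by omega)])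
    (by show t₃ 7 = _; simp [ht₃, unary])
    (by show t₃ 31 = _; simp [ht₃, hq])
  have hF : ∀ q, q % 8 ≠ 2 → q ≠ 7 → q ≠ 15 → q ≠ 23 → q ≠ 31 → q ≠ 2 → t₄ q = t q := by
    intro q a1 a2 a3 a4 a5 a6
    rw [f1 q (fun r => by simp only [stdLayout]; omega) (by simpa [stdLayout])
      (by simpa [stdLayout]) (by simpa [stdLayout]) (by simpa [stdLayout])]
    simp [ht₃, a2, a6]
  have f3 : t₄ 7 = [] ↔ x.length ≤ T := f3
  have hfin : ∃ t', ERun (.ifTop 7 none (.emit 0) (probe s A w₀ w₁)) t₄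
      [if x.length ≤ T then enc x else if L = [] then w₀ else w₁]
      ((2 * s + 8) * x.length + 9 * k + (if x.length ≤ T then 0 else (s + 10) * B) +
        Layout.rest A + 2 * w₀.length + 2 * w₁.length + 11) t' := by
    have g0 : t₄ 0 = enc x := hF 0 (by omega) (by omega) (by omega) (by omega) (by omega) (by omega)
    have g1 : t₄ 1 = unary k :=
      hF 1 (by omega) (by omega) (by omega) (by omega) (by omega) (by omega)
    by_cases hT : x.length ≤ T
    · rw [if_pos hT, if_pos hT]
      have := ERun.emit 0 t₄
      rw [g0, length_enc] at this
      exact ⟨_, (this.ifTop_true (by simp [f3.2 hT])).mono (by ring_nf; omega)⟩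
    · rw [if_neg hT, if_neg hT]
      obtain ⟨t', h⟩ := probe_run hA w₀ w₁ t₄ g0 g1
        (by rw [hF 4 (by omega) (by omega) (by omega) (by omega) (by omega) (by omega),
          hq 4 (by omega)])
        (by rw [hF 5 (by omega) (by omega) (by omega) (by omega) (by omega) (by omega),
          hq 5 (by omega)])
        (fun r => by rw [hF _ (by omega) (by omega) (by omega) (by omega) (by omega) (by omega),
          hq _ (by omega)])
        (fun r hr => by rw [hF _ (by omega) (by omega) (by omega) (by omega) (by omega) (by omega),
          hq _ (by omega)])
      exact ⟨t', (h.ifTop_false (by simpa using mt f3.1 hT)).mono (by ring_nf; omega)⟩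
  obtain ⟨t', e5⟩ := hfin
  refine ⟨t', (e1.seq_silent (e2.seq_silent (e3.seq_silent (e4.seq_silent e5)))).mono ?_⟩
  simp only [stdLayout]
  ring_nf
  omega

/-- If the second input is `w₁`, run `A` on the first and third one or do nothing, depending on
whether the fifth input is `w₂`; else output the fifth input. -/
def expand (A : Prog) (w₁ w₂ : List ℕ) : Prog :=
  ifEq 1 w₁ (ifEq 4 w₂ (.seq (clear 3) (.seq (mv 1 2 1) A)) .skip) (.emit 4)

theorem expand_run {A : Prog} {x y Y : List ℕ} {k k' : ℕ} {L : List (List ℕ)} {B : ℕ} {s' : State}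
    (hA : ERun A (initState [x, unary k]) L B s') (w₁ w₂ : List ℕ) :
    ∃ t', ERun (expand A w₁ w₂) (initState [x, y, unary k, unary k', Y])
      (if y = w₁ then if Y = w₂ then L else [] else [Y])
      ((if y = w₁ ∧ Y = w₂ then B else 0) + 4 * k + 2 * k' + Y.length + 2 * w₁.length +
        2 * w₂.length + 10) t' := by
  by_cases hy : y = w₁
  · rw [if_pos hy]
    by_cases hY : Y = w₂
    · rw [if_pos hY, if_pos ⟨hy, hY⟩]
      have e1 := clear_run (a := 3) (unary k') (initState [x, [], unary k, unary k', []]) rfl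
      rw [update_initState _ _ _ (by simp)] at e1
      have e2 := mv_run (a := 2) (b := 1) (by omega) 1 (unary k)
        (initState [x, [], unary k, [], []]) rfl (fun a ha => eq_zero_of_mem_unary ha)
      rw [update_initState _ _ _ (by simp), update_initState _ _ _ (by simp)] at e2
      have e : initState [x, unary k] = initState [x, unary k, [], [], []] :=
        (initState_append_replicate [x, unary k] 3).symm
      rw [e] at hA
      simp only [initState_apply, List.getD_cons_zero, List.getD_cons_succ, List.append_nil,
        List.set_cons_zero, List.set_cons_succ, unary, List.reverse_replicate] at e1 e2 hA
      refine ⟨s', (ifEq_run_eq (a := 1) (s := initState [x, y, unary k, unary k', Y]) w₁ hy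
        (B := B + 4 * k + 2 * k' + 2 * w₂.length + 3) ?_).mono (by omega)⟩
      rw [update_initState _ _ _ (by simp)]
      refine (ifEq_run_eq (B := B + 4 * k + 2 * k' + 2) w₂ hY ?_).mono (by omega)
      rw [update_initState _ _ _ (by simp)]
      exact (e1.seq_silent (e2.seq_silent hA)).mono (by simp; omega)
    · rw [if_neg hY]
      obtain ⟨l, h⟩ := ifEq_run_ne (a := 4) w₂ (p := .seq (clear 3) (.seq (mv 1 2 1) A))
        (s := Function.update (initState [x, y, unary k, unary k', Y]) 1 [])
        (by rw [update_initState _ _ _ (by simp)]; exact hY) (fun l => ERun.skip _)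
      exact ⟨_, (ifEq_run_eq (a := 1) (s := initState [x, y, unary k, unary k', Y]) w₁ hy h).mono
        (by omega)⟩
  · rw [if_neg hy]
    obtain ⟨l, h⟩ := ifEq_run_ne (a := 1) w₁
      (p := ifEq 4 w₂ (.seq (clear 3) (.seq (mv 1 2 1) A)) .skip)
      (s := initState [x, y, unary k, unary k', Y]) hy (q := .emit 4) (L := [Y]) (B := Y.length)
      (fun l => by
        have := ERun.emit 4 (Function.update (initState [x, y, unary k, unary k', Y]) 1 l)
        simpa [initState_apply] using this)
    exact ⟨_, h.mono (by omega)⟩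

theorem primrec_unary : Primrec unary :=
  (Primrec.list_map Primrec.list_range (Primrec.const 0).to₂).of_eq fun k => by simp [unary]

/-- The initial state is computable from the content of register `0`. -/
theorem computable_take_initState {α : Type*} [Primcodable α] {f : α → List ℕ} (hf : Primrec f)
    (N : ℕ) : Computable fun a => State.take N (initState [f a]) := by
  refine (Primrec.fin_curry.2 ?_).to_comp
  have : Primrec₂ fun (a : α) (i : Fin N) => if i.1 = 0 then f a else [] :=
    Primrec.ite (Primrec.eq.comp (Primrec.fin_val.comp Primrec.snd) (Primrec.const 0))
      (hf.comp Primrec.fst) (Primrec.const [])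
  refine this.of_eq fun a i => ?_
  rcases i with ⟨_ | i, hi⟩ <;> simp [State.take, initState]

theorem EnumeratesWithDelay.of_erun {s : ℕ} {p : Prog} {inputs : List (List ℕ)}
    {S : Finset (Word s)} {l : List (Word s)} {B B' : ℕ} {s' : State}
    (h : ERun p (initState inputs) (l.map enc) B s') (hl : l.Nodup) (hS : l.toFinset = S)
    (hB : B ≤ B') : EnumeratesWithDelay p inputs S B' := by
  obtain ⟨τ, h1, h2, h3⟩ := h
  exact ⟨τ, s', l, h1, h2, hl, hS, h3.mono hB⟩

theorem EnumeratesWithDelay.exists_erun {s : ℕ} {p : Prog} {inputs : List (List ℕ)}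
    {S : Finset (Word s)} {B : ℕ} (h : EnumeratesWithDelay p inputs S B) :
    ∃ (l : List (Word s)) (s' : State), ERun p (initState inputs) (l.map enc) B s' ∧ l.Nodup ∧
      l.toFinset = S := by
  obtain ⟨τ, s', l, h1, h2, h3, h4, h5⟩ := h
  exact ⟨l, s', ⟨τ, h1, h2, h5⟩, h3, h4⟩

/-! ### Correctness of the kernel, for FPT delay and for polynomial delay -/

namespace ParamEnumProblem

variable {s : ℕ}

/-- A kernel from an algorithm with delay `f (κ x) * |x| ^ O(1)`, and a program `d` without output
that makes at least about `f k` steps on the number `k`. -/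
theorem exists_kernel (P : ParamEnumProblem s) {A d : Prog} {f T : ℕ → ℕ} {C₀ : ℕ}
    (hA : P.EnumeratedWithFactor A f) (s' : ℕ → State)
    (hd : ∀ k, Run d (initState [unary k]) (List.replicate (T k) none) (s' k))
    (hf : ∀ k, f k ≤ k + T k + C₀) :
    ∃ (A₁ A₂ : Prog) (C : ℕ), ∀ f' : ℕ → ℕ, (∀ k, C ≤ f' k) →
      (∀ x : Word s, x.length ≤ T (P.κ x) → x.length ≤ f' (P.κ x) ∧ P.κ x ≤ f' (P.κ x)) →
      P.IsPDKernel A₁ A₂ f' := by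
  classical
  obtain ⟨c, hA⟩ := hA
  -- If no instance has a solution, or none lacks one, the corresponding fixed instance is never
  -- called for and the empty word is a dummy.
  obtain ⟨y₁, hy₁⟩ : ∃ y₁, ∀ x, (P.Sol x).Nonempty → (P.Sol y₁).Nonempty := by
    by_cases h : ∃ y, (P.Sol y).Nonempty
    · exact ⟨h.choose, fun _ _ => h.choose_spec⟩
    · exact ⟨[], fun x hx => (h ⟨x, hx⟩).elim⟩
  obtain ⟨y₀, hy₀⟩ : ∃ y₀, ∀ x, ¬ (P.Sol x).Nonempty → ¬ (P.Sol y₀).Nonempty := by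
    by_cases h : ∃ y, ¬ (P.Sol y).Nonempty
    · exact ⟨h.choose, fun _ _ => h.choose_spec⟩
    · exact ⟨[], fun x hx => (h ⟨x, hx⟩).elim⟩
  obtain ⟨Y₁, hY₁⟩ : ∃ Y₁, (P.Sol y₁).Nonempty → Y₁ ∈ P.Sol y₁ := by
    by_cases h : (P.Sol y₁).Nonempty
    · exact ⟨h.choose, fun _ => h.choose_spec⟩
    · exact ⟨[], fun hx => (h hx).elim⟩
  choose l t hl hnd hS using fun x => (hA x).exists_erun
  have hlS (x : Word s) : (l x).map enc = [] ↔ ¬ (P.Sol x).Nonempty := by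
    rw [← hS x, List.map_eq_nil_iff, Finset.not_nonempty_iff_eq_empty, List.toFinset_eq_empty_iff]
  let y : Word s → Word s := fun x => if x.length ≤ T (P.κ x) then x else
    if (P.Sol x).Nonempty then y₁ else y₀
  have hy (x : Word s) : (P.Sol (y x)).Nonempty ↔ (P.Sol x).Nonempty := by
    simp only [y]
    split_ifs with h1 h2
    · rfl
    · exact ⟨fun _ => h2, fun _ => hy₁ x h2⟩
    · exact ⟨fun h => (hy₀ x h2 h).elim, fun h => (h2 h).elim⟩
  -- The heart of the argument: T(κ(x)) < |x| turns the factor f(κ(x)) into something linear in |x|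
  -- + κ(x).
  have hdelay (x : Word s) (hx : ¬ x.length ≤ T (P.κ x)) : f (P.κ x) * (x.length + 1) ^ c ≤
      (x.length + P.κ x + C₀) * (x.length + P.κ x + 1) ^ c := by
    refine Nat.mul_le_mul ?_ (Nat.pow_le_pow_left (by omega) c)
    have := hf (P.κ x)
    omega
  refine ⟨compress s d A (enc y₀) (enc y₁), expand A (enc y₁) (enc Y₁),
    y₀.length + y₁.length + P.κ y₀ + P.κ y₁, fun f' hf' hx' => ⟨y, ⟨?_, fun x => ?_⟩, ?_⟩⟩
  · let D := Layout.rest d + Layout.rest A + 2 * y₀.length + 2 * y₁.length + 20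
    refine ⟨.C 2 * (.C (5 * s + 60) * .X + .C (s + 10) * ((.X + .C C₀) * (.X + 1) ^ c) + .C D) + 1,
      fun x => ?_⟩
    obtain ⟨t', e⟩ := compress_run (hd (P.κ x)) (hl x) (enc y₀) (enc y₁)
    have ey : (if x.length ≤ T (P.κ x) then enc x else
        if (l x).map enc = [] then enc y₀ else enc y₁) = enc (y x) := by
      simp only [y, hlS, ite_not]
      split_ifs <;> rfl
    rw [ey] at e
    refine e.computesInTime ?_
    simp only [Polynomial.eval_add, Polynomial.eval_mul, Polynomial.eval_C, Polynomial.eval_X,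
      Polynomial.eval_pow, Polynomial.eval_one, length_enc]
    have h1 : (if x.length ≤ T (P.κ x) then 0 else
        (s + 10) * (f (P.κ x) * (x.length + 1) ^ c)) ≤
        (s + 10) * ((x.length + P.κ x + C₀) * (x.length + P.κ x + 1) ^ c) := by
      split_ifs with h
      · exact Nat.zero_le _
      · exact Nat.mul_le_mul_left _ (hdelay x h)
    have h2 : (5 * s + 30) * x.length + 18 * P.κ x ≤ (5 * s + 60) * (x.length + P.κ x) := by
      nlinarith
    simp only [D]
    omega
  · refine ⟨?_, ?_, hy x⟩
    · simp only [y]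
      have := hf' (P.κ x)
      split_ifs with h1
      · exact (hx' x h1).2
      · omega
      · omega
    · simp only [y]
      have := hf' (P.κ x)
      split_ifs with h1
      · exact (hx' x h1).1
      · omega
      · omega
  · let D := f (P.κ y₁) * (y₁.length + 1) ^ c + 2 * y₁.length + 2 * Y₁.length + 10
    refine ⟨(.X + .C C₀) * (.X + 1) ^ c + .C 10 * .X + .C D,
      fun x Y => if y x = y₁ then if Y = Y₁ then P.Sol x else ∅ else {Y}, fun x => ⟨?_, ?_, ?_⟩⟩
    · intro Y _
      obtain ⟨t', e⟩ := expand_run (y := enc (y x)) (Y := enc Y) (k' := P.κ (y x)) (hl x)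
        (enc y₁) (enc Y₁)
      simp only [enc_injective.eq_iff, length_enc] at e
      have e' : (if y x = y₁ then if Y = Y₁ then (l x).map enc else [] else [enc Y]) =
          (if y x = y₁ then if Y = Y₁ then l x else [] else [Y]).map enc := by
        split_ifs <;> rfl
      rw [e'] at e
      refine .of_erun e ?_ ?_ ?_
      · split_ifs
        · exact hnd x
        · exact List.nodup_nil
        · exact List.nodup_singleton Y
      · beta_reduce
        split_ifs
        · exact hS x
        · simp
        · simp
      · simp only [Polynomial.eval_add, Polynomial.eval_mul, Polynomial.eval_C, Polynomial.eval_X,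
          Polynomial.eval_pow, Polynomial.eval_one]
        set z := x.length + (y x).length + P.κ x + P.κ (y x) + Y.length with hz
        have h1 : (if y x = y₁ ∧ Y = Y₁ then f (P.κ x) * (x.length + 1) ^ c else 0) ≤
            (z + C₀) * (z + 1) ^ c + f (P.κ y₁) * (y₁.length + 1) ^ c := by
          split_ifs with h
          · by_cases h1 : x.length ≤ T (P.κ x)
            · have : x = y₁ := by rw [← h.1]; simp [y, h1]
              rw [← this]
              exact Nat.le_add_left _ _
            · refine ((hdelay x h1).trans (Nat.mul_le_mul (by omega)
                (Nat.pow_le_pow_left (by omega) c))).trans (Nat.le_add_right _ _)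
          · exact Nat.zero_le _
        simp only [D]
        omega
    · intro Y _ Y' _ hne
      simp only [Function.onFun]
      split_ifs with h1 h2 h3
      · exact (hne (h2.trans h3.symm)).elim
      · exact Finset.disjoint_empty_right _
      · exact Finset.disjoint_empty_left _
      · exact Finset.disjoint_empty_left _
      · simpa using hne
    · by_cases h1 : y x = y₁
      · simp only [h1, if_true]
        by_cases h2 : (P.Sol x).Nonempty
        · have h3 := hY₁ (hy₁ x h2)
          ext Z
          simp only [Finset.mem_biUnion]
          refine ⟨?_, fun h => ⟨Y₁, h3, by simpa using h⟩⟩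
          rintro ⟨Y, -, hY⟩
          split_ifs at hY
          · exact hY
          · simp at hY
        -- This happens only if y₁ has no solutions, for example when it is a dummy; then both sides
        -- are empty.
        · have h3 : P.Sol y₁ = ∅ := by
            rw [← Finset.not_nonempty_iff_eq_empty, ← h1, hy x]
            exact h2
          rw [h3, Finset.biUnion_empty, Finset.not_nonempty_iff_eq_empty.1 h2]
      · simp only [h1, if_false, Finset.biUnion_singleton_eq_self]
        by_cases h2 : x.length ≤ T (P.κ x)
        · simp [y, h2]
        -- A long x whose kernel differs from y₁ has kernel y₀, so there is nothing to enumerate.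
        · have h3 : ¬ (P.Sol x).Nonempty := by
            intro h3
            simp [y, h2, h3] at h1
          have h4 := h3
          rw [← hy x] at h4
          rw [Finset.not_nonempty_iff_eq_empty.1 h3, Finset.not_nonempty_iff_eq_empty.1 h4]

/-- `d` leaves f(k) in unary in register 0, which held k symbols at the start, so `Run.length_le`
gives f(k) ≤ k + T(k). The kernel size is T(k) + k plus a constant for y₀ and y₁. -/
theorem HasFPTDelayAlgorithm.hasPDKernel {P : ParamEnumProblem s}
    (h : P.HasFPTDelayAlgorithm) : P.HasPDKernel := by
  obtain ⟨A, f, hf, hA⟩ := h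
  obtain ⟨d, hd⟩ := exists_prog_of_computable hf
  obtain ⟨T, hT, hdT⟩ := exists_computable_time d (fun k => initState [unary k])
    (computable_take_initState primrec_unary) _ hd
  obtain ⟨A₁, A₂, C, h⟩ := P.exists_kernel (C₀ := 0) hA _ hdT (fun k => by
    simpa [initState] using (hdT k).length_le 0)
  refine ⟨A₁, A₂, fun k => T k + k + C, ?_, h _ (fun k => by omega) fun x hx => ⟨?_, ?_⟩⟩
  · exact (Primrec.nat_add.to_comp.comp (Primrec.nat_add.to_comp.comp hT .id) (.const C))
  · omega
  · omega

/-- With `skip` as the clock, T = 1 and only words of length at most 1 are kept as kernels. There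
are finitely many of them, so κ is bounded on them without any assumption. -/
theorem HasPolyDelayAlgorithm.hasConstantSizePDKernel {P : ParamEnumProblem s}
    (h : P.HasPolyDelayAlgorithm) : P.HasConstantSizePDKernel := by
  obtain ⟨A, f, hf, ⟨C₀, hC₀⟩, hA⟩ := h
  obtain ⟨A₁, A₂, C, h⟩ := P.exists_kernel (d := .skip) (T := fun _ => 1) (C₀ := C₀) hA _
    (fun k => .skip _) (fun k => (hC₀ k).trans (by omega))
  have hfin : {x : Word s | x.length ≤ 1}.Finite := List.finite_length_le _ 1
  obtain ⟨D, hD⟩ := (hfin.image P.κ).bddAbove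
  refine ⟨A₁, A₂, fun _ => C + D + 1, .const _, ⟨_, fun _ => le_rfl⟩,
    h _ (fun k => by omega) fun x hx => ⟨by omega, ?_⟩⟩
  have : P.κ x ≤ D := hD ⟨x, hx, rfl⟩
  omega

end ParamEnumProblem

/-! ### From kernels to enumeration algorithms -/

/-- A list of words as the content of a register: the words are reversed, and each one is followed
by the symbol `s`. -/
def pack {s : ℕ} (l : List (Word s)) : List ℕ := l.flatMap fun w => (enc w).reverse ++ [s]

@[simp] theorem pack_cons {s : ℕ} (w : Word s) (l : List (Word s)) :
    pack (w :: l) = (enc w).reverse ++ s :: pack l := by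
  simp [pack]

theorem length_le_length_pack {s : ℕ} (l : List (Word s)) : l.length ≤ (pack l).length := by
  induction l with
  | nil => simp
  | cons w l ih => simp; omega

theorem length_le_length_pack_of_mem {s : ℕ} {l : List (Word s)} {w : Word s} (h : w ∈ l) :
    w.length ≤ (pack l).length := by
  induction l with
  | nil => simp at h
  | cons v l ih =>
    simp only [pack_cons, List.length_append, List.length_reverse, length_enc, List.length_cons]
    rcases List.mem_cons.1 h with rfl | h
    · omega
    · have := ih h
      omega

/-- Move the first word of the list in register `18` to register `37`. -/
def unpack (s : ℕ) : Prog :=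
  .seq (.push 20 0) (.loop 20 (.seq (.pop 20) (.ifTop 18 (some s) (.pop 18)
    (.seq (mvTop 18 37 s) (.push 20 0)))))

/-- Words are packed in reverse since moving from stack to stack reverses them once more. -/
theorem unpack_run {s : ℕ} (w rest : List ℕ) (hw : ∀ a ∈ w, a < s) (t : State)
    (h18 : t 18 = w.reverse ++ s :: rest) (h20 : t 20 = []) :
    ERun (unpack s) t [] ((s + 6) * w.length + 6)
      (Function.update (Function.update t 18 rest) 37 (w ++ t 37)) := by
  have key : ∀ (v : List ℕ) (t : State), (∀ a ∈ v, a < s) → t 18 = v ++ s :: rest → t 20 = [0] →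
      ERun (.loop 20 (.seq (.pop 20) (.ifTop 18 (some s) (.pop 18)
        (.seq (mvTop 18 37 s) (.push 20 0))))) t [] ((s + 6) * v.length + 5)
        (Function.update (Function.update (Function.update t 18 rest) 37 (v.reverse ++ t 37))
          20 []) := by
    intro v
    induction v with
    | nil =>
      intro t hv h18 h20
      refine ERun.loop_step_silent (by simp [h20]) ((ERun.pop 20 t).seq_silent
        ((ERun.pop 18 _).ifTop_true (by simp [h18]))) (.loop_done (by simp [h20])) |>.mono
        (by simp) |>.cast ?_
      funext q
      simp only [Function.update_apply]
      split_ifs <;> simp_all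
    | cons x v ih =>
      intro t hv h18 h20
      have hx : x < s := hv x (by simp)
      have e1 := mvTop_run (a := 18) (b := 37) (by omega) (s := Function.update t 20 [])
        (x := x) (l := v ++ s :: rest) (by simp [h18]) s hx
      refine ERun.loop_step_silent (by simp [h20]) (((ERun.pop 20 t).cast (s₂ :=
        Function.update t 20 []) (by simp [h20])).seq_silent ((e1.seq_silent
        (ERun.push 20 0 _)).ifTop_false (by simp [h18, hx.ne])))
        (ih _ (fun a ha => hv a (by simp [ha]))
        (by simp) (by simp)) |>.mono (by simp; ring_nf; omega) |>.cast ?_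
      funext q
      by_cases h1 : q = 20
      · subst h1; simp
      by_cases h2 : q = 37
      · subst h2; simp
      by_cases h3 : q = 18
      · subst h3; simp
      simp [h1, h2, h3]
  have e := key w.reverse (Function.update t 20 [0]) (by simpa using hw) (by simp [h18]) (by simp)
  refine (((ERun.push 20 0 t).cast (by rw [h20])).seq_silent e).mono (by simp; omega) |>.cast ?_
  funext q
  simp only [Function.update_apply]
  split_ifs <;> simp_all

/-- Put the marker `M` on the registers of a program. -/
def mark (M : ℕ) : ℕ → Prog
  | 0 => .skip
  | N + 1 => .seq (mark M N) (.push (8 * N + 5) M)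

theorem mark_run (M N : ℕ) (t : State) : ∃ t', ERun (mark M N) t [] (N + 1) t' ∧
    (∀ r < N, t' (8 * r + 5) = M :: t (8 * r + 5)) ∧
    ∀ q, (∀ r < N, q ≠ 8 * r + 5) → t' q = t q := by
  induction N with
  | zero => exact ⟨t, .skip t, by omega, fun _ _ => rfl⟩
  | succ N ih =>
    obtain ⟨t', h1, h2, h3⟩ := ih
    refine ⟨_, h1.seq_silent (.push (8 * N + 5) M t'), fun r hr => ?_, fun q hq => ?_⟩
    · by_cases h : r = N
      · subst h
        simp [h3 (8 * r + 5) (fun r' hr' => by omega)]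
      · simp [h, h2 r (by omega)]
    · rw [Function.update_of_ne (hq N (by omega)), h3 q fun r hr => hq r (by omega)]

/-- Registers for the lifting algorithm. -/
def stdGround (M : ℕ) : Ground where
  ρ r := 8 * r + 5
  u := 6
  e := 14
  φ := 22
  M := M
  inj a b h := by simp only at h; omega
  ρu r := by omega
  ρe r := by omega
  ρφ r := by omega
  ue := by omega
  uφ := by omega
  eφ := by omega

/-- Run the lifting algorithm `A` for the first solution in register `18`. -/
def liftStep (s N M : ℕ) (A : Prog) : Prog :=
  .seq (mark M N) (.seq (unpack s) (.seq (cp s 0 5 4) (.seq (cp s 12 13 4)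
    (.seq (cp 1 1 21 4) (.seq (cp 1 10 29 4) ((stdGround M).lift A))))))

/-- The state in which the solutions in `l` remain to be lifted. -/
structure Ready {s : ℕ} (x y : Word s) (k k' : ℕ) (l : List (Word s)) (t : State) : Prop where
  h0 : t 0 = enc x
  h1 : t 1 = unary k
  h4 : t 4 = []
  h6 : t 6 = []
  h10 : t 10 = unary k'
  h12 : t 12 = enc y
  h14 : t 14 = []
  h18 : t 18 = pack l
  h20 : t 20 = []
  h22 : t 22 = []

/-- All registers that the next round needs are restored, and those of the lifting algorithm are
left dirty: new markers are put on top of the old contents, so the cost does not depend on the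
leftovers. -/
theorem liftStep_run {s N M : ℕ} {A : Prog} (hN : A.RegsLT N) (hM : A.SymLT M)
    (hMs : s < M) {x y Y : Word s} {k k' : ℕ} {l : List (Word s)} {L : List (List ℕ)} {B : ℕ}
    {s' : State} (hA : ERun A (initState [enc x, enc y, unary k, unary k', enc Y]) L B s')
    {t : State} (ht : Ready x y k k' (Y :: l) t) :
    ∃ t', ERun (liftStep s N M A) t L ((2 * s + 10) * (x.length + y.length + k + k' + Y.length) +
      (2 * M + 20) * (3 * B + 2) + N + 15) t' ∧ Ready x y k k' l t' := by
  obtain ⟨t₁, e1, h5, hF⟩ := mark_run M N t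
  have hF' : ∀ q, q % 8 ≠ 5 → t₁ q = t q := fun q hq => hF q fun r _ => by omega
  have a0 : t₁ 0 = enc x := (hF' 0 (by omega)).trans ht.h0
  have a1 : t₁ 1 = unary k := (hF' 1 (by omega)).trans ht.h1
  have a4 : t₁ 4 = [] := (hF' 4 (by omega)).trans ht.h4
  have a6 : t₁ 6 = [] := (hF' 6 (by omega)).trans ht.h6
  have a10 : t₁ 10 = unary k' := (hF' 10 (by omega)).trans ht.h10
  have a12 : t₁ 12 = enc y := (hF' 12 (by omega)).trans ht.h12
  have a14 : t₁ 14 = [] := (hF' 14 (by omega)).trans ht.h14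
  have a18 : t₁ 18 = (enc Y).reverse ++ s :: pack l := by
    rw [hF' 18 (by omega), ht.h18, pack_cons]
  have a20 : t₁ 20 = [] := (hF' 20 (by omega)).trans ht.h20
  have a22 : t₁ 22 = [] := (hF' 22 (by omega)).trans ht.h22
  have e2 := unpack_run (enc Y) (pack l) (fun a ha => lt_of_mem_enc ha) t₁ a18 a20
  set t₂ := Function.update (Function.update t₁ 18 (pack l)) 37 (enc Y ++ t₁ 37) with ht₂
  have e3 := cp_run (a := 0) (b := 5) (t := 4) (by omega) (by omega) (by omega) s t₂
    (by simp [ht₂, a4]) (fun a ha => lt_of_mem_enc (w := x) (by simpa [ht₂, a0] using ha))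
  set t₃ := Function.update t₂ 5 (t₂ 0 ++ t₂ 5) with ht₃
  have e4 := cp_run (a := 12) (b := 13) (t := 4) (by omega) (by omega) (by omega) s t₃
    (by simp [ht₃, ht₂, a4]) (fun a ha => lt_of_mem_enc (w := y)
      (by simpa [ht₃, ht₂, a12] using ha))
  set t₄ := Function.update t₃ 13 (t₃ 12 ++ t₃ 13) with ht₄
  have e5 := cp_run (a := 1) (b := 21) (t := 4) (by omega) (by omega) (by omega) 1 t₄
    (by simp [ht₄, ht₃, ht₂, a4]) (fun a ha => eq_zero_of_mem_unary (k := k)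
      (by simpa [ht₄, ht₃, ht₂, a1] using ha))
  set t₅ := Function.update t₄ 21 (t₄ 1 ++ t₄ 21) with ht₅
  have e6 := cp_run (a := 10) (b := 29) (t := 4) (by omega) (by omega) (by omega) 1 t₅
    (by simp [ht₅, ht₄, ht₃, ht₂, a4]) (fun a ha => eq_zero_of_mem_unary (k := k')
      (by simpa [ht₅, ht₄, ht₃, ht₂, a10] using ha))
  set t₆ := Function.update t₅ 29 (t₅ 10 ++ t₅ 29) with ht₆
  have b0 : t₂ 0 = enc x := by simp [ht₂, a0]
  have b12 : t₃ 12 = enc y := by simp [ht₃, ht₂, a12]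
  have b1 : t₄ 1 = unary k := by simp [ht₄, ht₃, ht₂, a1]
  have b10 : t₅ 10 = unary k' := by simp [ht₅, ht₄, ht₃, ht₂, a10]
  have hout : ∀ q, q % 8 ≠ 5 → q ≠ 18 → t₆ q = t q := by
    intro q hq h
    rw [← hF' q hq, ht₆, ht₅, ht₄, ht₃, ht₂]
    simp only [Function.update_apply]
    rw [if_neg (by omega), if_neg (by omega), if_neg (by omega), if_neg (by omega),
      if_neg (by omega), if_neg (by omega)]
  have hrep : (stdGround M).Rep N (fun r => t (8 * r + 5))
      (initState [enc x, enc y, unary k, unary k', enc Y]) t₆ := by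
    refine ⟨fun r hr => ?_, fun r a ha => ?_, ?_, ?_, ?_⟩
    · show t₆ (8 * r + 5) = _ ++ M :: t (8 * r + 5)
      rw [← h5 r hr]
      rcases r with _ | _ | _ | _ | _ | r
      · rw [ht₆, ht₅, ht₄, ht₃, b0]; simp [ht₂, initState]
      · rw [ht₆, ht₅, ht₄, b12]; simp [ht₃, ht₂, initState]
      · rw [ht₆, ht₅, b1]; simp [ht₄, ht₃, ht₂, initState]
      · rw [ht₆, b10]; simp [ht₅, ht₄, ht₃, ht₂, initState]
      · simp [ht₆, ht₅, ht₄, ht₃, ht₂, initState]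
      · rw [initState_of_length_le (by simp), ht₆, ht₅, ht₄, ht₃, ht₂]
        simp only [Function.update_apply]
        rw [if_neg (by omega), if_neg (by omega), if_neg (by omega), if_neg (by omega),
          if_neg (by omega), if_neg (by omega), List.nil_append]
    · show a < M
      rcases r with _ | _ | _ | _ | _ | r
      · exact (lt_of_mem_enc (w := x) ha).trans hMs
      · exact (lt_of_mem_enc (w := y) ha).trans hMs
      · have := eq_zero_of_mem_unary (k := k) ha; omega
      · have := eq_zero_of_mem_unary (k := k') ha; omega
      · exact (lt_of_mem_enc (w := Y) ha).trans hMs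
      · rw [initState_of_length_le (by simp)] at ha
        simp at ha
    · exact (hout 6 (by omega) (by omega)).trans ht.h6
    · exact (hout 14 (by omega) (by omega)).trans ht.h14
    · exact (hout 22 (by omega) (by omega)).trans ht.h22
  obtain ⟨t', e7, c6, c14, c22, hfr⟩ := Ground.lift_run hA hN hM t₆ hrep
  have hfr' : ∀ q, q % 8 ≠ 5 → q ≠ 6 → q ≠ 14 → q ≠ 22 → t' q = t₆ q := fun q h1 h2 h3 h4 =>
    hfr q (fun r => by simp only [stdGround]; omega) h2 h3 h4
  refine ⟨t', (e1.seq_silent (e2.seq_silent (e3.seq_silent (e4.seq_silent (e5.seq_silent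
    (e6.seq_silent e7)))))).mono ?_, ?_⟩
  · rw [b0, b12, b1, b10]
    simp only [length_enc, length_unary, Ground.slow, stdGround]
    ring_nf
    nlinarith [Nat.zero_le (k * s), Nat.zero_le (k' * s)]
  · have hh : ∀ q, q % 8 ≠ 5 → q ≠ 6 → q ≠ 14 → q ≠ 22 → q ≠ 18 → t' q = t q :=
      fun q h1 h2 h3 h4 h5 => (hfr' q h1 h2 h3 h4).trans (hout q h1 h5)
    refine ⟨?_, ?_, ?_, c6, ?_, ?_, c14, ?_, ?_, c22⟩
    · rw [hh _ (by omega) (by omega) (by omega) (by omega) (by omega), ht.h0]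
    · rw [hh _ (by omega) (by omega) (by omega) (by omega) (by omega), ht.h1]
    · rw [hh _ (by omega) (by omega) (by omega) (by omega) (by omega), ht.h4]
    · rw [hh _ (by omega) (by omega) (by omega) (by omega) (by omega), ht.h10]
    · rw [hh _ (by omega) (by omega) (by omega) (by omega) (by omega), ht.h12]
    · rw [hfr' _ (by omega) (by omega) (by omega) (by omega)]
      simp [ht₆, ht₅, ht₄, ht₃, ht₂]
    · rw [hh _ (by omega) (by omega) (by omega) (by omega) (by omega), ht.h20]

/-- A solution may contribute no output at all, so silent stretches can extend over many rounds; the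
factor `l.length` cannot be avoided by this argument. -/
theorem liftLoop_run {s N M : ℕ} {A : Prog} (hN : A.RegsLT N) (hM : A.SymLT M)
    (hMs : s < M) {x y : Word s} {k k' B W : ℕ} {L : Word s → List (List ℕ)} {s' : Word s → State}
    (l : List (Word s)) (hW : ∀ Y ∈ l, Y.length ≤ W)
    (hA : ∀ Y ∈ l, ERun A (initState [enc x, enc y, unary k, unary k', enc Y]) (L Y) B (s' Y))
    {t : State} (ht : Ready x y k k' l t) :
    ∃ t', ERun (.loop 18 (liftStep s N M A)) t (l.flatMap L)
      (l.length * ((2 * s + 10) * (x.length + y.length + k + k' + W) +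
        (2 * M + 20) * (3 * B + 2) + N + 16) + 1) t' := by
  induction l generalizing t with
  | nil => exact ⟨t, (ERun.loop_done ht.h18).mono (by simp)⟩
  | cons Y l ih =>
    obtain ⟨t₁, e1, ht₁⟩ := liftStep_run hN hM hMs (hA Y (by simp)) ht
    obtain ⟨t', e2⟩ := ih (fun Z hZ => hW Z (by simp [hZ])) (fun Z hZ => hA Z (by simp [hZ])) ht₁
    refine ⟨t', ?_⟩
    rw [List.flatMap_cons]
    refine (ERun.loop_step (by simp [ht.h18]) e1 e2).mono ?_
    have h1 : (2 * s + 10) * (x.length + y.length + k + k' + Y.length) ≤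
        (2 * s + 10) * (x.length + y.length + k + k' + W) :=
      Nat.mul_le_mul_left _ (by have := hW Y (by simp); omega)
    rw [List.length_cons, Nat.add_one_mul l.length]
    omega

/-- Compute the kernel by `A₁`, its parameter and its solutions by `b`, and lift the solutions
by `A₂`. -/
def viaKernel (s N M : ℕ) (A₁ A₂ b : Prog) : Prog :=
  .seq (cp s 0 3 4) (.seq (cp 1 1 11 4) (.seq (.push 7 1)
    (.seq ((stdLayout s 3 0 (by omega)).watch A₁) (.seq (mv s 15 12) (.seq (cp s 12 2 4)
    (.seq (b.rename fun r => 8 * r + 2) (.loop 18 (liftStep s N M A₂))))))))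

/-- The word y appears on the output tape, from where a program cannot read; watching `A₁` up to its
only output captures y, reversed, in register 15. Registers 10 and 18 are the registers 1 and 2 of
the renamed program `b`, with κ(y) and the packed solutions. -/
theorem viaKernel_run {s N M : ℕ} {A₁ A₂ b : Prog} (hN : A₂.RegsLT N) (hM : A₂.SymLT M)
    (hMs : s < M) {x y : Word s} {k k' B₁ B T W : ℕ} {L : Word s → List (List ℕ)}
    {s₁ : State} {s' : Word s → State} {l : List (Word s)}
    (hA₁ : ERun A₁ (initState [enc x, unary k]) [enc y] B₁ s₁)
    (hb : ∃ u, ERun b (initState [enc y]) [] T u ∧ u 1 = unary k' ∧ u 2 = pack l)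
    (hW : ∀ Y ∈ l, Y.length ≤ W)
    (hA : ∀ Y ∈ l, ERun A₂ (initState [enc x, enc y, unary k, unary k', enc Y]) (L Y) B (s' Y)) :
    ∃ t', ERun (viaKernel s N M A₁ A₂ b) (initState [enc x, unary k]) (l.flatMap L)
      ((3 * s + 10) * (x.length + k + y.length) + (s + 10) * B₁ + Layout.rest A₁ + T +
        l.length * ((2 * s + 10) * (x.length + y.length + k + k' + W) +
        (2 * M + 20) * (3 * B + 2) + N + 16) + 20) t' := by
  set t := initState [enc x, unary k] with ht
  have hq : ∀ q, 2 ≤ q → t q = [] := fun q hq => initState_of_length_le (by simpa using hq)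
  have h0 : t 0 = enc x := rfl
  have h1 : t 1 = unary k := rfl
  have e1 := cp_run (a := 0) (b := 3) (t := 4) (by omega) (by omega) (by omega) s t
    (hq 4 (by omega)) (fun a ha => lt_of_mem_enc (h0 ▸ ha))
  rw [h0, length_enc, hq 3 (by omega), List.append_nil] at e1
  have e2 := cp_run (a := 1) (b := 11) (t := 4) (by omega) (by omega) (by omega) 1
    (Function.update t 3 (enc x)) (by simp [hq]) (fun a ha =>
      eq_zero_of_mem_unary (k := k) (by simpa [h1] using ha))
  simp only [ne_eq, OfNat.one_ne_ofNat, not_false_eq_true, Function.update_of_ne, h1,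
    length_unary, Nat.reduceEqDiff, hq 11 (by omega), List.append_nil] at e2
  have e3 := ERun.push 7 1 (Function.update (Function.update t 3 (enc x)) 11 (unary k))
  simp only [ne_eq, Nat.reduceEqDiff, not_false_eq_true, Function.update_of_ne,
    hq 7 (by omega)] at e3
  set t₃ := Function.update (Function.update (Function.update t 3 (enc x)) 11 (unary k)) 7 [1]
    with ht₃
  obtain ⟨t₄, e4, f1, f2, -, f3⟩ := Layout.watch_first (ℓ := stdLayout s 3 0 (by omega)) hA₁ t₃
    (fun r => by
      show t₃ (8 * r + 3) = _
      rcases r with _ | _ | r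
      · simp [ht₃, h0]
      · simp [ht₃, h1]
      · rw [hq (r + 1 + 1) (by omega), ht₃]
        simp only [Function.update_apply]
        rw [if_neg (by omega), if_neg (by omega), if_neg (by omega), hq _ (by omega)])
    (by show t₃ 7 = _; simp [ht₃])
    (by show t₃ 31 = _; simp [ht₃, hq])
  have g15 : t₄ 15 = (enc y).reverse := by
    have : t₄ 15 = (enc y).reverse ++ t₃ 15 := (f3 _ _ rfl).2 fun a ha => lt_of_mem_enc ha
    rw [this]
    simp [ht₃, hq]
  have hF : ∀ q, q % 8 ≠ 3 → q % 8 ≠ 7 → t₄ q = t q := by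
    intro q a1 a2
    rw [f1 q (fun r => by simp only [stdLayout]; omega) (by simp only [stdLayout]; omega)
      (by simp only [stdLayout]; omega) (by simp only [stdLayout]; omega)
      (by simp only [stdLayout]; omega), ht₃]
    simp only [Function.update_apply]
    rw [if_neg (by omega), if_neg (by omega), if_neg (by omega)]
  have e5 := mv_run (a := 15) (b := 12) (by omega) s _ t₄ g15
    (fun a ha => lt_of_mem_enc (w := y) (by simpa using ha))
  rw [List.reverse_reverse, hF 12 (by omega) (by omega), hq 12 (by omega), List.append_nil] at e5
  set t₅ := Function.update (Function.update t₄ 15 []) 12 (enc y) with ht₅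
  have e6 := cp_run (a := 12) (b := 2) (t := 4) (by omega) (by omega) (by omega) s t₅
    (by simp [ht₅, hF, hq]) (fun a ha => lt_of_mem_enc (w := y) (by simpa [ht₅] using ha))
  have g12 : t₅ 12 = enc y := by simp [ht₅]
  have g2 : t₅ 2 = [] := by simp [ht₅, hF, hq]
  rw [g12, g2, List.append_nil] at e6
  set t₆ := Function.update t₅ 2 (enc y) with ht₆
  obtain ⟨u, hb1, hb2, hb3⟩ := hb
  obtain ⟨t₇, e7, g7, g8⟩ := hb1.rename (σ := fun r => 8 * r + 2)
    (fun a b h => by simp only at h; omega) t₆ (fun r => by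
      rcases r with _ | r
      · simp [ht₆, initState]
      · rw [initState_of_length_le (by simp), ht₆, ht₅]
        simp only [Function.update_apply]
        rw [if_neg (by omega), if_neg (by omega), if_neg (by omega), hF _ (by omega) (by omega),
          hq _ (by omega)])
  have hF' : ∀ q, q % 8 ≠ 2 → q % 8 ≠ 3 → q % 8 ≠ 7 → q ≠ 12 → t₇ q = t q := by
    intro q a1 a2 a3 a4
    rw [g8 q (fun r => by omega), ← hF q a2 a3, ht₆, ht₅]
    simp only [Function.update_apply]
    rw [if_neg (by omega), if_neg (by omega), if_neg (by omega)]
  have hready : Ready x y k k' l t₇ := by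
    refine ⟨?_, ?_, ?_, ?_, (g7 1).trans hb2, ?_, ?_, (g7 2).trans hb3, ?_, ?_⟩
    · rw [hF' _ (by omega) (by omega) (by omega) (by omega), h0]
    · rw [hF' _ (by omega) (by omega) (by omega) (by omega), h1]
    · rw [hF' _ (by omega) (by omega) (by omega) (by omega), hq _ (by omega)]
    · rw [hF' _ (by omega) (by omega) (by omega) (by omega), hq _ (by omega)]
    · rw [g8 12 (fun r => by omega)]
      simp [ht₆, ht₅]
    · rw [hF' _ (by omega) (by omega) (by omega) (by omega), hq _ (by omega)]
    · rw [hF' _ (by omega) (by omega) (by omega) (by omega), hq _ (by omega)]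
    · rw [hF' _ (by omega) (by omega) (by omega) (by omega), hq _ (by omega)]
  obtain ⟨t', e8⟩ := liftLoop_run hN hM hMs l hW hA hready
  refine ⟨t', (e1.seq_silent (e2.seq_silent (e3.seq_silent (e4.seq_silent (e5.seq_silent
    (e6.seq_silent (e7.seq_silent e8))))))).mono ?_⟩
  simp only [stdLayout, List.length_reverse, length_enc]
  have : (2 * s + 7) * x.length + 9 * k + (s + 3) * y.length + (2 * s + 7) * y.length ≤
      (3 * s + 10) * (x.length + k + y.length) := by
    nlinarith [Nat.zero_le (s * k), Nat.zero_le (s * x.length)]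
  omega

namespace ParamEnumProblem

variable {s : ℕ}

/-- An enumeration algorithm from a kernel and a program that computes the parameters and the
solutions of the compressed instances. -/
theorem exists_enumeration (P : ParamEnumProblem s) {A₁ A₂ b : Prog} {y : Word s → Word s}
    {q : Polynomial ℕ}
    (hA₁ : ∀ x, ComputesInTime A₁ [enc x, unary (P.κ x)] (y x) (q.eval (x.length + P.κ x)))
    (hA₂ : P.IsLifting A₂ y) {R : Word s → List (Word s)} {T : Word s → ℕ}
    (hR : ∀ z, (R z).Nodup ∧ (R z).toFinset = P.Sol z)
    (hb : ∀ x, ∃ u, ERun b (initState [enc (y x)]) [] (T (y x)) u ∧ u 1 = unary (P.κ (y x)) ∧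
      u 2 = pack (R (y x))) :
    ∃ (p : Prog) (Q : Polynomial ℕ), ∀ x, EnumeratesWithDelay p [enc x, unary (P.κ x)] (P.Sol x)
      (Q.eval (x.length + P.κ x +
        ((y x).length + P.κ (y x) + (pack (R (y x))).length + T (y x)))) := by
  classical
  obtain ⟨g, S, hS⟩ := hA₂
  obtain ⟨N, hN⟩ := A₂.exists_regsLT
  obtain ⟨M₀, hM₀⟩ := A₂.exists_symLT
  let M := M₀ + s + 1
  refine ⟨viaKernel s N M A₁ A₂ b, .C (3 * s + 10) * .X + .C (s + 10) * q +
    .C (Layout.rest A₁) + .X +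
    .X * (.C (2 * s + 10) * .X + .C (2 * M + 20) * (.C 3 * g + 2) + .C (N + 16)) + 20,
    fun x => ?_⟩
  obtain ⟨hx1, hx2, hx3⟩ := hS x
  have hmem : ∀ Y, Y ∈ R (y x) ↔ Y ∈ P.Sol (y x) := fun Y => by
    rw [← (hR (y x)).2, List.mem_toFinset]
  -- Nothing is known about the lifting algorithm for Y outside of Sol(y); the membership is moved
  -- into the conclusion so that lists and final states can be chosen for all Y.
  have hex : ∀ Y, ∃ (l : List (Word s)) (s' : State), Y ∈ P.Sol (y x) →
      ERun A₂ (initState [enc x, enc (y x), unary (P.κ x), unary (P.κ (y x)), enc Y]) (l.map enc)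
        (g.eval (x.length + (y x).length + P.κ x + P.κ (y x) + Y.length)) s' ∧ l.Nodup ∧
        l.toFinset = S x Y := by
    intro Y
    by_cases hY : Y ∈ P.Sol (y x)
    · obtain ⟨l, s', h⟩ := (hx1 Y hY).exists_erun
      exact ⟨l, s', fun _ => h⟩
    · exact ⟨[], fun _ => [], fun h => (hY h).elim⟩
  choose l s' hl using hex
  set z := x.length + P.κ x + ((y x).length + P.κ (y x) + (pack (R (y x))).length + T (y x))
    with hz
  obtain ⟨τ, s₁, r1, r2, r3⟩ := hA₁ x
  have hrun₁ : ERun A₁ (initState [enc x, unary (P.κ x)]) [enc (y x)]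
      (q.eval (x.length + P.κ x)) s₁ := ⟨τ, r1, r2, τ.delayLE_length.mono r3⟩
  obtain ⟨t', e⟩ := viaKernel_run (N := N) (M := M) (L := fun Y => (l Y).map enc) (s' := s')
    (B := g.eval z)
    hN (hM₀.mono (by omega)) (by omega) hrun₁ (hb x)
    (fun Y hY => length_le_length_pack_of_mem hY) (fun Y hY =>
      (hl Y ((hmem Y).1 hY)).1.mono (polynomial_eval_mono g (by
        have := length_le_length_pack_of_mem hY
        omega)))
  rw [← List.map_flatMap] at e
  refine .of_erun e ?_ ?_ ?_
  · rw [List.nodup_flatMap]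
    refine ⟨fun Y hY => (hl Y ((hmem Y).1 hY)).2.1, ?_⟩
    refine (hR (y x)).1.imp_of_mem fun {Y Y'} hY hY' hne => ?_
    have := hx2 ((hmem Y).1 hY) ((hmem Y').1 hY') hne
    simp only [Function.onFun] at this ⊢
    rw [← (hl Y ((hmem Y).1 hY)).2.2, ← (hl Y' ((hmem Y').1 hY')).2.2] at this
    intro a ha ha'
    exact Finset.disjoint_left.1 this (List.mem_toFinset.2 ha) (List.mem_toFinset.2 ha')
  · rw [← hx3]
    ext a
    simp only [List.mem_toFinset, List.mem_flatMap, Finset.mem_biUnion]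
    constructor
    · rintro ⟨Y, hY, ha⟩
      refine ⟨Y, (hmem Y).1 hY, ?_⟩
      rw [← (hl Y ((hmem Y).1 hY)).2.2]
      exact List.mem_toFinset.2 ha
    · rintro ⟨Y, hY, ha⟩
      refine ⟨Y, (hmem Y).2 hY, ?_⟩
      rw [← (hl Y hY).2.2] at ha
      exact List.mem_toFinset.1 ha
  · simp only [Polynomial.eval_add, Polynomial.eval_mul, Polynomial.eval_C, Polynomial.eval_X,
      Polynomial.eval_ofNat]
    have h1 : (3 * s + 10) * (x.length + P.κ x + (y x).length) ≤ (3 * s + 10) * z :=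
      Nat.mul_le_mul_left _ (by omega)
    have h2 : (s + 10) * q.eval (x.length + P.κ x) ≤ (s + 10) * q.eval z :=
      Nat.mul_le_mul_left _ (polynomial_eval_mono q (by omega))
    -- Each packed word occupies at least one symbol, so the packed length bounds both the number of
    -- solutions and the length of each.
    have h3 : (R (y x)).length * ((2 * s + 10) * (x.length + (y x).length + P.κ x + P.κ (y x) +
        (pack (R (y x))).length) + (2 * M + 20) * (3 * g.eval z + 2) + N + 16) ≤
        z * ((2 * s + 10) * z + (2 * M + 20) * (3 * g.eval z + 2) + (N + 16)) := by
      refine Nat.mul_le_mul ?_ ?_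
      · have := length_le_length_pack (R (y x))
        omega
      · have : (2 * s + 10) * (x.length + (y x).length + P.κ x + P.κ (y x) +
            (pack (R (y x))).length) ≤ (2 * s + 10) * z := Nat.mul_le_mul_left _ (by omega)
        omega
    omega

end ParamEnumProblem

/-! ### Kernels of constant size -/

/-- Look up the word in register `0` in a table; the values of `f` and `g` are put into the
registers `1` and `2`. -/
def table {s : ℕ} (f g : Word s → List ℕ) : ℕ → List (Word s) → Prog
  | _, [] => .skip
  | i, w :: l => .seq (cp s 0 (i + 4) 3)
      (ifEq (i + 4) (enc w) (.seq (put 1 (f w)) (put 2 (g w))) (table f g (i + 1) l))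

/-- Each comparison gets a fresh scratch register, since a failed one leaves an unknown rest behind.
For the same reason the bound B precedes the quantifier over t: the search must go on with one
bound, whatever the rest is. -/
theorem table_run {s : ℕ} (f g : Word s → List ℕ) {y : Word s} {l : List (Word s)} (hy : y ∈ l)
    (i : ℕ) : ∃ B, ∀ t : State, t 0 = enc y → t 1 = [] → t 2 = [] → t 3 = [] →
      (∀ r, i + 4 ≤ r → t r = []) →
      ∃ u, ERun (table f g i l) t [] B u ∧ u 1 = f y ∧ u 2 = g y := by
  induction l generalizing i with
  | nil => simp at hy
  | cons w l ih =>
    have e1 : ∀ t : State, t 0 = enc y → t 3 = [] → (∀ r, i + 4 ≤ r → t r = []) →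
        ERun (cp s 0 (i + 4) 3) t [] ((2 * s + 7) * y.length + 2)
          (Function.update t (i + 4) (enc y)) := by
      intro t h0 h3 h
      have := cp_run (a := 0) (b := i + 4) (t := 3) (by omega) (by omega) (by omega) s t h3
        (fun a ha => lt_of_mem_enc (w := y) (h0 ▸ ha))
      rwa [h0, length_enc, h _ le_rfl, List.append_nil] at this
    by_cases hw : y = w
    · subst hw
      refine ⟨_, fun t h0 h1 h2 h3 h => ⟨_, (e1 t h0 h3 h).seq_silent (ifEq_run_eq _ (by simp)
        ((put_run 1 (f y) _).seq_silent (put_run 2 (g y) _))), ?_, ?_⟩⟩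
      · simp [h1]
      · simp [h2]
    · obtain ⟨B, hB⟩ := ih ((List.mem_cons.1 hy).resolve_left hw) (i + 1)
      refine ⟨(2 * s + 7) * y.length + 2 + (B + 2 * (enc w).length + 1), fun t h0 h1 h2 h3 h => ?_⟩
      choose u hu hu1 hu2 using fun l : List ℕ =>
        hB (Function.update (Function.update t (i + 4) (enc y)) (i + 4) l) (by simpa using h0)
          (by simpa using h1) (by simpa using h2) (by simpa using h3) (fun r hr => by
            rw [Function.update_of_ne (by omega), Function.update_of_ne (by omega), h r (by omega)])
      obtain ⟨l, hl⟩ := ifEq_run_ne (enc w) (p := .seq (put 1 (f w)) (put 2 (g w)))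
        (s := Function.update t (i + 4) (enc y)) (by simpa [enc_injective.eq_iff] using hw) hu
      exact ⟨u l, ((e1 t h0 h3 h).seq_silent hl).mono (by omega), hu1 l, hu2 l⟩

theorem EnumeratesWithDelay.mono {s : ℕ} {p : Prog} {inputs : List (List ℕ)}
    {S : Finset (Word s)} {B B' : ℕ} (h : EnumeratesWithDelay p inputs S B) (hB : B ≤ B') :
    EnumeratesWithDelay p inputs S B' := by
  obtain ⟨τ, s', l, h1, h2, h3, h4, h5⟩ := h
  exact ⟨τ, s', l, h1, h2, h3, h4, h5.mono hB⟩

namespace ParamEnumProblem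

variable {s : ℕ}

/-- Only the finitely many words of length at most C occur as kernels, so a table replaces the
computation of κ and Sol, and D bounds everything that depends on y. -/
theorem HasConstantSizePDKernel.hasPolyDelayAlgorithm {P : ParamEnumProblem s}
    (hκ : P.PolyBoundedParameter) (h : P.HasConstantSizePDKernel) : P.HasPolyDelayAlgorithm := by
  obtain ⟨q₀, hq₀⟩ := hκ
  obtain ⟨A₁, A₂, f, -, ⟨C, hC⟩, y, ⟨⟨q, hA₁⟩, hy⟩, hA₂⟩ := h
  have hfin : {z : Word s | z.length ≤ C}.Finite := List.finite_length_le _ C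
  have hyC (x : Word s) : y x ∈ {z : Word s | z.length ≤ C} := (hy x).2.1.trans (hC _)
  have hex (z : Word s) : ∃ B, z ∈ {z : Word s | z.length ≤ C} →
      ∃ u, ERun (table (fun z => unary (P.κ z)) (fun z => pack (P.Sol z).toList) 0
        hfin.toFinset.toList) (initState [enc z]) [] B u ∧ u 1 = unary (P.κ z) ∧
        u 2 = pack (P.Sol z).toList := by
    by_cases hz : z ∈ {z : Word s | z.length ≤ C}
    · obtain ⟨B, hB⟩ := table_run (fun z => unary (P.κ z)) (fun z => pack (P.Sol z).toList)
        (y := z) (l := hfin.toFinset.toList) (by simpa using hz) 0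
      exact ⟨B, fun _ => hB _ rfl rfl rfl rfl fun r hr => initState_of_length_le (by simp; omega)⟩
    · exact ⟨0, fun h => (hz h).elim⟩
  choose T hT using hex
  obtain ⟨p, Q, hp⟩ := P.exists_enumeration hA₁ hA₂ (R := fun z => (P.Sol z).toList) (T := T)
    (fun z => ⟨Finset.nodup_toList _, Finset.toList_toFinset _⟩) (fun x => hT _ (hyC x))
  obtain ⟨D, hD⟩ := (hfin.image fun z => z.length + P.κ z + (pack (P.Sol z).toList).length +
    T z).bddAbove
  obtain ⟨K, e, hK⟩ := exists_polynomial_bound (Q.comp (.X + q₀ + .C D))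
  refine ⟨p, fun _ => K, .const K, ⟨K, fun _ => le_rfl⟩, e, fun x => ?_⟩
  have h1 := hD ⟨y x, hyC x, rfl⟩
  have h2 := hq₀ x
  refine (hp x).mono ((polynomial_eval_mono Q ?_).trans
    ((le_of_eq (by rw [Polynomial.eval_comp])).trans (hK x.length)))
  simp only [Polynomial.eval_add, Polynomial.eval_X, Polynomial.eval_C]
  beta_reduce at h1
  omega

end ParamEnumProblem

/-! ### Compiling computable functions on words -/

/-- Do `c a` if the top of register `0` is `a < n`. -/
def dispatch (c : ℕ → Prog) : ℕ → Prog
  | 0 => .skip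
  | n + 1 => .ifTop 0 (some n) (c n) (dispatch c n)

theorem dispatch_run {c : ℕ → Prog} {n a : ℕ} (ha : a < n) {t t' : State}
    (h0 : (t 0).head? = some a) (h : ∃ B, ERun (c a) t [] B t') :
    ∃ B, ERun (dispatch c n) t [] B t' := by
  induction n with
  | zero => omega
  | succ n ih =>
    by_cases hn : a = n
    · subst hn
      obtain ⟨B, hB⟩ := h
      exact ⟨_, hB.ifTop_true h0⟩
    · obtain ⟨B, hB⟩ := ih (by omega)
      exact ⟨_, hB.ifTop_false (by rw [h0]; simpa using hn)⟩

/-- If register `2` contains `k < n` in unary, then push `i + k` on register `0`. -/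
def pushValue : ℕ → ℕ → Prog
  | _, 0 => .skip
  | i, n + 1 => .ifTop 2 none (.push 0 i) (.seq (.pop 2) (pushValue (i + 1) n))

/-- Only constants can be pushed, so turning a number into a symbol is a finite case distinction;
hence a bound n on the symbols is required. -/
theorem pushValue_run {k n : ℕ} (hk : k < n) (i : ℕ) (v w : List ℕ) :
    ∃ B, ERun (pushValue i n) (initState [v, w, unary k]) [] B (initState [(i + k) :: v, w]) := by
  induction n generalizing i k with
  | zero => omega
  | succ n ih =>
    have e0 : initState [(i + k) :: v, w] = initState [(i + k) :: v, w, []] :=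
      (initState_append_replicate [(i + k) :: v, w] 1).symm
    rw [e0]
    rcases k with _ | k
    · refine ⟨_, ((ERun.push 0 i _).cast ?_).ifTop_true rfl⟩
      rw [update_initState _ _ _ (by simp)]
      simp [initState, unary]
    · obtain ⟨B, hB⟩ := ih (show k < n by omega) (i + 1)
      refine ⟨_, (((ERun.pop 2 _).cast (s₂ := initState [v, w, unary k]) ?_).seq_silent
        hB).ifTop_false (by simp [initState, unary, List.replicate_succ]) |>.cast ?_⟩
      · rw [update_initState _ _ _ (by simp)]
        simp [initState, unary, List.replicate_succ]
      · rw [← e0]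
        congr 3
        omega

theorem encode_eq_encode_enc {s : ℕ} (w : Word s) :
    Encodable.encode w = Encodable.encode (enc w) := by
  induction w with
  | nil => rfl
  | cons a w ih => rw [Encodable.encode_list_cons, ih]; rfl

/-- The code of a :: v is `Nat.pair a (encode v)` plus one, a computable function of the code of v
for each of the finitely many symbols a. Reading from the top, the loop builds the code of the
reversed word. -/
theorem encode_run {p : ℕ → Prog}
    (hp : ∀ a n, ∃ B, ERun (p a) (initState [unary n]) [] B (initState [unary (Nat.pair a n).succ]))
    {s : ℕ} {w : List ℕ} (hw : ∀ a ∈ w, a < s) (v : List ℕ) :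
    ∃ B, ERun (.loop 0 (dispatch (fun a => .seq (.pop 0) ((p a).rename (· + 1))) s))
      (initState [w, unary (Encodable.encode v)]) [] B
      (initState [[], unary (Encodable.encode (w.reverse ++ v))]) := by
  induction w generalizing v with
  | nil => exact ⟨_, ERun.loop_done rfl⟩
  | cons a w ih =>
    obtain ⟨B₂, h2⟩ := ih (fun b hb => hw b (by simp [hb])) (a :: v)
    obtain ⟨B₀, h0⟩ := hp a (Encodable.encode v)
    have e0 := ERun.pop 0 (initState [a :: w, unary (Encodable.encode v)])
    rw [update_initState _ _ _ (by simp)] at e0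
    have e1 := h0.shift 1 (initState [w, unary (Encodable.encode v)]) rfl (by
      rintro (_ | _ | r) hr <;> first | omega | rfl)
    rw [update_initState _ _ _ (by simp)] at e1
    simp only [List.set_cons_zero, List.set_cons_succ, initState_apply, List.getD_cons_zero,
      List.tail_cons] at e0 e1
    obtain ⟨B₁, h1⟩ := dispatch_run (c := fun a => .seq (.pop 0) ((p a).rename (· + 1)))
      (hw a (by simp)) (t := initState [a :: w, unary (Encodable.encode v)]) rfl
      ⟨_, e0.seq_silent e1⟩
    rw [← show Encodable.encode (a :: v) = (Nat.pair a (Encodable.encode v)).succ from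
      Encodable.encode_list_cons a v] at h1
    refine ⟨_, ERun.loop_step_silent (by simp [initState]) h1 h2 |>.cast ?_⟩
    simp

/-- The empty list has code 0 and every other code is positive, so the unary register is empty
exactly when the list is used up. The entries are pushed in turn, which reverses the list. -/
theorem decode_run {p q : Prog}
    (hp : ∀ l : List ℕ, ∃ B, ERun p (initState [unary (Encodable.encode l)]) [] B
      (initState [unary l.headI]))
    (hq : ∀ l : List ℕ, ∃ B, ERun q (initState [unary (Encodable.encode l)]) [] B
      (initState [unary (Encodable.encode l.tail)]))
    {s : ℕ} {w : List ℕ} (hw : ∀ a ∈ w, a < s) (v : List ℕ) :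
    ∃ B, ERun (.loop 1 (.seq (cp 1 1 2 3) (.seq (p.rename (· + 2)) (.seq (pushValue 0 s)
      (q.rename (· + 1)))))) (initState [v, unary (Encodable.encode w)]) [] B
      (initState [w.reverse ++ v, []]) := by
  induction w generalizing v with
  | nil => exact ⟨_, ERun.loop_done rfl⟩
  | cons a w ih =>
    obtain ⟨B₂, h2⟩ := ih (fun b hb => hw b (by simp [hb])) (a :: v)
    obtain ⟨B₀, h0⟩ := hp (a :: w)
    obtain ⟨B₁, h1⟩ := hq (a :: w)
    set m := Encodable.encode (a :: w) with hm
    have e0 := cp_run (a := 1) (b := 2) (t := 3) (by simp) (by simp) (by simp) 1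
      (initState [v, unary m, []]) rfl (fun x hx => eq_zero_of_mem_unary (k := m) hx)
    rw [update_initState _ _ _ (by simp)] at e0
    have e1 := h0.shift 2 (initState [v, unary m, unary m]) rfl (by
      rintro (_ | _ | _ | r) hr <;> first | omega | rfl)
    rw [update_initState _ _ _ (by simp)] at e1
    obtain ⟨B₃, e2⟩ := pushValue_run (hw a (by simp)) 0 v (unary m)
    have e3 := h1.shift 1 (initState [a :: v, unary m]) rfl (by
      rintro (_ | _ | r) hr <;> first | omega | rfl)
    rw [update_initState _ _ _ (by simp)] at e3
    simp only [List.set_cons_zero, List.set_cons_succ, initState_apply, List.getD_cons_zero,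
      List.getD_cons_succ, List.tail_cons, List.headI_cons, List.append_nil, zero_add]
      at e0 e1 e2 e3
    have e : initState [v, unary m] = initState [v, unary m, []] :=
      (initState_append_replicate [v, unary m] 1).symm
    rw [← e] at e0
    refine ⟨_, ERun.loop_step_silent ?_ (e0.seq_silent (e1.seq_silent (e2.seq_silent e3))) h2
      |>.cast ?_⟩
    · simp [initState, hm, unary]
    · simp

/-- Every computable function on words is computed, in register `0`, by a program. -/
theorem exists_prog_of_computable_word {s M : ℕ} {h : Word s → List ℕ} (hh : Computable h)
    (hM : ∀ y, ∀ a ∈ h y, a < M) :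
    ∃ p : Prog, ∀ y, ∃ B, ERun p (initState [enc y]) [] B (initState [h y]) := by
  have hc (a : ℕ) : Computable fun n => (Nat.pair a n).succ :=
    (Primrec.succ.comp (Primrec₂.natPair.comp (.const a) .id)).to_comp
  choose p hp using fun a => exists_prog_of_computable (hc a)
  -- The inner reversal undoes the one by `encode_run`, the outer one anticipates the one by
  -- `decode_run`.
  have hH : Computable fun n => Encodable.encode
      (h ((Encodable.decode (α := Word s) n).getD []).reverse).reverse :=
    Computable.encode.comp (Computable.list_reverse.comp (hh.comp (Computable.list_reverse.comp
      (Computable.option_getD Computable.decode (.const [])))))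
  obtain ⟨H, hH⟩ := exists_prog_of_computable hH
  have hd : Computable fun n => ((Encodable.decode (α := List ℕ) n).getD []).headI :=
    (Primrec.list_headI.comp (Primrec.option_getD.comp .decode (.const []))).to_comp
  obtain ⟨d, hd⟩ := exists_prog_of_computable hd
  have ht : Computable fun n =>
      Encodable.encode ((Encodable.decode (α := List ℕ) n).getD []).tail :=
    (Primrec.encode.comp (Primrec.list_tail.comp
      (Primrec.option_getD.comp .decode (.const [])))).to_comp
  obtain ⟨q, hq⟩ := exists_prog_of_computable ht
  refine ⟨.seq (.loop 0 (dispatch (fun a => .seq (.pop 0) ((p a).rename (· + 1))) s))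
    (.seq (H.rename (· + 1)) (.loop 1 (.seq (cp 1 1 2 3) (.seq (d.rename (· + 2))
      (.seq (pushValue 0 M) (q.rename (· + 1))))))), fun y => ?_⟩
  obtain ⟨B₁, e1⟩ := encode_run hp (w := enc y) (s := s) (fun a ha => lt_of_mem_enc ha) []
  have e : (enc y).reverse = enc y.reverse := by simp [enc]
  rw [List.append_nil, e, ← encode_eq_encode_enc] at e1
  obtain ⟨B₂, e2⟩ := hH (Encodable.encode y.reverse)
  rw [Encodable.encodek, Option.getD_some, List.reverse_reverse] at e2
  have e2 := e2.shift 1 (initState [[], unary (Encodable.encode y.reverse)]) rfl (by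
      rintro (_ | _ | r) hr <;> first | omega | rfl)
  rw [update_initState _ _ _ (by simp)] at e2
  obtain ⟨B₃, e3⟩ := decode_run (p := d) (q := q) (fun l => by simpa using hd (Encodable.encode l))
    (fun l => by simpa using hq (Encodable.encode l)) (w := (h y).reverse) (s := M)
    (by simpa using hM y) []
  rw [List.reverse_reverse, List.append_nil] at e3
  simp only [List.set_cons_zero, List.set_cons_succ] at e2
  have i1 : initState [enc y] = initState [enc y, unary (Encodable.encode ([] : List ℕ))] :=
    (initState_append_replicate [enc y] 1).symm
  have i2 : initState [h y] = initState [h y, []] := (initState_append_replicate [h y] 1).symm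
  rw [i1, i2]
  exact ⟨_, e1.seq_silent (e2.seq_silent e3)⟩

/-! ### Kernels with computable parameter -/

theorem primrec_enc {s : ℕ} : Primrec (enc (s := s)) :=
  Primrec.list_map .id (Primrec.fin_val.comp .snd).to₂

theorem primrec_pack {s : ℕ} : Primrec (pack (s := s)) :=
  Primrec.list_flatMap .id (Primrec.list_append.comp
    (Primrec.list_reverse.comp (primrec_enc.comp .snd)) (.const [s])).to₂

/-- The computable list of solutions may contain repetitions, which would lead to repeated outputs;
they have to be removed computably. -/
theorem primrec_foldr_insert {α : Type*} [Primcodable α] [DecidableEq α] [BEq α] [LawfulBEq α] :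
    Primrec fun l : List α => l.foldr List.insert [] := by
  have hmem : PrimrecRel fun (l : List α) (a : α) => ∃ b ∈ l, b = a :=
    PrimrecRel.exists_mem_list Primrec.eq
  have : Primrec₂ fun (_ : List α) (p : α × List α) => if ∃ b ∈ p.2, b = p.1 then p.2 else
      p.1 :: p.2 :=
    Primrec.ite (hmem.comp (Primrec.snd.comp Primrec.snd) (Primrec.fst.comp Primrec.snd))
      (Primrec.snd.comp Primrec.snd)
      (Primrec.list_cons.comp (Primrec.fst.comp Primrec.snd) (Primrec.snd.comp Primrec.snd))
  refine (Primrec.list_foldr .id (.const []) this).of_eq fun l => ?_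
  simp only [exists_eq_right, id]
  congr 1
  funext a m
  simp [List.insert]

theorem nodup_foldr_insert {α : Type*} [BEq α] [LawfulBEq α] (l : List α) :
    (l.foldr List.insert []).Nodup := by
  induction l with
  | nil => exact List.nodup_nil
  | cons a l ih => exact ih.insert

theorem toFinset_foldr_insert {α : Type*} [DecidableEq α] [BEq α] [LawfulBEq α] (l : List α) :
    (l.foldr List.insert []).toFinset = l.toFinset := by
  induction l with
  | nil => rfl
  | cons a l ih => rw [List.foldr_cons, List.toFinset_cons, ← ih]; ext; simp

/-- Symbols are less than s and pairing is monotone, so iterating e ↦ `Nat.pair s e` + 1 dominates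
the codes. -/
theorem exists_encode_le (s : ℕ) : ∃ E : ℕ → ℕ, Computable E ∧ ∀ (w : Word s) (n : ℕ),
    w.length ≤ n → Encodable.encode w ≤ E n := by
  refine ⟨fun n => n.rec 0 fun _ e => (Nat.pair s e).succ, ?_, fun w => ?_⟩
  · exact Computable.nat_rec .id (.const 0) (Primrec.succ.comp (Primrec₂.natPair.comp (.const s)
      (Primrec.snd.comp .snd))).to_comp.to₂
  · induction w with
    | nil => intro n _; simp
    | cons a w ih =>
      rintro (_ | n) hn
      · simp at hn
      · have h1 := ih n (by simpa using hn)
        rw [Encodable.encode_list_cons]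
        refine Nat.succ_le_succ ?_
        refine (Nat.pair_lt_pair_left _ (show Encodable.encode a < s from a.2)).le.trans ?_
        exact (strictMono_nat_of_lt_succ (f := Nat.pair s)
          fun n => Nat.pair_lt_pair_right s n.lt_succ_self).monotone h1

/-- The values of a computable function on the words of bounded length are bounded by a computable
function of the length. -/
theorem exists_computable_bound {s : ℕ} {V : Word s → ℕ} (hV : Computable V) :
    ∃ H : ℕ → ℕ, Computable H ∧ ∀ (w : Word s) (n : ℕ), w.length ≤ n → V w ≤ H n := by
  obtain ⟨E, hE, hE'⟩ := exists_encode_le s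
  -- Summing V over all codes up to E(n) avoids deciding which of them belong to short words;
  -- invalid codes count as the empty word.
  let S : ℕ → ℕ := fun m => m.rec 0 fun i r => r + V ((Encodable.decode (α := Word s) i).getD [])
  have hS : Computable S := Computable.nat_rec .id (.const 0)
    (Primrec.nat_add.to_comp.comp (Computable.snd.comp .snd) (hV.comp (Computable.option_getD
      (Computable.decode.comp (Computable.fst.comp .snd)) (.const [])))).to₂
  have hmono : Monotone S := monotone_nat_of_le_succ fun m => Nat.le_add_right _ _
  refine ⟨fun n => S (E n + 1), hS.comp (Computable.succ.comp hE), fun w n hn => ?_⟩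
  refine le_trans ?_ (hmono (Nat.succ_le_succ (hE' w n hn)))
  show V w ≤ _ + V ((Encodable.decode (α := Word s) (Encodable.encode w)).getD [])
  rw [Encodable.encodek]
  exact Nat.le_add_left _ _

/-- Two computable functions on words are computed simultaneously by a program. -/
theorem exists_prog_pair {s M : ℕ} {f g : Word s → List ℕ} (hf : Computable f) (hg : Computable g)
    (hfM : ∀ y, ∀ a ∈ f y, a < M) (hgM : ∀ y, ∀ a ∈ g y, a < M) :
    ∃ p : Prog, ∀ y, ∃ B u, ERun p (initState [enc y]) [] B u ∧ u 1 = f y ∧ u 2 = g y := by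
  obtain ⟨p, hp⟩ := exists_prog_of_computable_word hf hfM
  obtain ⟨q, hq⟩ := exists_prog_of_computable_word hg hgM
  refine ⟨.seq (cp s 0 1 3) (.seq (cp s 0 2 3) (.seq (p.rename fun r => 3 * r + 1)
    (q.rename fun r => 3 * r + 2))), fun y => ?_⟩
  obtain ⟨B₁, h1⟩ := hp y
  obtain ⟨B₂, h2⟩ := hq y
  have i : initState [enc y] = initState [enc y, [], [], []] :=
    (initState_append_replicate [enc y] 3).symm
  have e1 := cp_run (a := 0) (b := 1) (t := 3) (by simp) (by simp) (by simp) s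
    (initState [enc y, [], [], []]) rfl (fun a ha => lt_of_mem_enc (w := y) ha)
  rw [update_initState _ _ _ (by simp)] at e1
  have e2 := cp_run (a := 0) (b := 2) (t := 3) (by simp) (by simp) (by simp) s
    (initState [enc y, enc y, [], []]) rfl (fun a ha => lt_of_mem_enc (w := y) ha)
  rw [update_initState _ _ _ (by simp)] at e2
  simp only [List.set_cons_zero, List.set_cons_succ, initState_apply, List.getD_cons_zero,
    List.getD_cons_succ, List.append_nil] at e1 e2
  obtain ⟨t, e3, g1, g2⟩ := h1.rename (σ := fun r => 3 * r + 1)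
    (fun a b h => by simp only at h; omega)
    (initState [enc y, enc y, enc y, []]) (by
      rintro (_ | r)
      · rfl
      · rw [initState_of_length_le (by simp), initState_of_length_le (by simp)])
  obtain ⟨t', e4, g3, g4⟩ := h2.rename (σ := fun r => 3 * r + 2)
    (fun a b h => by simp only at h; omega) t (by
      rintro (_ | r)
      · exact g2 2 fun r => by omega
      · rw [g2 _ fun r => by omega, initState_of_length_le (by simp; omega),
          initState_of_length_le (by simp)])
  rw [i]
  refine ⟨_, t', e1.seq_silent (e2.seq_silent (e3.seq_silent e4)), ?_, g3 0⟩
  rw [g4 1 fun r => by omega]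
  exact g1 0

theorem lt_of_mem_pack {s a : ℕ} {l : List (Word s)} (h : a ∈ pack l) : a < s + 1 := by
  simp only [pack, List.mem_flatMap, List.mem_append, List.mem_reverse, List.mem_singleton] at h
  obtain ⟨w, -, h | rfl⟩ := h
  · exact (lt_of_mem_enc h).trans (Nat.lt_succ_self s)
  · exact Nat.lt_succ_self _

namespace ParamEnumProblem

variable {s : ℕ}

/-- Computability of κ is used twice: to supply κ(y) to the lifting algorithm, and to bound κ(y),
the solutions of y and the time to find them by a computable function `H` of the length bound
f(κ(x)). -/
theorem HasPDKernel.hasFPTDelayAlgorithm {P : ParamEnumProblem s} (hκ : Computable P.κ)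
    (h : P.HasPDKernel) : P.HasFPTDelayAlgorithm := by
  obtain ⟨A₁, A₂, f, hf, y, ⟨⟨q, hA₁⟩, hy⟩, hA₂⟩ := h
  obtain ⟨g, hg, hgS⟩ := P.computable_Sol
  let R : Word s → List (Word s) := fun z => (g z).foldr List.insert []
  have hR : Computable R := primrec_foldr_insert.to_comp.comp hg
  have hpack : Computable fun z => pack (R z) := primrec_pack.to_comp.comp hR
  obtain ⟨b, hb⟩ := exists_prog_pair (M := s + 1) (primrec_unary.to_comp.comp hκ) hpack
    (fun z a ha => (eq_zero_of_mem_unary ha).trans_le (by omega)) (fun z a ha => lt_of_mem_pack ha)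
  choose B u hrun hu1 hu2 using hb
  -- The bounds `B` come from choice; the exact running time `T` is computable, as `H` requires.
  obtain ⟨T, hT, hT'⟩ := exists_computable_time b (fun z : Word s => initState [enc z])
    (computable_take_initState primrec_enc) u (fun z => ⟨_, hrun z⟩)
  obtain ⟨p, Q, hp⟩ := P.exists_enumeration hA₁ hA₂ (R := R) (T := T)
    (fun z => ⟨nodup_foldr_insert _, (toFinset_foldr_insert _).trans (hgS z)⟩)
    (fun x => ⟨u (y x), .of_run (hT' _) le_rfl, hu1 _, hu2 _⟩)
  have hadd {a b : Word s → ℕ} (ha : Computable a) (hb : Computable b) :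
      Computable fun z => a z + b z := Primrec.nat_add.to_comp.comp ha hb
  obtain ⟨H, hH, hH'⟩ := exists_computable_bound
    (hadd (hadd (hadd Computable.list_length hκ) (Computable.list_length.comp hpack)) hT)
  obtain ⟨K, e, hK⟩ := exists_polynomial_bound Q
  have hpow : Primrec₂ ((· ^ ·) : ℕ → ℕ → ℕ) := Primrec₂.unpaired'.1 Nat.Primrec.pow
  refine ⟨p, fun k => K * (k + H (f k) + 1) ^ e, ?_, e, fun x => (hp x).mono ?_⟩
  · exact Primrec.nat_mul.to_comp.comp (.const K) (hpow.to_comp.comp (Computable.succ.comp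
      (Primrec.nat_add.to_comp.comp .id (hH.comp hf))) (.const e))
  · have h1 := hH' (y x) _ (hy x).2.1
    rw [mul_assoc, ← mul_pow]
    refine (hK _).trans (Nat.mul_le_mul_left K (Nat.pow_le_pow_left ?_ e))
    -- With H standing for H(f(k)), this is |x| + k + H + 1 ≤ (k + H + 1)(|x| + 1), which separates
    -- the parameter from the length.
    nlinarith [Nat.zero_le ((P.κ x + H (f (P.κ x))) * x.length)]

end ParamEnumProblem

end PDKernel

theorem mainTheorem2 {s : ℕ} (P : PDKernel.ParamEnumProblem s) :
    ((P.HasFPTDelayAlgorithm → P.HasPDKernel) ∧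
      (Computable P.κ → P.HasPDKernel → P.HasFPTDelayAlgorithm)) ∧
    ((P.HasPolyDelayAlgorithm → P.HasConstantSizePDKernel) ∧
      (P.PolyBoundedParameter → P.HasConstantSizePDKernel → P.HasPolyDelayAlgorithm)) :=
  ⟨⟨fun h => h.hasPDKernel, fun hκ h => h.hasFPTDelayAlgorithm hκ⟩,
    fun h => h.hasConstantSizePDKernel, fun hκ h => h.hasPolyDelayAlgorithm hκ⟩
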